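/- All vector spaces are over $\mathbb{C}$. A vertex algebra is a vector space $V$ with bilinear products $(a,b)\mapsto a(n)b$ $(n\in\mathbb{Z})$, written $Y(a,z)=\sum_{n}a(n)z^{-n-1}$, and a vector $\mathbf 1\neq 0$, such that $a(n)b=0$ for $n\gg 0$; $a(n)\mathbf 1=0$ for $n\ge 0$ and $a(-1)\mathbf 1=a$; and the Borcherds identity holds. Put $T_Va=a(-2)\mathbf 1$. A *VH pair* $(V,H)$ is a vertex algebra $V$ with a finite-dimensional subspace $H\subset V$ such that, for all $h,h'\in H$, $h(1)h'\in\mathbb{C}\mathbf 1$, $h(n)h'=0$ for $n=0$ and for $n\ge 2$, and the bilinear form on $H$ given by $h(1)h'=(h,h')\mathbf 1$ is non-degenerate. A morphism $(V,H_V)\to(W,H_W)$ is a vertex algebra homomorphism $f$ with $f(H_V)=H_W$. An *AH pair* $(A,H)$ is a finite-dimensional vector space $H$ with a non-degenerate symmetric bilinear form and a non-zero unital associative algebra $A=\bigoplus_{\alpha\in H}A^\alpha$ such that $1\in A^0$; $A^\alpha A^\beta\subset A^{\alpha+\beta}$; $A^\alpha A^\beta\ne 0$ implies $(\alpha,\beta)\in\mathbb{Z}$;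 and $vw=(-1)^{(\alpha,\beta)}wv$ for $v\in A^\alpha$, $w\in A^\beta$ (read as $vw=wv=0$ if $(\alpha,\beta)\notin\mathbb{Z}$). A morphism $(A,H_A)\to(B,H_B)$ is a pair $(f,f')$ of a unital algebra homomorphism $f:A\to B$ and an isometric linear isomorphism $f':H_A\to H_B$ with $f(A^\alpha)\subset B^{f'(\alpha)}$ for all $\alpha$. *The functor $\mathcal V$.* Let $M_H(0)$ be the Fock space (Heisenberg vertex algebra) of level one of $H$, that is, the symmetric algebra of $H\otimes t^{-1}\mathbb{C}[t^{-1}]$ with the action of operators $h(n)$ satisfying $[h(m),h'(n)]=m(h,h')\delta_{m+n,0}$, $h(0)=0$, and $h(n)\mathbf 1=0$ for $n\ge 0$. For an AH pair $(A,H)$ let $\mathcal V(A,H)=(M_H(0)\otimes A,H)$, with vacuum $\mathbf 1\otimes 1$, with $H$ embedded by $h\mapsto h(-1)\mathbf 1\otimes 1$, and with the vertex algebra structure generated by the following fields, where $v\in M_H(0)$ and $b\in A^\beta$: $Y(h(-1)\mathbf 1\otimes 1,z)=\sum_n h(n)z^{-n-1}$ with $h(0)(v\otimes b)=(h,\beta)\,v\otimes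 b$ and $h(n)(v\otimes b)=h(n)v\otimes b$ for $n\neq0$; and, for $a\in A^\alpha$, $$Y(\mathbf 1\otimes a,z)(v\otimes b)=z^{(\alpha,\beta)}\exp\Bigl(\sum_{n\ge1}\tfrac{\alpha(-n)}{n}z^n\Bigr)\exp\Bigl(\sum_{n\ge1}\tfrac{\alpha(n)}{-n}z^{-n}\Bigr)v\otimes ab$$ (zero if $(\alpha,\beta)\notin\mathbb{Z}$, as then $ab=0$). A morphism $(f,f')$ is sent to $M(f')\otimes f$, where $M(f'):M_{H_A}(0)\to M_{H_B}(0)$ is induced by $f'$. *The functor $\Omega$.* For a VH pair $(V,H)$ let $\omega_H=\frac12\sum_i h_i(-1)h^i$ for a basis $\{h_i\}$ of $H$ with dual basis $\{h^i\}$. For $\alpha\in H$ let $\Omega^\alpha_{V,H}$ be the space of all $v\in V$ with $T_Vv=\omega_H(0)v$, $h(n)v=0$ and $h(0)v=(h,\alpha)v$ for all $h\in H$ and $n\ge1$. Let $\Omega_{V,H}=\bigoplus_{\alpha\in H}\Omega^\alpha_{V,H}\subset V$, with unit $\mathbf 1$ and with the product, for $v\in\Omega^\alpha_{V,H}$ and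 $w\in\Omega^\beta_{V,H}$, $vw=v(-(\alpha,\beta)-1)w$ if $Y(v,z)w\ne0$ (in which case $(\alpha,\beta)\in\mathbb{Z}$) and $vw=0$ otherwise. Let $\Omega(V,H)=(\Omega_{V,H},H)$, and send a morphism $f$ to the pair of its restrictions to $\Omega_{V,H}$ and to $H$. **Theorem.** These constructions are well defined and give functors $\mathcal V$ from AH pairs to VH pairs and $\Omega$ from VH pairs to AH pairs. The functor $\Omega$ is right adjoint to $\mathcal V$, and $\Omega\circ\mathcal V$ is isomorphic to the identity functor of the category of AH pairs. -/

import Mathlib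

open CategoryTheory
open scoped TensorProduct Nat

universe u

noncomputable section

namespace VertexPair

/-! ## Vertex algebras -/

/-- A vertex algebra over `ℂ`, in the form given by Borcherds. `nProd n a b` is the `n`-th product
`a(n)b`, that is, `Y(a,z) = ∑ n, a(n) z^(-n-1)`. By `truncation` all the sums in `borcherds` are
finite. -/
class VertexAlgebra (V : Type u) [AddCommGroup V] [Module ℂ V] where
  nProd : ℤ → V →ₗ[ℂ] V →ₗ[ℂ] V
  vac : V
  vac_ne_zero : vac ≠ 0
  truncation : ∀ a b : V, ∃ N : ℤ, ∀ n : ℤ, N ≤ n → nProd n a b = 0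
  nProd_vac_of_nonneg : ∀ (a : V) (n : ℤ), 0 ≤ n → nProd n a vac = 0
  nProd_neg_one_vac : ∀ a : V, nProd (-1) a vac = a
  borcherds : ∀ (a b c : V) (p q r : ℤ),
    ∑ᶠ i : ℕ, (Ring.choose p i : ℤ) • nProd (p + q - i) (nProd (r + i) a b) c =
      ∑ᶠ i : ℕ, ((-1) ^ i * Ring.choose r i : ℤ) •
        (nProd (p + r - i) a (nProd (q + i) b c)
          - ((-1 : ℂ) ^ r) • nProd (q + r - i) b (nProd (p + i) a c))


/-! ## VH pairs -/

/-- A VH pair `(V, H)`: a vertex algebra with a finite-dimensional Heisenberg subspace `H`.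
The bilinear form is determined by the first products of elements of `H`. -/
structure VHPair where
  V : Type u
  [addCommGroup : AddCommGroup V]
  [module : Module ℂ V]
  [vertexAlgebra : VertexAlgebra V]
  H : Submodule ℂ V
  [finiteDimensional : FiniteDimensional ℂ H]
  form : LinearMap.BilinForm ℂ H
  nProd_one : ∀ h h' : H,
    VertexAlgebra.nProd 1 (h : V) (h' : V) = form h h' • (VertexAlgebra.vac : V)
  nProd_eq_zero : ∀ (h h' : H) (n : ℤ), n = 0 ∨ 2 ≤ n →
    VertexAlgebra.nProd n (h : V) (h' : V) = 0
  nondegenerate : form.Nondegenerate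

attribute [instance] VHPair.addCommGroup VHPair.module VHPair.vertexAlgebra
  VHPair.finiteDimensional

/-- A homomorphism of VH pairs: a vertex algebra homomorphism `f` with `f(H_V) = H_W`. -/
@[ext]
structure VHPair.Hom (X Y : VHPair.{u}) where
  toLinearMap : X.V →ₗ[ℂ] Y.V
  map_vac : toLinearMap VertexAlgebra.vac = VertexAlgebra.vac
  map_nProd : ∀ (n : ℤ) (a b : X.V), toLinearMap (VertexAlgebra.nProd n a b) =
    VertexAlgebra.nProd n (toLinearMap a) (toLinearMap b)
  map_H : X.H.map toLinearMap = Y.H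

instance : Category VHPair.{u} where
  Hom X Y := VHPair.Hom X Y
  id X :=
    { toLinearMap := LinearMap.id
      map_vac := rfl
      map_nProd := fun _ _ _ => rfl
      map_H := Submodule.map_id _ }
  comp f g :=
    { toLinearMap := g.toLinearMap ∘ₗ f.toLinearMap
      map_vac := by simp [f.map_vac, g.map_vac]
      map_nProd := fun n a b => by simp [f.map_nProd, g.map_nProd]
      map_H := by rw [Submodule.map_comp, f.map_H, g.map_H] }

/-- The linear map underlying a morphism of VH pairs. -/
def VHPair.lin {X Y : VHPair.{u}} (f : X ⟶ Y) : X.V →ₗ[ℂ] Y.V :=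
  VHPair.Hom.toLinearMap f

/-- The canonical derivation `T v = v(-2)𝟏`. -/
def VHPair.T (X : VHPair.{u}) (v : X.V) : X.V :=
  VertexAlgebra.nProd (-2) v VertexAlgebra.vac

/-- The Sugawara vector `ω_H = (1/2) ∑ i, h_i(-1)h^i`, for a basis `h_i` of `H` and its dual
basis `h^i`. -/
def VHPair.sugawara (X : VHPair.{u}) : X.V :=
  (1 / 2 : ℂ) • ∑ i, VertexAlgebra.nProd (-1) (Module.finBasis ℂ X.H i : X.V)
    (X.form.dualBasis X.nondegenerate (Module.finBasis ℂ X.H) i : X.V)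

/-- The space `Ω^α` of the vectors `v` with `T v = ω_H(0) v`, `h(n) v = 0` for `n ≥ 1`, and
`h(0) v = (h, α) v`, for all `h ∈ H`. -/
def VHPair.vacuumSpace (X : VHPair.{u}) (α : X.H) : Submodule ℂ X.V where
  carrier := {v | X.T v = VertexAlgebra.nProd 0 X.sugawara v ∧
    (∀ (h : X.H) (n : ℤ), 1 ≤ n → VertexAlgebra.nProd n (h : X.V) v = 0) ∧
    ∀ h : X.H, VertexAlgebra.nProd 0 (h : X.V) v = X.form h α • v}
  zero_mem' := by simp [VHPair.T]
  add_mem' := by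
    rintro a b ⟨ha, ha', ha''⟩ ⟨hb, hb', hb''⟩
    simp only [VHPair.T] at ha hb
    refine ⟨by simp [VHPair.T, ha, hb], fun h n hn => by simp [ha' h n hn, hb' h n hn],
      fun h => by simp [ha'' h, hb'' h]⟩
  smul_mem' := by
    rintro c a ⟨ha, ha', ha''⟩
    simp only [VHPair.T] at ha
    refine ⟨by simp [VHPair.T, ha], fun h n hn => by simp [ha' h n hn],
      fun h => by simp [ha'' h, smul_comm c]⟩

/-! ## AH pairs -/

open Classical in
/-- An AH pair `(A, H)`: a nonzero unital associative algebra graded by a finite-dimensional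
quadratic space `H`. If `(α, β)` is not an integer then `A^α A^β = 0 = A^β A^α` by
`integral_of_mul_ne_zero`, so that `mul_comm_sign` concerns only the case of an integer. -/
structure AHPair where
  A : Type u
  H : Type u
  [ring : Ring A]
  [algebra : Algebra ℂ A]
  [nontrivial : Nontrivial A]
  [addCommGroup : AddCommGroup H]
  [module : Module ℂ H]
  [finiteDimensional : FiniteDimensional ℂ H]
  form : LinearMap.BilinForm ℂ H
  isSymm : form.IsSymm
  nondegenerate : form.Nondegenerate
  grade : H → Submodule ℂ A
  isInternal : DirectSum.IsInternal grade
  one_mem : (1 : A) ∈ grade 0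
  mul_mem : ∀ {α β : H} {v w : A}, v ∈ grade α → w ∈ grade β → v * w ∈ grade (α + β)
  integral_of_mul_ne_zero : ∀ {α β : H} {v w : A}, v ∈ grade α → w ∈ grade β → v * w ≠ 0 →
    ∃ n : ℤ, form α β = n
  mul_comm_sign : ∀ {α β : H} {v w : A}, v ∈ grade α → w ∈ grade β →
    ∀ n : ℤ, form α β = n → v * w = ((-1 : ℂ) ^ n) • (w * v)

attribute [instance] AHPair.ring AHPair.algebra AHPair.nontrivial AHPair.addCommGroup
  AHPair.module AHPair.finiteDimensional

/-- A homomorphism of AH pairs: a unital algebra homomorphism together with an isometric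
isomorphism of the grading spaces compatible with the gradings. -/
@[ext]
structure AHPair.Hom (P Q : AHPair.{u}) where
  toAlgHom : P.A →ₐ[ℂ] Q.A
  toLinearEquiv : P.H ≃ₗ[ℂ] Q.H
  map_form : ∀ α β : P.H, Q.form (toLinearEquiv α) (toLinearEquiv β) = P.form α β
  map_grade : ∀ (α : P.H) (a : P.A), a ∈ P.grade α → toAlgHom a ∈ Q.grade (toLinearEquiv α)

instance : Category AHPair.{u} where
  Hom P Q := AHPair.Hom P Q
  id P :=
    { toAlgHom := AlgHom.id ℂ P.A
      toLinearEquiv := LinearEquiv.refl ℂ P.H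
      map_form := fun _ _ => rfl
      map_grade := fun _ _ h => h }
  comp f g :=
    { toAlgHom := g.toAlgHom.comp f.toAlgHom
      toLinearEquiv := f.toLinearEquiv.trans g.toLinearEquiv
      map_form := fun α β => by simp [f.map_form, g.map_form]
      map_grade := fun α a h => g.map_grade _ _ (f.map_grade _ _ h) }

/-- The algebra homomorphism underlying a morphism of AH pairs. -/
def AHPair.alg {P Q : AHPair.{u}} (f : P ⟶ Q) : P.A →ₐ[ℂ] Q.A :=
  AHPair.Hom.toAlgHom f

/-- The isometry underlying a morphism of AH pairs. -/
def AHPair.isom {P Q : AHPair.{u}} (f : P ⟶ Q) : P.H ≃ₗ[ℂ] Q.H :=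
  AHPair.Hom.toLinearEquiv f

/-! ## The Fock space `M_H(0)` of the Heisenberg Lie algebra -/

/-- The derivation of the symmetric algebra of `W` that extends a linear form on `W`. -/
def contraction {W : Type u} [AddCommGroup W] [Module ℂ W] (ℓ : W →ₗ[ℂ] ℂ) :
    Derivation ℂ (SymmetricAlgebra ℂ W) (SymmetricAlgebra ℂ W) :=
  letI S := SymmetricAlgebra ℂ W
  letI f : S →ₐ[ℂ] TrivSqZeroExt S S := SymmetricAlgebra.lift
    ((TrivSqZeroExt.inlAlgHom ℂ S S).toLinearMap ∘ₗ SymmetricAlgebra.ι ℂ W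
      + (TrivSqZeroExt.inrHom S S).restrictScalars ℂ ∘ₗ Algebra.linearMap ℂ S ∘ₗ ℓ)
  Derivation.mk' ((TrivSqZeroExt.sndHom S S).restrictScalars ℂ ∘ₗ f.toLinearMap) (by
    have hf : ∀ x, (f x).fst = x := fun x => by
      have : (TrivSqZeroExt.fstHom ℂ S S).comp f = AlgHom.id ℂ S := by
        apply SymmetricAlgebra.algHom_ext
        ext w
        simp [f]
        rfl
      exact congrArg (fun g => g x) this
    intro a b
    simp [hf, mul_comm b])

theorem contraction_ι {W : Type u} [AddCommGroup W] [Module ℂ W] (ℓ : W →ₗ[ℂ] ℂ) (w : W) :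
    contraction ℓ (SymmetricAlgebra.ι ℂ W w) = algebraMap ℂ _ (ℓ w) := by
  simp [contraction, Algebra.algebraMap_eq_smul_one]

/-- The underlying space of the Heisenberg vertex algebra `M_H(0)` associated with `H`: the
symmetric algebra of `H ⊗ t⁻¹ℂ[t⁻¹]`, where `Finsupp.single k h` stands for `h ⊗ t^(-k-1)`. -/
abbrev Fock (H : Type u) [AddCommGroup H] [Module ℂ H] : Type u :=
  SymmetricAlgebra ℂ (ℕ →₀ H)

variable {H : Type u} [AddCommGroup H] [Module ℂ H]

/-- The element `h(-k-1)𝟏` of `M_H(0)`. -/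
def Fock.gen (h : H) (k : ℕ) : Fock H :=
  SymmetricAlgebra.ι ℂ (ℕ →₀ H) (Finsupp.single k h)

/-- The action of `h(n)` on `M_H(0)`: multiplication by `h(-k-1)𝟏` for `n = -k-1 < 0`, zero
for `n = 0`, and for `n > 0` the derivation with `h'(-m)𝟏 ↦ n (h, h') δ_{m,n}`. -/
def Fock.heis (B : LinearMap.BilinForm ℂ H) (h : H) : ℤ → Module.End ℂ (Fock H)
  | Int.negSucc k => LinearMap.mulLeft ℂ (Fock.gen h k)
  | Int.ofNat 0 => 0
  | Int.ofNat (k + 1) =>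
      (contraction (((k : ℂ) + 1) • (B h ∘ₗ Finsupp.lapply k))).toLinearMap

/-- The map `M_H(0) → M_{H'}(0)` induced by a linear map `H → H'`. -/
def Fock.map {H' : Type u} [AddCommGroup H'] [Module ℂ H'] (f : H →ₗ[ℂ] H') :
    Fock H →ₐ[ℂ] Fock H' :=
  SymmetricAlgebra.lift (SymmetricAlgebra.ι ℂ (ℕ →₀ H') ∘ₗ Finsupp.mapRange.linearMap f)

/-- The coefficient of `z^k` in `exp f(z)`, for a power series `f` without constant term. -/
def expCoeff {R : Type u} [Ring R] [Algebra ℂ R] (f : PowerSeries R) (k : ℕ) : R :=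
  ∑ m ∈ Finset.range (k + 1), ((m ! : ℂ)⁻¹) • PowerSeries.coeff k (f ^ m)

/-- The coefficient of `z^k` in `exp (∑_{n ≥ 1} (α(-n) / n) z^n)` on `M_H(0)`. -/
def Fock.creation (B : LinearMap.BilinForm ℂ H) (α : H) (k : ℕ) : Module.End ℂ (Fock H) :=
  expCoeff (PowerSeries.mk fun n : ℕ =>
    if n = 0 then 0 else ((n : ℂ)⁻¹) • Fock.heis B α (-(n : ℤ))) k

/-- The coefficient of `z^(-k)` in `exp (∑_{n ≥ 1} (α(n) / (-n)) z^(-n))` on `M_H(0)`. -/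
def Fock.annihilation (B : LinearMap.BilinForm ℂ H) (α : H) (k : ℕ) : Module.End ℂ (Fock H) :=
  expCoeff (PowerSeries.mk fun n : ℕ =>
    if n = 0 then 0 else (-(n : ℂ))⁻¹ • Fock.heis B α (n : ℤ)) k

/-- The coefficient of `z^m` in
`exp (∑_{n ≥ 1} (α(-n) / n) z^n) exp (∑_{n ≥ 1} (α(n) / (-n)) z^(-n)) v`. The sum is finite, since
`Fock.annihilation B α k v = 0` for large `k`. -/
def Fock.vertexCoeff (B : LinearMap.BilinForm ℂ H) (α : H) (m : ℤ) (v : Fock H) : Fock H :=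
  ∑ᶠ (p : ℕ × ℕ) (_ : (p.1 : ℤ) - (p.2 : ℤ) = m),
    Fock.creation B α p.1 (Fock.annihilation B α p.2 v)

/-! ## The functor `𝒱` -/

/-- An identification of the VH pair `X` with `(M_H(0) ⊗ A, H)`, where `P = (A, H)`:
a linear isomorphism under which the vacuum is `𝟏 ⊗ 1`, the Heisenberg subspace is
`H = {h(-1)𝟏 ⊗ 1}`, and, for `v ∈ M_H(0)` and `b ∈ A^β`,
* `h(n)(v ⊗ b)` is `(h, β) v ⊗ b` for `n = 0` and `h(n)v ⊗ b` for `n ≠ 0`;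
* for `a ∈ A^α`, the `n`-th product of `𝟏 ⊗ a` with `v ⊗ b` is the coefficient of `z^(-n-1)` in
`z^(α,β) exp (∑_{n ≥ 1} (α(-n) / n) z^n) exp (∑_{n ≥ 1} (α(n) / (-n)) z^(-n)) v ⊗ ab`,
which is zero if `(α, β)` is not an integer. -/
structure LatticeModel (P : AHPair.{u}) (X : VHPair.{u}) where
  iso : (Fock P.H ⊗[ℂ] P.A) ≃ₗ[ℂ] X.V
  iso_one : iso (1 ⊗ₜ 1) = VertexAlgebra.vac
  mem_H : ∀ x : X.V, x ∈ X.H ↔ ∃ h : P.H, iso (Fock.gen h 0 ⊗ₜ 1) = x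
  nProd_zero_heis : ∀ (h β : P.H) (v : Fock P.H) (b : P.A), b ∈ P.grade β →
    VertexAlgebra.nProd 0 (iso (Fock.gen h 0 ⊗ₜ 1)) (iso (v ⊗ₜ b)) = iso ((P.form h β • v) ⊗ₜ b)
  nProd_heis : ∀ (h : P.H) (v : Fock P.H) (b : P.A) (n : ℤ), n ≠ 0 →
    VertexAlgebra.nProd n (iso (Fock.gen h 0 ⊗ₜ 1)) (iso (v ⊗ₜ b)) =
      iso (Fock.heis P.form h n v ⊗ₜ b)
  nProd_vertex : ∀ (α β : P.H) (N : ℤ), P.form α β = N →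
    ∀ (a b : P.A) (v : Fock P.H) (n : ℤ), a ∈ P.grade α → b ∈ P.grade β →
      VertexAlgebra.nProd n (iso (1 ⊗ₜ a)) (iso (v ⊗ₜ b)) =
        iso (Fock.vertexCoeff P.form α (-n - 1 - N) v ⊗ₜ (a * b))
  nProd_vertex_eq_zero : ∀ (α β : P.H), (∀ N : ℤ, P.form α β ≠ N) →
    ∀ (a b : P.A) (v : Fock P.H) (n : ℤ), a ∈ P.grade α → b ∈ P.grade β →
      VertexAlgebra.nProd n (iso (1 ⊗ₜ a)) (iso (v ⊗ₜ b)) = 0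

/-- `𝒱` is the functor `(A, H) ↦ (M_H(0) ⊗ A, H)`, sending a morphism `(f, f')` to
`M(f') ⊗ f`. -/
def IsLatticeFunctor (𝒱 : AHPair.{u} ⥤ VHPair.{u}) : Prop :=
  ∃ m : ∀ P : AHPair.{u}, LatticeModel P (𝒱.obj P),
    ∀ (P Q : AHPair.{u}) (f : P ⟶ Q) (v : Fock P.H) (a : P.A),
      VHPair.lin (𝒱.map f) ((m P).iso (v ⊗ₜ a)) =
        (m Q).iso (Fock.map (AHPair.isom f).toLinearMap v ⊗ₜ AHPair.alg f a)

/-! ## The functor `Ω` -/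

/-- An identification of the AH pair `P` with `(Ω_{V,H}, H)`, where `X = (V, H)`: an isometry of
the spaces `H`, and an injective linear map onto `⊕ α, Ω^α ⊆ V` that matches the gradings,
such that the unit is the vacuum and, for `v ∈ Ω^α` and `w ∈ Ω^β`, the product `vw` is
`v(-(α,β)-1)w` if `Y(v,z)w ≠ 0` (then `(α, β)` is an integer) and zero otherwise. -/
structure VacuumModel (X : VHPair.{u}) (P : AHPair.{u}) where
  isoH : X.H ≃ₗ[ℂ] P.H
  form_isoH : ∀ h h' : X.H, P.form (isoH h) (isoH h') = X.form h h'
  incl : P.A →ₗ[ℂ] X.V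
  incl_injective : Function.Injective incl
  map_grade : ∀ α : X.H, (P.grade (isoH α)).map incl = X.vacuumSpace α
  incl_one : incl 1 = VertexAlgebra.vac
  mul_eq_nProd : ∀ (α β : X.H) (v w : P.A), v ∈ P.grade (isoH α) → w ∈ P.grade (isoH β) →
    (∃ n : ℤ, VertexAlgebra.nProd n (incl v) (incl w) ≠ 0) →
      ∃ N : ℤ, X.form α β = N ∧ incl (v * w) = VertexAlgebra.nProd (-N - 1) (incl v) (incl w)
  mul_eq_zero : ∀ (α β : X.H) (v w : P.A), v ∈ P.grade (isoH α) → w ∈ P.grade (isoH β) →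
    (∀ n : ℤ, VertexAlgebra.nProd n (incl v) (incl w) = 0) → v * w = 0

/-- `Ω` is the functor `(V, H) ↦ (Ω_{V,H}, H)`, sending a morphism `f` to its restrictions to
`Ω_{V,H}` and to `H`. -/
def IsVacuumFunctor (Ω : VHPair.{u} ⥤ AHPair.{u}) : Prop :=
  ∃ m : ∀ X : VHPair.{u}, VacuumModel X (Ω.obj X),
    ∀ (X Y : VHPair.{u}) (f : X ⟶ Y),
      (∀ a : (Ω.obj X).A, (m Y).incl (AHPair.alg (Ω.map f) a) = VHPair.lin f ((m X).incl a)) ∧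
      ∀ h : X.H, ((m Y).isoH.symm (AHPair.isom (Ω.map f) ((m X).isoH h)) : Y.V) =
        VHPair.lin f (h : X.V)

end VertexPair

end

/-!
The proof turns on one differential equation. Let `v ∈ Ω^α` and let `w` be a vector of weight `β`
that is killed by all `h(n)` with `n ≥ 1`. On a vector of weight `α` with this property `ω_H(0)` acts
as `α(-1)` (`VHPair.IsWeightVector.sugawara_zero`), so `T v = α(-1)v`, and the Borcherds identity
turns this into
`z d/dz Y(v, z)w = (α, β) Y(v, z)w + ∑_{i ≥ 0} z^(i+1) α(-1-i) Y(v, z)w`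
(`VHPair.vacuumSpace_recursion`). Hence `Y(v, z)w` is zero unless `(α, β)` is an integer, and in that
case it is `z^(α, β) exp(∑_{n ≥ 1} α(-n) z^n / n)` applied to its leading coefficient.

*The functor `Ω`.* The leading coefficients of `Y(v, z)w`, for `v ∈ Ω^α` and `w ∈ Ω^β`, lie in
`Ω^(α + β)`. Their associativity and the sign `(-1)^(α, β)` in their commutation rule are the cases
of the Borcherds identity and of skew-symmetry in which all the other terms lie beyond the leading
one (`VHPair.leadingProd_assoc`, `VHPair.leadingProd_skew`). The sum of the spaces `Ω^α` is direct
because the form is nondegenerate, so that distinct `α` are distinct joint eigenvalues of the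
operators `h(0)`.

*The functor `𝒱` on objects.* The vertex algebra structure on `M_H(0) ⊗ A` comes from a
reconstruction theorem, `FormalField.IsGeneratingSystem.vertexAlgebra`: a set of mutually local,
translation covariant fields that generates the space from the vacuum determines a vertex algebra in
which these fields are the fields of their states. The space of fields generated by the given ones
consists of mutually local fields by Dong's lemma (`FormalField.IsLocal.nthProd_left`), is mapped
bijectively to the states by `a(z) ↦ a(-1)𝟏`, and satisfies the Borcherds identity
(`FormalField.borcherds_of_isLocal`). The hypothesis with content is the locality of the fields of
`𝟏 ⊗ a` and `𝟏 ⊗ b`. As their commutators with the operators `h(n)` are known, it is enough to test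
it on the vectors `𝟏 ⊗ c` (`AHPair.heisOp_locBracket`). There the two products of the fields are the
expansions in the two directions of one and the same series times `(z - w)^(α, β)`, and the sign
`(-1)^(α, β)` that arises when this factor is turned around is the sign by which `a` and `b` commute
(`AHPair.locBracket_vertex_one`).

*The adjunction.* A morphism from `(A, H)` to `Ω(V, H)` is a linear map from `A` to the vacuum
vectors of `V` that takes products to leading coefficients, together with an isometry
(`VacuumMap`). It extends uniquely to a linear map on `M_H(0) ⊗ A` that is compatible with the
operators `h(n)`. This extension respects the fields of `𝟏 ⊗ a`, because both sides solve the
differential equation above with the same leading coefficient, and therefore respects all products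
(`VacuumMap.extend_nProd`). Thus `𝒱(A, H)` has the universal property of a left adjoint
(`AHPair.bijective_transpose`), and `𝒱` is defined on morphisms by this property.

*The unit.* The vectors of the Fock space that are killed by all `h(n)` with `n ≥ 1` are the
scalars: in coordinates these operators are, up to nonzero factors, all the partial derivatives of a
polynomial ring. Together with the nondegeneracy of the form this shows that the vacuum vectors of
`𝒱(A, H)` are the `𝟏 ⊗ a` with `a ∈ A` (`AHPair.latticeVacuumModel`). So the unit of the adjunction
is an isomorphism.
-/

noncomputable section

namespace VertexPair

/-! ### Consequences of the Borcherds identity -/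

theorem choose_neg_one_int (i : ℕ) : Ring.choose (-1 : ℤ) i = (-1) ^ i := by
  induction i with
  | zero => simp
  | succ k ih =>
    have h := Ring.choose_succ_succ (-1 : ℤ) k
    rw [neg_add_cancel, Ring.choose_zero_succ, ih] at h
    rw [pow_succ]; linarith

theorem choose_neg_two_int (i : ℕ) : Ring.choose (-2 : ℤ) i = (-1) ^ i * (i + 1) := by
  induction i with
  | zero => simp
  | succ k ih =>
    have h := Ring.choose_succ_succ (-2 : ℤ) k
    rw [show (-2 : ℤ) + 1 = -1 by norm_num, choose_neg_one_int, ih] at h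
    rw [pow_succ] at *; push_cast; linarith

namespace VertexAlgebra

variable {V : Type u} [AddCommGroup V] [Module ℂ V] [VertexAlgebra V]

/-- The commutator formula. -/
theorem commutator_formula (a b c : V) (p q : ℤ) :
    nProd p a (nProd q b c) - nProd q b (nProd p a c) =
      ∑ᶠ i : ℕ, (Ring.choose p i : ℤ) • nProd (p + q - i) (nProd i a b) c := by
  have h := (borcherds a b c p q 0).symm
  rw [finsum_eq_single _ 0] at h
  swap
  · intro i hi
    obtain ⟨j, rfl⟩ := Nat.exists_eq_succ_of_ne_zero hi
    simp [Ring.choose_zero_succ]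
  simp only [zero_add] at h
  rw [← h]; simp

/-- The associativity formula, which expresses the modes of `a(r)b` in terms of those of `a`
and `b`. -/
theorem nProd_nProd (a b c : V) (r q : ℤ) :
    nProd q (nProd r a b) c = ∑ᶠ i : ℕ, ((-1) ^ i * Ring.choose r i : ℤ) •
        (nProd (r - i) a (nProd (q + i) b c)
          - ((-1 : ℂ) ^ r) • nProd (q + r - i) b (nProd i a c)) := by
  have h := borcherds a b c 0 q r
  rw [finsum_eq_single _ 0] at h
  swap
  · intro i hi
    obtain ⟨j, rfl⟩ := Nat.exists_eq_succ_of_ne_zero hi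
    simp [Ring.choose_zero_succ]
  simpa using h

theorem exists_trunc_nat (a b : V) (q : ℤ) :
    ∃ M : ℕ, ∀ i : ℕ, M ≤ i → nProd (q + i) a b = 0 := by
  obtain ⟨N, hN⟩ := truncation a b
  exact ⟨(N - q).toNat, fun i hi => hN _ (by omega)⟩

/-- The sum in the associativity formula is finite. -/
theorem nProd_nProd_support (a b c : V) (r q : ℤ) :
    (Function.support fun i : ℕ => ((-1) ^ i * Ring.choose r i : ℤ) •
      (nProd (r - i) a (nProd (q + i) b c)
        - ((-1 : ℂ) ^ r) • nProd (q + r - i) b (nProd i a c))).Finite := by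
  obtain ⟨M, hM⟩ := exists_trunc_nat b c q
  obtain ⟨M', hM'⟩ := exists_trunc_nat a c 0
  refine (Finset.range (max M M')).finite_toSet.subset fun i hi => ?_
  by_contra hi'
  simp only [Finset.coe_range, Set.mem_Iio, not_lt, max_le_iff] at hi'
  refine hi ?_
  have h2 := hM' i hi'.2
  rw [zero_add] at h2
  simp [hM i hi'.1, h2]

theorem commutator_zero (a b c : V) (q : ℤ) :
    nProd 0 a (nProd q b c) = nProd q (nProd 0 a b) c + nProd q b (nProd 0 a c) := by
  have h := commutator_formula a b c 0 q
  rw [finsum_eq_single _ 0] at h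
  swap
  · intro i hi
    obtain ⟨j, rfl⟩ := Nat.exists_eq_succ_of_ne_zero hi
    simp [Ring.choose_zero_succ]
  simp only [Ring.choose_zero_right, one_smul, Nat.cast_zero, sub_zero, zero_add] at h
  rw [← h]; abel

/-- If the products `a(i)b` vanish for `i ≥ 1`, the commutator has a single term. -/
theorem commutator_of_trunc {a b : V} (hab : ∀ n : ℤ, 1 ≤ n → nProd n a b = 0) (c : V) (p q : ℤ) :
    nProd p a (nProd q b c) = nProd (p + q) (nProd 0 a b) c + nProd q b (nProd p a c) := by
  have h := commutator_formula a b c p q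
  rw [finsum_eq_single _ 0] at h
  swap
  · intro i hi
    rw [hab i (by omega)]
    simp
  simp only [Ring.choose_zero_right, one_smul, Nat.cast_zero, sub_zero] at h
  rw [← h]; abel

theorem vac_comm (a c : V) (p q : ℤ) :
    nProd p a (nProd q vac c) = nProd q vac (nProd p a c) := by
  have h := commutator_formula a vac c p q
  rw [finsum_eq_single _ 0] at h
  · rw [nProd_vac_of_nonneg _ _ (by simp)] at h
    simpa [sub_eq_zero] using h
  · intro i hi
    rw [nProd_vac_of_nonneg _ _ (by simp)]
    simp

theorem nProd_neg_one_vac_left (c : V) : nProd (-1) vac c = c := by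
  have := vac_comm c vac (-1) (-1)
  rwa [nProd_neg_one_vac, nProd_neg_one_vac, eq_comm] at this

theorem nProd_vac_vac (n : ℕ) : nProd (-2 - n : ℤ) (vac : V) vac = 0 := by
  induction n using Nat.strong_induction_on with
  | _ n ih =>
  have h := nProd_nProd (vac : V) vac vac (-1) (-2 - n)
  rw [nProd_neg_one_vac, finsum_eq_sum_of_support_subset (s := {0, n + 1})] at h
  · rw [Finset.sum_pair (by omega)] at h
    have e1 : (-2 - n + (0 : ℕ) : ℤ) = -2 - n := by simp
    have e2 : (-2 - n + ((n + 1 : ℕ) : ℤ) : ℤ) = -1 := by push_cast; ring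
    have e3 : (-1 - ((n + 1 : ℕ) : ℤ) : ℤ) = -2 - n := by push_cast; ring
    have e4 : ((-1) ^ (n + 1) * (-1) ^ (n + 1) : ℤ) = 1 := by
      rw [← pow_add, ← two_mul, pow_mul]; simp
    rw [e1, e2, e3, nProd_neg_one_vac, nProd_vac_of_nonneg _ ((0 : ℕ) : ℤ) (by simp),
      nProd_vac_of_nonneg _ ((n + 1 : ℕ) : ℤ) (by omega), choose_neg_one_int, choose_neg_one_int,
          e4] at h
    simp only [Nat.cast_zero, sub_zero, nProd_neg_one_vac_left] at h
    simpa using h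
  · intro i hi
    by_contra hi'
    simp only [Finset.coe_insert, Finset.coe_singleton, Set.mem_insert_iff,
      Set.mem_singleton_iff, not_or] at hi'
    refine hi ?_
    have h1 : nProd (i : ℤ) (vac : V) vac = 0 := nProd_vac_of_nonneg _ _ (by simp)
    have h2 : nProd (-1 - i : ℤ) (vac : V) (nProd (-2 - n + i : ℤ) vac vac) = 0 := by
      rcases lt_or_ge i (n + 1) with hlt | hge
      · have := ih (n - i) (by omega)
        rw [show (-2 - ((n - i : ℕ) : ℤ)) = -2 - n + i by push_cast [show i ≤ n by omega]; ring]
          at this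
        rw [this, map_zero]
      · rw [nProd_vac_of_nonneg (vac : V) (-2 - n + i) (by omega), map_zero]
    simp [h1, h2]

theorem nProd_vac_left (n : ℤ) (c : V) : nProd n vac c = if n = -1 then c else 0 := by
  split_ifs with hn
  · rw [hn, nProd_neg_one_vac_left]
  · have h := vac_comm c vac (-1) n
    rw [nProd_neg_one_vac] at h
    rw [← h]
    rcases lt_or_ge n 0 with h0 | h0
    · have := nProd_vac_vac (V := V) (-2 - n).toNat
      rw [Int.toNat_of_nonneg (by omega), sub_sub_cancel] at this
      rw [this, map_zero]
    · rw [nProd_vac_of_nonneg _ _ h0, map_zero]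

/-- The modes of `T a = a(-2)𝟏`. -/
theorem nProd_translate (a c : V) (q : ℤ) :
    nProd q (nProd (-2) a vac) c = (-q) • nProd (q - 1) a c := by
  rw [nProd_nProd]
  simp only [nProd_vac_left]
  rcases lt_trichotomy q 0 with hq | hq | hq
  · rw [finsum_eq_single _ (-1 - q).toNat]
    · have e : ((-1 - q).toNat : ℤ) = -1 - q := Int.toNat_of_nonneg (by omega)
      rw [e, if_pos (by ring), if_neg (by omega), choose_neg_two_int, ← mul_assoc, ← pow_add,
        ← two_mul, pow_mul, e]
      simp only [even_two, Even.neg_pow, one_pow, one_mul, smul_zero, sub_zero]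
      congr 2
      · ring
      · rw [show -2 - (-1 - q) = q - 1 by ring]
    · intro i hi
      rw [if_neg (by omega), if_neg (by omega)]
      simp
  · subst hq
    rw [finsum_eq_zero_of_forall_eq_zero]
    · simp
    · intro i
      rw [if_neg (by omega), if_neg (by omega)]
      simp
  · rw [finsum_eq_single _ (q - 1).toNat]
    · have e : ((q - 1).toNat : ℤ) = q - 1 := Int.toNat_of_nonneg (by omega)
      rw [e, if_neg (by omega), if_pos (by ring), choose_neg_two_int, ← mul_assoc, ← pow_add,
        ← two_mul, pow_mul, e]
      simp
    · intro i hi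
      rw [if_neg (by omega), if_neg (by omega)]
      simp

theorem translate_nProd (a b : V) (n : ℤ) :
    nProd (-2) (nProd n a b) vac =
      nProd n (nProd (-2) a vac) b + nProd n a (nProd (-2) b vac) := by
  rw [nProd_nProd, nProd_translate, finsum_eq_sum_of_support_subset (s := {0, 1})]
  · rw [Finset.sum_pair (by omega)]
    simp [nProd_vac_of_nonneg, nProd_neg_one_vac]
    abel
  · intro i hi
    by_contra hi'
    simp only [Finset.coe_insert, Finset.coe_singleton, Set.mem_insert_iff,
      Set.mem_singleton_iff, not_or] at hi'
    refine hi ?_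
    simp [nProd_vac_of_nonneg _ _ (show (0 : ℤ) ≤ -2 + i by omega),
      nProd_vac_of_nonneg _ _ (show (0 : ℤ) ≤ i by omega)]

/-- Skew-symmetry for the product `a(r)b` such that all the products `a(r+i)b` with `i ≥ 1`
vanish. -/
theorem skew_of_trunc (a b : V) (r : ℤ) (h : ∀ n : ℤ, r < n → nProd n a b = 0) :
    nProd r a b = -((-1 : ℂ) ^ r • nProd r b a) := by
  have h1 := borcherds a b vac (-1) 0 r
  rw [finsum_eq_single _ 0, finsum_eq_single _ 0] at h1
  · simpa [nProd_vac_of_nonneg, nProd_neg_one_vac] using h1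
  · intro i hi
    rw [nProd_vac_of_nonneg _ _ (by omega), nProd_vac_of_nonneg _ _ (by omega)]
    simp
  · intro i hi
    rw [h _ (by omega)]
    simp

/-- If a linear map respects the modes of `a` and of `b`, it respects the modes of all the products
`a(r)b`. -/
theorem map_nProd_closed {W : Type u} [AddCommGroup W] [Module ℂ W] [VertexAlgebra W]
    (f : V →ₗ[ℂ] W) {a b : V} (r : ℤ)
    (ha : ∀ (n : ℤ) (c : V), f (nProd n a c) = nProd n (f a) (f c))
    (hb : ∀ (n : ℤ) (c : V), f (nProd n b c) = nProd n (f b) (f c)) (n : ℤ) (c : V) :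
    f (nProd n (nProd r a b) c) = nProd n (f (nProd r a b)) (f c) := by
  rw [ha, nProd_nProd, nProd_nProd]
  have := AddMonoidHom.map_finsum (f : V →+ W) (nProd_nProd_support a b c r n)
  refine this.trans (finsum_congr fun i => ?_)
  simp [ha, hb]

end VertexAlgebra

/-! ### The vacuum space of a VH pair -/

namespace VertexAlgebra

variable {V : Type u} [AddCommGroup V] [Module ℂ V] [VertexAlgebra V]

/-- Associativity of leading coefficients: the case of the Borcherds identity in which both sums
reduce to their first term. -/
theorem assoc_of_trunc (a b c : V) (p q r : ℤ) (hr : ∀ n : ℤ, r < n → nProd n a b = 0)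
    (hq : ∀ n : ℤ, q < n → nProd n b c = 0) (hp : ∀ n : ℤ, p ≤ n → nProd n a c = 0) :
    nProd (p + q) (nProd r a b) c = nProd (p + r) a (nProd q b c) := by
  have h := borcherds a b c p q r
  rw [finsum_eq_single _ 0, finsum_eq_single _ 0] at h
  · simpa [hp p le_rfl] using h
  · intro i hi
    rw [hq _ (by omega), hp _ (by omega)]
    simp
  · intro i hi
    rw [hr _ (by omega)]
    simp

end VertexAlgebra

namespace VHPair

open VertexAlgebra

variable (X : VHPair.{u})

/-- The canonical commutation relations of the modes of `H`. -/
theorem heis_comm (h h' : X.H) (m n : ℤ) (c : X.V) :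
    nProd m (h : X.V) (nProd n (h' : X.V) c) = nProd n (h' : X.V) (nProd m (h : X.V) c)
      + if m + n = 0 then ((m : ℂ) * X.form h h') • c else 0 := by
  have e := commutator_formula (h : X.V) (h' : X.V) c m n
  rw [finsum_eq_single _ 1] at e
  · rw [sub_eq_iff_eq_add'] at e
    rw [e, Nat.cast_one, X.nProd_one, map_smul, LinearMap.smul_apply, nProd_vac_left,
      Ring.choose_one_right]
    congr 1
    by_cases hmn : m + n = 0
    · rw [if_pos (by omega), if_pos hmn, ← Int.cast_smul_eq_zsmul ℂ, smul_smul]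
    · rw [if_neg (by omega), if_neg hmn]; simp
  · intro i hi
    rw [X.nProd_eq_zero h h' i (by omega)]
    simp

theorem form_comm (h h' : X.H) : X.form h h' = X.form h' h := by
  have e := skew_of_trunc (h : X.V) (h' : X.V) 1
    (fun n hn => X.nProd_eq_zero h h' n (Or.inr (by omega)))
  rw [X.nProd_one, X.nProd_one] at e
  simp only [zpow_one, neg_smul, one_smul, neg_neg] at e
  exact smul_left_injective ℂ vac_ne_zero e

theorem form_isSymm : X.form.IsSymm := ⟨fun h h' => X.form_comm h h'⟩

/-- The vectors of weight `α` that are killed by all `h(n)` with `n ≥ 1`. -/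
def IsWeightVector (α : X.H) (v : X.V) : Prop :=
  (∀ (h : X.H) (n : ℤ), 1 ≤ n → nProd n (h : X.V) v = 0) ∧
    ∀ h : X.H, nProd 0 (h : X.V) v = X.form h α • v

variable {X}

/-- On a weight vector only the terms `h_i(-1) h^i(0)` of `ω_H(0)` survive. -/
theorem IsWeightVector.sugawara_zero {α : X.H} {v : X.V} (hv : X.IsWeightVector α v) :
    nProd 0 X.sugawara v = nProd (-1) (α : X.V) v := by
  have key : ∀ h h' : X.H, nProd 0 (nProd (-1) (h : X.V) (h' : X.V)) v =
      nProd (-1) (X.form h' α • (h : X.V) + X.form h α • (h' : X.V)) v := by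
    intro h h'
    rw [nProd_nProd, finsum_eq_single _ 0]
    · simp [hv.2]
    · intro i hi
      rw [hv.1 h' _ (by omega), hv.1 h _ (by omega)]
      simp
  set b := Module.finBasis ℂ X.H
  set d := X.form.dualBasis X.nondegenerate b
  have e1 : ∑ i, X.form (b i) α • d i = α := by
    conv_rhs => rw [← d.sum_repr α]
    refine Finset.sum_congr rfl fun i _ => ?_
    rw [X.form_comm, LinearMap.BilinForm.dualBasis_repr_apply]
  have e2 : ∑ i, X.form (d i) α • b i = α := by
    have hd : X.form.dualBasis X.nondegenerate d = b :=
      LinearMap.BilinForm.dualBasis_dualBasis X.nondegenerate X.form_isSymm b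
    conv_rhs => rw [← (X.form.dualBasis X.nondegenerate d).sum_repr α]
    refine Finset.sum_congr rfl fun i _ => ?_
    rw [X.form_comm, LinearMap.BilinForm.dualBasis_repr_apply, hd]
  have e3 : ∑ i, (X.form (d i) α • ((b i : X.H) : X.V) + X.form (b i) α • ((d i : X.H) : X.V)) =
      (2 : ℂ) • (α : X.V) := by
    rw [Finset.sum_add_distrib]
    have e1' := congrArg (Submodule.subtype X.H) e1
    have e2' := congrArg (Submodule.subtype X.H) e2
    simp only [map_sum, map_smul, Submodule.subtype_apply] at e1' e2'
    rw [e1', e2', two_smul]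
  unfold sugawara
  rw [map_smul, map_sum, LinearMap.smul_apply, LinearMap.sum_apply]
  simp only [key]
  rw [← LinearMap.sum_apply, ← map_sum, e3, map_smul, LinearMap.smul_apply, smul_smul]
  norm_num

theorem mem_vacuumSpace_iff {α : X.H} {v : X.V} :
    v ∈ X.vacuumSpace α ↔ X.T v = nProd (-1) (α : X.V) v ∧ X.IsWeightVector α v := by
  constructor
  · intro h
    have hw : X.IsWeightVector α v := ⟨h.2.1, h.2.2⟩
    exact ⟨h.1.trans hw.sugawara_zero, hw⟩
  · rintro ⟨h, hw⟩
    exact ⟨h.trans hw.sugawara_zero.symm, hw.1, hw.2⟩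

theorem isWeightVector_of_mem {α : X.H} {v : X.V} (hv : v ∈ X.vacuumSpace α) :
    X.IsWeightVector α v := (mem_vacuumSpace_iff.1 hv).2

/-- The commutator of `h(p)` with `Y(v, z)`, for `v ∈ Ω^α`. -/
theorem heis_vacuumSpace_comm {α : X.H} {v : X.V} (hv : v ∈ X.vacuumSpace α) (h : X.H)
    (p q : ℤ) (c : X.V) : nProd p (h : X.V) (nProd q v c) =
      X.form h α • nProd (p + q) v c + nProd q v (nProd p (h : X.V) c) := by
  rw [commutator_of_trunc (fun n hn => hv.2.1 h n hn), hv.2.2 h]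
  simp

/-- The differential equation satisfied by `Y(v, z)w`, for `v ∈ Ω^α` and `w` of weight `β`. -/
theorem vacuumSpace_recursion {α β : X.H} {v w : X.V} (hv : v ∈ X.vacuumSpace α)
    (hw : X.IsWeightVector β w) (k : ℤ) :
    ((k : ℂ) - X.form α β) • nProd (-k - 1) v w =
      ∑ᶠ i : ℕ, nProd (-1 - i : ℤ) (α : X.V) (nProd (-k + i) v w) := by
  have h1 := nProd_translate v w (-k)
  rw [show nProd (-2) v vac = nProd (-1) (α : X.V) v from (mem_vacuumSpace_iff.1 hv).1,
    nProd_nProd] at h1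
  have e : ∀ i : ℕ, ((-1) ^ i * Ring.choose (-1) i : ℤ) •
      (nProd (-1 - i : ℤ) (α : X.V) (nProd (-k + i) v w)
        - ((-1 : ℂ) ^ (-1 : ℤ)) • nProd (-k + -1 - i) v (nProd i (α : X.V) w)) =
      nProd (-1 - i : ℤ) (α : X.V) (nProd (-k + i) v w) +
        nProd (-k + -1 - i) v (nProd i (α : X.V) w) := by
    intro i
    rw [choose_neg_one_int, ← pow_add, ← two_mul, pow_mul]
    norm_num
  simp only [e] at h1
  obtain ⟨M, hM⟩ := exists_trunc_nat v w (-k)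
  rw [finsum_add_distrib, finsum_eq_single (fun i : ℕ => nProd (-k + -1 - i) v _) 0] at h1
  · simp only [Nat.cast_zero, sub_zero, hw.2, neg_neg, map_smul] at h1
    rw [sub_smul, Int.cast_smul_eq_zsmul ℂ, ← h1, ← sub_eq_add_neg]
    simp
  · intro i hi
    rw [hw.1 _ _ (by omega), map_zero]
  · refine (Finset.range M).finite_toSet.subset fun i hi => ?_
    by_contra hi'
    exact hi (by simp only [Finset.coe_range, Set.mem_Iio, not_lt] at hi'; simp [hM i hi'])
  · refine (Finset.range 1).finite_toSet.subset fun i hi => ?_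
    by_contra hi'
    refine hi ?_
    simp only [Finset.coe_range, Set.mem_Iio, not_lt] at hi'
    beta_reduce
    rw [hw.1 _ _ (by omega), map_zero]

/-- By `vacuumSpace_recursion`, if the coefficients of `z^j` in `Y(v, z)w` vanish for all `j < k`,
so does the coefficient of `z^k`, except possibly for `k = (α, β)`. -/
theorem nProd_eq_zero_of_form_ne {α β : X.H} {v w : X.V} (hv : v ∈ X.vacuumSpace α)
    (hw : X.IsWeightVector β w) (K : ℤ)
    (h : ∀ k < K, X.form α β = k → nProd (-k - 1) v w = 0) :
    ∀ k < K, nProd (-k - 1) v w = 0 := by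
  obtain ⟨N, hN⟩ := truncation v w
  suffices H : ∀ m : ℕ, ∀ k : ℤ, k ≤ -N - 1 + m → k < K → nProd (-k - 1) v w = 0 from
    fun k hk => H (k + N + 1).toNat k (by omega) hk
  intro m
  induction m with
  | zero => exact fun k hk _ => hN _ (by omega)
  | succ m ih =>
    intro k hk hkK
    have h1 := vacuumSpace_recursion hv hw k
    rw [finsum_eq_zero_of_forall_eq_zero] at h1
    · rcases smul_eq_zero.1 h1 with h2 | h2
      · exact h k hkK (sub_eq_zero.1 h2).symm
      · exact h2
    · intro i
      have := ih (k - 1 - i) (by push_cast at hk; omega) (by omega)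
      rw [show -(k - 1 - i) - 1 = -k + i by ring] at this
      rw [this, map_zero]

theorem nProd_eq_zero_of_nonintegral {α β : X.H} {v w : X.V} (hv : v ∈ X.vacuumSpace α)
    (hw : X.IsWeightVector β w) (h : ¬ ∃ N : ℤ, X.form α β = N) (n : ℤ) : nProd n v w = 0 := by
  have := nProd_eq_zero_of_form_ne hv hw (-n) (fun k _ e => (h ⟨k, e⟩).elim) (-n - 1) (by omega)
  rwa [show -(-n - 1) - 1 = n by ring] at this

theorem nProd_eq_zero_of_lt {α β : X.H} {v w : X.V} (hv : v ∈ X.vacuumSpace α)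
    (hw : X.IsWeightVector β w) {N : ℤ} (h : X.form α β = N) {n : ℤ} (hn : -N - 1 < n) :
    nProd n v w = 0 := by
  have := nProd_eq_zero_of_form_ne hv hw (-n) (fun k hk e => by
    rw [h, Int.cast_inj] at e; omega) (-n - 1) (by omega)
  rwa [show -(-n - 1) - 1 = n by ring] at this

open Classical in
/-- The product of `Ω^α` and `Ω^β`: the leading coefficient of `Y(v, z)w`. -/
def leadingProd (α β : X.H) : X.V →ₗ[ℂ] X.V →ₗ[ℂ] X.V :=
  if h : ∃ N : ℤ, X.form α β = N then nProd (-h.choose - 1) else 0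

theorem leadingProd_eq {α β : X.H} {N : ℤ} (h : X.form α β = N) :
    leadingProd α β = nProd (V := X.V) (-N - 1) := by
  have h' : ∃ N : ℤ, X.form α β = N := ⟨N, h⟩
  rw [leadingProd, dif_pos h']
  have : h'.choose = N := by exact_mod_cast h'.choose_spec.symm.trans h
  rw [this]

theorem leadingProd_eq_zero {α β : X.H} (h : ¬ ∃ N : ℤ, X.form α β = N) :
    leadingProd α β = 0 := dif_neg h

theorem nProd_mem_vacuumSpace {α β : X.H} {v w : X.V} (hv : v ∈ X.vacuumSpace α)
    (hw : w ∈ X.vacuumSpace β) {N : ℤ} (h : X.form α β = N) :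
    nProd (-N - 1) v w ∈ X.vacuumSpace (α + β) := by
  refine ⟨?_, fun h' n hn => ?_, fun h' => ?_⟩
  · have h1 := hv.1
    have h2 := hw.1
    unfold T at *
    rw [translate_nProd, commutator_zero, h1, h2]
  · rw [heis_vacuumSpace_comm hv, hw.2.1 h' n hn,
      nProd_eq_zero_of_lt hv (isWeightVector_of_mem hw) h (by omega)]
    simp
  · rw [heis_vacuumSpace_comm hv, hw.2.2 h', map_smul, map_add, add_smul, zero_add]

theorem leadingProd_mem {α β : X.H} {v w : X.V} (hv : v ∈ X.vacuumSpace α)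
    (hw : w ∈ X.vacuumSpace β) : leadingProd α β v w ∈ X.vacuumSpace (α + β) := by
  by_cases h : ∃ N : ℤ, X.form α β = N
  · obtain ⟨N, h⟩ := h
    rw [leadingProd_eq h]
    exact nProd_mem_vacuumSpace hv hw h
  · rw [leadingProd_eq_zero h]
    exact zero_mem _

theorem vac_mem_vacuumSpace : (vac : X.V) ∈ X.vacuumSpace 0 := by
  refine ⟨?_, fun h n hn => nProd_vac_of_nonneg _ _ (by omega), fun h => ?_⟩
  · have := nProd_vac_vac (V := X.V) 0
    simp only [Nat.cast_zero, sub_zero] at this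
    rw [T, this, nProd_vac_of_nonneg _ _ le_rfl]
  · rw [nProd_vac_of_nonneg _ _ le_rfl]; simp

theorem leadingProd_vac_left (β : X.H) (w : X.V) : leadingProd 0 β vac w = w := by
  rw [leadingProd_eq (N := 0) (by simp), nProd_vac_left, if_pos (by simp)]

theorem leadingProd_vac_right (β : X.H) (w : X.V) : leadingProd β 0 w vac = w := by
  rw [leadingProd_eq (N := 0) (by simp), neg_zero, zero_sub, nProd_neg_one_vac]

/-- If all three pairings are integers, this is `assoc_of_trunc`. Otherwise both sides vanish: the
Borcherds identity expresses either one through a product `Y(u, z)v` or `Y(v, z)w` that is zero. -/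
theorem leadingProd_assoc {α β γ : X.H} {u v w : X.V} (hu : u ∈ X.vacuumSpace α)
    (hv : v ∈ X.vacuumSpace β) (hw : w ∈ X.vacuumSpace γ) :
    leadingProd (α + β) γ (leadingProd α β u v) w =
      leadingProd α (β + γ) u (leadingProd β γ v w) := by
  have hv' := isWeightVector_of_mem hv
  have hw' := isWeightVector_of_mem hw
  obtain ⟨M, hM⟩ := truncation u w
  by_cases hαβ : ∃ N : ℤ, X.form α β = N
  · obtain ⟨a, ha⟩ := hαβ
    rw [leadingProd_eq ha]
    by_cases hβγ : ∃ N : ℤ, X.form β γ = N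
    · obtain ⟨b, hb⟩ := hβγ
      rw [leadingProd_eq hb]
      by_cases hαγ : ∃ N : ℤ, X.form α γ = N
      · obtain ⟨c, hc⟩ := hαγ
        have e := assoc_of_trunc u v w (-c) (-b - 1) (-a - 1)
          (fun n hn => nProd_eq_zero_of_lt hu hv' ha hn)
          (fun n hn => nProd_eq_zero_of_lt hv hw' hb hn)
          (fun n hn => nProd_eq_zero_of_lt hu hw' hc (by omega))
        rw [leadingProd_eq (N := c + b) (by simp [hb, hc]),
          leadingProd_eq (N := a + c) (by simp [ha, hc]),
          show -(c + b) - 1 = -c + (-b - 1) by ring, show -(a + c) - 1 = -c + (-a - 1) by ring, e]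
      -- as `(α, β)` and `(β, γ)` are integers, neither `(α + β, γ)` nor `(α, β + γ)` is one
      · rw [leadingProd_eq_zero, leadingProd_eq_zero]
        · rfl
        · rintro ⟨N, hN⟩
          refine hαγ ⟨N - a, ?_⟩
          rw [map_add, ha] at hN
          push_cast
          rw [← hN]; ring
        · rintro ⟨N, hN⟩
          refine hαγ ⟨N - b, ?_⟩
          rw [map_add, LinearMap.add_apply, hb] at hN
          push_cast
          rw [← hN]; ring
    · rw [leadingProd_eq_zero hβγ, LinearMap.zero_apply, LinearMap.zero_apply, map_zero]
      by_cases h : ∃ N : ℤ, X.form (α + β) γ = N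
      · obtain ⟨N, h⟩ := h
        have e := assoc_of_trunc u v w M (-N - 1 - M) (-a - 1)
          (fun n hn => nProd_eq_zero_of_lt hu hv' ha hn)
          (fun n _ => nProd_eq_zero_of_nonintegral hv hw' hβγ n) hM
        rw [add_sub_cancel, nProd_eq_zero_of_nonintegral hv hw' hβγ, map_zero] at e
        rw [leadingProd_eq h, e]
      · rw [leadingProd_eq_zero h]; rfl
  · rw [leadingProd_eq_zero hαβ, LinearMap.zero_apply, LinearMap.zero_apply, map_zero,
      LinearMap.zero_apply]
    by_cases hβγ : ∃ N : ℤ, X.form β γ = N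
    · obtain ⟨b, hb⟩ := hβγ
      rw [leadingProd_eq hb]
      by_cases h : ∃ N : ℤ, X.form α (β + γ) = N
      · obtain ⟨N, h⟩ := h
        have e := assoc_of_trunc u v w M (-b - 1) (-N - 1 - M)
          (fun n _ => nProd_eq_zero_of_nonintegral hu hv' hαβ n)
          (fun n hn => nProd_eq_zero_of_lt hv hw' hb hn) hM
        rw [add_sub_cancel, nProd_eq_zero_of_nonintegral hu hv' hαβ, map_zero,
          LinearMap.zero_apply] at e
        rw [leadingProd_eq h, ← e]
      · rw [leadingProd_eq_zero h]; rfl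
    · rw [leadingProd_eq_zero hβγ, LinearMap.zero_apply, LinearMap.zero_apply, map_zero]

theorem leadingProd_skew {α β : X.H} {v w : X.V} (hv : v ∈ X.vacuumSpace α)
    (hw : w ∈ X.vacuumSpace β) {N : ℤ} (h : X.form α β = N) :
    leadingProd α β v w = (-1 : ℂ) ^ N • leadingProd β α w v := by
  rw [leadingProd_eq h, leadingProd_eq ((X.form_comm β α).trans h), skew_of_trunc v w _
    (fun n hn => nProd_eq_zero_of_lt hv (isWeightVector_of_mem hw) h hn), ← neg_smul]
  congr 1
  rw [zpow_sub₀ (by norm_num), zpow_neg, ← inv_zpow]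
  norm_num [div_neg]

/-- Vectors of distinct weights are linearly independent, as the form is non-degenerate. -/
theorem iSupIndep_vacuumSpace : iSupIndep X.vacuumSpace := by
  have h1 := Module.End.independent_iInf_maxGenEigenspace_of_forall_mapsTo
    (fun h : X.H => nProd 0 (h : X.V)) (fun i j μ => by
      refine Module.End.mapsTo_maxGenEigenspace_of_comm ?_ μ
      ext c
      have := X.heis_comm i j 0 0 c
      simp only [Int.cast_zero, zero_mul, zero_smul, ite_self, add_zero] at this
      simp [this])
  have hinj : Function.Injective fun (α : X.H) (h : X.H) => X.form h α := by
    intro α β e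
    have e' : ∀ h : X.H, X.form h α = X.form h β := fun h => congrFun e h
    refine sub_eq_zero.1 (X.nondegenerate.2 _ fun h => ?_)
    rw [map_sub, e', sub_self]
  refine (h1.comp hinj).mono fun α v hv => ?_
  simp only [Function.comp_apply, Submodule.mem_iInf]
  intro h
  refine Module.End.mem_maxGenEigenspace _ _ _ |>.2 ⟨1, ?_⟩
  simp [hv.2.2 h]

end VHPair

/-! ### The functor of vacuum spaces -/

theorem AHPair.grade_induction (P : AHPair.{u}) {p : P.A → Prop}
    (mem : ∀ α, ∀ a ∈ P.grade α, p a) (zero : p 0) (add : ∀ a b, p a → p b → p (a + b))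
    (a : P.A) : p a := by
  classical
  have h : a ∈ ⨆ α, P.grade α := by
    rw [P.isInternal.submodule_iSup_eq_top]; trivial
  exact Submodule.iSup_induction (motive := p) _ h mem zero add

theorem AHPair.linearMap_ext {P : AHPair.{u}} {M : Type*} [AddCommGroup M] [Module ℂ M]
    {f g : P.A →ₗ[ℂ] M} (h : ∀ α, ∀ a ∈ P.grade α, f a = g a) : f = g :=
  LinearMap.ext fun a => P.grade_induction (p := fun a => f a = g a) h (by simp)
    (fun a b ha hb => by simp [ha, hb]) a

namespace VHPair

open VertexAlgebra DirectSum

theorem gradedMk_eq {X : VHPair.{u}} {α β : X.H} {x : X.vacuumSpace α} {y : X.vacuumSpace β}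
    (h : α = β) (hxy : (x : X.V) = y) :
    (GradedMonoid.mk α x : GradedMonoid fun α : X.H => X.vacuumSpace α) = GradedMonoid.mk β y := by
  subst h
  rw [Subtype.ext hxy]

instance gOneVacuumSpace (X : VHPair.{u}) :
    GradedMonoid.GOne fun α : X.H => X.vacuumSpace α where
  one := ⟨vac, vac_mem_vacuumSpace⟩

instance gMulVacuumSpace (X : VHPair.{u}) :
    GradedMonoid.GMul fun α : X.H => X.vacuumSpace α where
  mul {α β} v w := ⟨leadingProd α β (v : X.V) (w : X.V), leadingProd_mem v.2 w.2⟩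

instance gMonoidVacuumSpace (X : VHPair.{u}) :
    GradedMonoid.GMonoid fun α : X.H => X.vacuumSpace α where
  toGMul := gMulVacuumSpace X
  toGOne := gOneVacuumSpace X
  one_mul := fun ⟨β, _⟩ => gradedMk_eq (zero_add β) (leadingProd_vac_left β _)
  mul_one := fun ⟨β, _⟩ => gradedMk_eq (add_zero β) (leadingProd_vac_right β _)
  mul_assoc := fun ⟨_, u⟩ ⟨_, v⟩ ⟨_, w⟩ =>
    gradedMk_eq (add_assoc _ _ _) (leadingProd_assoc u.2 v.2 w.2)

instance gRingVacuumSpace (X : VHPair.{u}) :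
    DirectSum.GRing fun α : X.H => X.vacuumSpace α where
  toGMonoid := gMonoidVacuumSpace X
  mul_zero v := Subtype.ext (map_zero (leadingProd _ _ (v : X.V)))
  zero_mul w := Subtype.ext (LinearMap.map_zero₂ (leadingProd _ _) (w : X.V))
  mul_add v w w' := Subtype.ext (map_add (leadingProd _ _ (v : X.V)) (w : X.V) (w' : X.V))
  add_mul v v' w := Subtype.ext
    (LinearMap.map_add₂ (leadingProd _ _) (v : X.V) (v' : X.V) (w : X.V))
  natCast n := n • (⟨vac, vac_mem_vacuumSpace⟩ : X.vacuumSpace 0)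
  natCast_zero := zero_nsmul _
  natCast_succ n := succ_nsmul (⟨vac, vac_mem_vacuumSpace⟩ : X.vacuumSpace 0) n
  intCast n := n • (⟨vac, vac_mem_vacuumSpace⟩ : X.vacuumSpace 0)
  intCast_ofNat n := natCast_zsmul _ n
  intCast_negSucc_ofNat n := negSucc_zsmul _ n

instance gAlgebraVacuumSpace (X : VHPair.{u}) :
    DirectSum.GAlgebra ℂ fun α : X.H => X.vacuumSpace α where
  toFun := (LinearMap.toSpanSingleton ℂ _
    (⟨vac, vac_mem_vacuumSpace⟩ : X.vacuumSpace 0)).toAddMonoidHom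
  map_one := one_smul ℂ (⟨vac, vac_mem_vacuumSpace⟩ : X.vacuumSpace 0)
  map_mul r s := gradedMk_eq (add_zero 0).symm (by
    change ((r * s) • (vac : X.V)) = leadingProd 0 0 (r • (vac : X.V)) (s • (vac : X.V))
    rw [map_smul, LinearMap.map_smul₂, leadingProd_vac_left, mul_smul, smul_comm])
  commutes := fun r ⟨β, w⟩ => gradedMk_eq ((zero_add β).trans (add_zero β).symm) (by
    change leadingProd 0 β (r • (vac : X.V)) (w : X.V) = leadingProd β 0 (w : X.V) (r • (vac : X.V))
    simp [leadingProd_vac_left, leadingProd_vac_right])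
  smul_def := fun r ⟨β, w⟩ => gradedMk_eq (zero_add β).symm (by
    change r • (w : X.V) = leadingProd 0 β (r • (vac : X.V)) (w : X.V)
    simp [leadingProd_vac_left])

variable (X : VHPair.{u})

open Classical in
/-- The inclusion of `Ω = ⨁ α, Ω^α` into `V`. -/
def vacuumIncl : (⨁ α : X.H, X.vacuumSpace α) →ₗ[ℂ] X.V :=
  DirectSum.coeLinearMap X.vacuumSpace

theorem vacuumIncl_injective : Function.Injective X.vacuumIncl := by
  classical
  exact X.iSupIndep_vacuumSpace.dfinsupp_lsum_injective

open Classical in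
@[simp]
theorem vacuumIncl_of (α : X.H) (v : X.vacuumSpace α) :
    X.vacuumIncl (DirectSum.of (fun α : X.H => X.vacuumSpace α) α v) = v :=
  DirectSum.coeLinearMap_of _ _ _

open Classical in
/-- The summand `Ω^α` of `⨁ α, Ω^α`. -/
def vacuumGrade (α : X.H) : Submodule ℂ (⨁ α : X.H, X.vacuumSpace α) :=
  LinearMap.range (DirectSum.lof ℂ X.H (fun α : X.H => X.vacuumSpace α) α)

open Classical in
theorem isInternal_vacuumGrade : DirectSum.IsInternal X.vacuumGrade := by
  let d : (⨁ α : X.H, X.vacuumSpace α) →ₗ[ℂ] ⨁ α : X.H, X.vacuumGrade α :=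
    DirectSum.toModule ℂ X.H _ fun α =>
      DirectSum.lof ℂ X.H (fun α => X.vacuumGrade α) α ∘ₗ LinearMap.rangeRestrict _
  let _ : DirectSum.Decomposition X.vacuumGrade := Decomposition.ofLinearMap _ d (by
    ext α v : 2
    simp only [d, LinearMap.comp_apply, DirectSum.toModule_lof, LinearMap.id_apply]
    exact DirectSum.coeLinearMap_lof _ _ _) (by
    refine DirectSum.linearMap_ext _ fun α => LinearMap.ext ?_
    rintro ⟨_, v, rfl⟩
    simp only [LinearMap.comp_apply, LinearMap.id_apply, DirectSum.coeLinearMap_lof, d,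
      DirectSum.toModule_lof]
    rfl)
  exact Decomposition.isInternal _

open Classical in
theorem mem_vacuumGrade_iff {α : X.H} {a : ⨁ α : X.H, X.vacuumSpace α} :
    a ∈ X.vacuumGrade α ↔ X.vacuumIncl a ∈ X.vacuumSpace α := by
  constructor
  · rintro ⟨v, rfl⟩
    exact (X.vacuumIncl_of α v).symm ▸ v.2
  · intro h
    exact ⟨⟨_, h⟩, X.vacuumIncl_injective (X.vacuumIncl_of α ⟨_, h⟩)⟩

open Classical in
theorem vacuumIncl_one : X.vacuumIncl 1 = vac := by
  rw [DirectSum.one_def, vacuumIncl_of]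
  rfl

variable {X}

open Classical in
theorem vacuumIncl_mul {α β : X.H} {a b : ⨁ α : X.H, X.vacuumSpace α} (ha : a ∈ X.vacuumGrade α)
    (hb : b ∈ X.vacuumGrade β) :
    X.vacuumIncl (a * b) = leadingProd α β (X.vacuumIncl a) (X.vacuumIncl b) := by
  obtain ⟨v, rfl⟩ := ha
  obtain ⟨w, rfl⟩ := hb
  rw [DirectSum.lof_eq_of, DirectSum.lof_eq_of, DirectSum.of_mul_of, vacuumIncl_of, vacuumIncl_of,
    vacuumIncl_of]
  rfl

variable (X)

open Classical in
/-- The AH pair `Ω(V, H)`. Its algebra is the external direct sum of the spaces `Ω^α`. -/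
def vacuumPair : AHPair.{u} where
  A := ⨁ α : X.H, X.vacuumSpace α
  H := X.H
  ring := DirectSum.ring _
  algebra := inferInstance
  nontrivial := ⟨⟨1, 0, fun h => vac_ne_zero (V := X.V) (by
    rw [← X.vacuumIncl_one, h, map_zero])⟩⟩
  form := X.form
  isSymm := X.form_isSymm
  nondegenerate := X.nondegenerate
  grade := X.vacuumGrade
  isInternal := by
    convert X.isInternal_vacuumGrade
    rfl
  one_mem := by
    rw [mem_vacuumGrade_iff, vacuumIncl_one]
    exact vac_mem_vacuumSpace
  mul_mem := by
    intro α β a b ha hb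
    rw [mem_vacuumGrade_iff, vacuumIncl_mul ha hb]
    exact leadingProd_mem (X.mem_vacuumGrade_iff.1 ha) (X.mem_vacuumGrade_iff.1 hb)
  integral_of_mul_ne_zero := by
    intro α β a b ha hb h
    by_contra hN
    refine h (X.vacuumIncl_injective ?_)
    rw [vacuumIncl_mul ha hb, leadingProd_eq_zero hN, map_zero]
    rfl
  mul_comm_sign := by
    intro α β a b ha hb N hN
    refine X.vacuumIncl_injective ?_
    rw [map_smul, vacuumIncl_mul ha hb, vacuumIncl_mul hb ha]
    exact leadingProd_skew (X.mem_vacuumGrade_iff.1 ha) (X.mem_vacuumGrade_iff.1 hb) hN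

theorem nProd_ne_zero_cases {α β : X.H} {a b : X.vacuumPair.A} (ha : a ∈ X.vacuumGrade α)
    (hb : b ∈ X.vacuumGrade β)
    (h : ∃ n : ℤ, nProd n (X.vacuumIncl a) (X.vacuumIncl b) ≠ 0) :
    ∃ N : ℤ, X.form α β = N ∧ X.vacuumIncl (a * b) =
      nProd (-N - 1) (X.vacuumIncl a) (X.vacuumIncl b) := by
  obtain ⟨n, hn⟩ := h
  by_cases hN : ∃ N : ℤ, X.form α β = N
  · obtain ⟨N, hN⟩ := hN
    exact ⟨N, hN, by rw [← leadingProd_eq hN]; exact vacuumIncl_mul ha hb⟩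
  · exact (hn (nProd_eq_zero_of_nonintegral (X.mem_vacuumGrade_iff.1 ha)
      (isWeightVector_of_mem (X.mem_vacuumGrade_iff.1 hb)) hN n)).elim

theorem mul_eq_zero_of_nProd {α β : X.H} {a b : X.vacuumPair.A} (ha : a ∈ X.vacuumGrade α)
    (hb : b ∈ X.vacuumGrade β)
    (h : ∀ n : ℤ, nProd n (X.vacuumIncl a) (X.vacuumIncl b) = 0) : a * b = 0 := by
  refine X.vacuumIncl_injective ((vacuumIncl_mul ha hb).trans ?_)
  refine Eq.trans ?_ (map_zero X.vacuumIncl).symm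
  by_cases hN : ∃ N : ℤ, X.form α β = N
  · obtain ⟨N, hN⟩ := hN
    rw [leadingProd_eq hN, h]
  · rw [leadingProd_eq_zero hN]; rfl

/-- The identification of `vacuumPair` with `(Ω_{V,H}, H)`. -/
def vacuumModel : VacuumModel X X.vacuumPair where
  isoH := LinearEquiv.refl ℂ X.H
  form_isoH _ _ := rfl
  incl := X.vacuumIncl
  incl_injective := X.vacuumIncl_injective
  map_grade α := by
    classical
    ext v
    constructor
    · rintro ⟨a, ha, rfl⟩
      exact X.mem_vacuumGrade_iff.1 ha
    · intro hv
      exact ⟨_, ⟨⟨v, hv⟩, rfl⟩, X.vacuumIncl_of α ⟨v, hv⟩⟩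
  incl_one := X.vacuumIncl_one
  mul_eq_nProd _ _ _ _ ha hb h := X.nProd_ne_zero_cases ha hb h
  mul_eq_zero _ _ _ _ ha hb h := X.mul_eq_zero_of_nProd ha hb h

end VHPair

namespace VacuumModel

open VertexAlgebra VHPair

variable {X : VHPair.{u}} {P : AHPair.{u}} (m : VacuumModel X P)

theorem incl_mem {α : X.H} {a : P.A} (ha : a ∈ P.grade (m.isoH α)) :
    m.incl a ∈ X.vacuumSpace α := by
  rw [← m.map_grade]
  exact Submodule.mem_map_of_mem ha

theorem incl_mul {α β : X.H} {v w : P.A} (hv : v ∈ P.grade (m.isoH α))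
    (hw : w ∈ P.grade (m.isoH β)) :
    m.incl (v * w) = leadingProd α β (m.incl v) (m.incl w) := by
  by_cases h : ∃ n : ℤ, nProd n (m.incl v) (m.incl w) ≠ 0
  · obtain ⟨N, hN, e⟩ := m.mul_eq_nProd α β v w hv hw h
    rw [leadingProd_eq hN, e]
  · push Not at h
    rw [m.mul_eq_zero α β v w hv hw h, map_zero]
    by_cases hN : ∃ N : ℤ, X.form α β = N
    · obtain ⟨N, hN⟩ := hN
      rw [leadingProd_eq hN, h]
    · rw [leadingProd_eq_zero hN]; rfl

theorem mem_grade_of_incl_mem {α : X.H} {a : P.A} (ha : m.incl a ∈ X.vacuumSpace α) :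
    a ∈ P.grade (m.isoH α) := by
  rw [← m.map_grade] at ha
  obtain ⟨b, hb, e⟩ := ha
  rwa [← m.incl_injective e]

section lift

variable {Q : AHPair.{u}} (e : Q.H ≃ₗ[ℂ] X.H) (g : Q.A →ₗ[ℂ] X.V)
  (hg : ∀ α, ∀ a ∈ Q.grade α, g a ∈ X.vacuumSpace (e α))

include hg in
theorem mem_range_incl (a : Q.A) : g a ∈ LinearMap.range m.incl := by
  refine Q.grade_induction (p := fun a => g a ∈ LinearMap.range m.incl) ?_ ?_ ?_ a
  · intro α a ha
    have := hg α a ha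
    rw [← m.map_grade] at this
    obtain ⟨b, _, hb⟩ := this
    exact ⟨b, hb⟩
  · simp
  · intro a b ha hb
    rw [map_add]
    exact add_mem ha hb

/-- The factorization through `Ω_{V,H}` of a linear map into `V` that maps each graded piece
into a vacuum space. -/
def liftLinear : Q.A →ₗ[ℂ] P.A :=
  (LinearEquiv.ofInjective m.incl m.incl_injective).symm.toLinearMap ∘ₗ
    g.codRestrict _ (m.mem_range_incl e g hg)

@[simp]
theorem incl_liftLinear (a : Q.A) : m.incl (m.liftLinear e g hg a) = g a := by
  have := (LinearEquiv.ofInjective m.incl m.incl_injective).apply_symm_apply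
    (g.codRestrict _ (m.mem_range_incl e g hg) a)
  exact congrArg Subtype.val this

/-- A morphism into `Ω(V, H)` is given by an isometry of the spaces `H` and a unital linear map
into `V` that maps the graded pieces into the vacuum spaces and the products to leading
coefficients. -/
def lift (he : ∀ α β, X.form (e α) (e β) = Q.form α β) (h1 : g 1 = vac)
    (hmul : ∀ α β, ∀ a ∈ Q.grade α, ∀ b ∈ Q.grade β,
      g (a * b) = leadingProd (e α) (e β) (g a) (g b)) : Q ⟶ P where
  toAlgHom := AlgHom.ofLinearMap (m.liftLinear e g hg)
    (m.incl_injective (by rw [incl_liftLinear, h1, m.incl_one])) (by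
      have key : ∀ α β, ∀ a ∈ Q.grade α, ∀ b ∈ Q.grade β, m.liftLinear e g hg (a * b) =
          m.liftLinear e g hg a * m.liftLinear e g hg b := by
        intro α β a ha b hb
        refine m.incl_injective ?_
        rw [m.incl_mul (α := e α) (β := e β)]
        · simp [hmul α β a ha b hb]
        · exact m.mem_grade_of_incl_mem (by simpa using hg α a ha)
        · exact m.mem_grade_of_incl_mem (by simpa using hg β b hb)
      intro a b
      induction a using Q.grade_induction with
      | mem α a ha =>
        induction b using Q.grade_induction with
        | mem β b hb => exact key α β a ha b hb
        | zero => simp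
        | add b b' hb hb' => rw [mul_add, map_add, map_add, hb, hb', mul_add]
      | zero => simp
      | add a a' ha ha' => rw [add_mul, map_add, map_add, ha, ha', add_mul])
  toLinearEquiv := e.trans m.isoH
  map_form α β := by simp [m.form_isoH, he]
  map_grade α a ha := m.mem_grade_of_incl_mem (by simpa using hg α a ha)

variable (he : ∀ α β, X.form (e α) (e β) = Q.form α β) (h1 : g 1 = vac)
  (hmul : ∀ α β, ∀ a ∈ Q.grade α, ∀ b ∈ Q.grade β,
      g (a * b) = leadingProd (e α) (e β) (g a) (g b))

theorem incl_alg_lift (a : Q.A) : m.incl (AHPair.alg (m.lift e g hg he h1 hmul) a) = g a :=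
  m.incl_liftLinear e g hg a

end lift

theorem hom_ext {Q : AHPair.{u}} {f f' : Q ⟶ P}
    (h : ∀ a, m.incl (AHPair.alg f a) = m.incl (AHPair.alg f' a))
    (h' : ∀ x, AHPair.isom f x = AHPair.isom f' x) : f = f' :=
  AHPair.Hom.ext (AlgHom.ext fun a => m.incl_injective (h a)) (LinearEquiv.ext h')

end VacuumModel

namespace VHPair

open VertexAlgebra

variable {X Y : VHPair.{u}} (f : X ⟶ Y)

theorem lin_vac : lin f vac = vac := VHPair.Hom.map_vac f

theorem lin_nProd (n : ℤ) (a b : X.V) : lin f (nProd n a b) = nProd n (lin f a) (lin f b) :=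
  VHPair.Hom.map_nProd f n a b

theorem lin_mem_H (h : X.H) : lin f h ∈ Y.H := by
  rw [← VHPair.Hom.map_H f]
  exact Submodule.mem_map_of_mem h.2

theorem form_of_lin {h h' : X.H} {k k' : Y.H} (hk : (k : Y.V) = lin f h)
    (hk' : (k' : Y.V) = lin f h') : Y.form k k' = X.form h h' := by
  have := Y.nProd_one k k'
  rw [hk, hk', ← lin_nProd, X.nProd_one, map_smul, lin_vac] at this
  exact (smul_left_injective ℂ vac_ne_zero this).symm

/-- The isometry of Heisenberg subspaces induced by a morphism of VH pairs. -/
def mapH : X.H ≃ₗ[ℂ] Y.H :=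
  LinearEquiv.ofBijective ((lin f).restrict fun h hh => lin_mem_H f ⟨h, hh⟩) (by
    constructor
    · rw [injective_iff_map_eq_zero]
      intro h hh
      refine X.nondegenerate.2 _ fun h' => ?_
      rw [← form_of_lin f (k := ⟨_, lin_mem_H f h'⟩)
        (k' := (lin f).restrict (fun h hh => lin_mem_H f ⟨h, hh⟩) h)
        rfl rfl, hh,
        map_zero]
    · rintro ⟨k, hk⟩
      have := hk
      rw [← VHPair.Hom.map_H f] at this
      obtain ⟨h, hh, rfl⟩ := this
      exact ⟨⟨h, hh⟩, rfl⟩)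

@[simp]
theorem coe_mapH (h : X.H) : (mapH f h : Y.V) = lin f h := rfl

theorem form_mapH (h h' : X.H) : Y.form (mapH f h) (mapH f h') = X.form h h' :=
  form_of_lin f rfl rfl

theorem lin_mem_vacuumSpace {α : X.H} {v : X.V} (hv : v ∈ X.vacuumSpace α) :
    lin f v ∈ Y.vacuumSpace (mapH f α) := by
  rw [mem_vacuumSpace_iff] at hv ⊢
  refine ⟨?_, fun k n hn => ?_, fun k => ?_⟩
  · have := congrArg (lin f) hv.1
    rw [T, lin_nProd, lin_nProd, lin_vac] at this
    exact this
  · obtain ⟨h, rfl⟩ := (mapH f).surjective k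
    rw [coe_mapH, ← lin_nProd, hv.2.1 h n hn, map_zero]
  · obtain ⟨h, rfl⟩ := (mapH f).surjective k
    rw [coe_mapH, ← lin_nProd, hv.2.2 h, map_smul, form_mapH]

theorem lin_leadingProd {α β : X.H} (v w : X.V) :
    lin f (leadingProd α β v w) = leadingProd (mapH f α) (mapH f β) (lin f v) (lin f w) := by
  by_cases h : ∃ N : ℤ, X.form α β = N
  · obtain ⟨N, h⟩ := h
    rw [leadingProd_eq h, leadingProd_eq ((form_mapH f α β).trans h), lin_nProd]
  · rw [leadingProd_eq_zero h, leadingProd_eq_zero (by rwa [form_mapH])]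
    simp

theorem lin_comp {Z : VHPair.{u}} (g : Y ⟶ Z) (v : X.V) : lin (f ≫ g) v = lin g (lin f v) := rfl

theorem hom_ext {f g : X ⟶ Y} (h : ∀ v, lin f v = lin g v) : f = g :=
  VHPair.Hom.ext (LinearMap.ext h)

/-- The morphism of AH pairs induced on vacuum spaces by a morphism of VH pairs. -/
def vacuumMap : X.vacuumPair ⟶ Y.vacuumPair :=
  Y.vacuumModel.lift (Q := X.vacuumPair) (mapH f) (lin f ∘ₗ X.vacuumModel.incl)
    (fun _ _ ha => lin_mem_vacuumSpace f (X.vacuumModel.incl_mem ha)) (form_mapH f)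
    (by rw [LinearMap.comp_apply, X.vacuumModel.incl_one, lin_vac])
    (fun α β a ha b hb => by
      rw [LinearMap.comp_apply, X.vacuumModel.incl_mul ha hb]
      exact lin_leadingProd f _ _)

theorem incl_vacuumMap (a : X.vacuumPair.A) :
    Y.vacuumModel.incl (AHPair.alg (vacuumMap f) a) = lin f (X.vacuumModel.incl a) :=
  Y.vacuumModel.incl_alg_lift (Q := X.vacuumPair) _ _ _ _ _ _ a

end VHPair

theorem AHPair.alg_comp {P Q R : AHPair.{u}} (f : P ⟶ Q) (g : Q ⟶ R) (a : P.A) :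
    AHPair.alg (f ≫ g) a = AHPair.alg g (AHPair.alg f a) := rfl

theorem AHPair.isom_comp {P Q R : AHPair.{u}} (f : P ⟶ Q) (g : Q ⟶ R) (h : P.H) :
    AHPair.isom (f ≫ g) h = AHPair.isom g (AHPair.isom f h) := rfl

/-- The functor `Ω`. -/
def vacuumFunctor : VHPair.{u} ⥤ AHPair.{u} where
  obj X := X.vacuumPair
  map f := VHPair.vacuumMap f
  map_id X := X.vacuumModel.hom_ext (fun a => VHPair.incl_vacuumMap _ a) fun _ => rfl
  map_comp {X Y Z} f g := Z.vacuumModel.hom_ext (fun a => by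
    rw [AHPair.alg_comp, VHPair.incl_vacuumMap, VHPair.incl_vacuumMap, VHPair.incl_vacuumMap,
      VHPair.lin_comp]) fun _ => rfl

theorem isVacuumFunctor_vacuumFunctor : IsVacuumFunctor vacuumFunctor.{u} :=
  ⟨fun X => X.vacuumModel, fun _ _ f => ⟨fun a => VHPair.incl_vacuumMap f a, fun _ => rfl⟩⟩

/-! ### Formal fields and their products -/

/-- The space of formal fields on `V`: sequences of operators `a(n)` such that, for every `v`,
`a(n)v = 0` for large `n`. -/
def FormalField (V : Type u) [AddCommGroup V] [Module ℂ V] :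
    Submodule ℂ (ℤ → Module.End ℂ V) where
  carrier := {a | ∀ v, ∃ N : ℤ, ∀ n, N ≤ n → a n v = 0}
  zero_mem' v := ⟨0, fun _ _ => rfl⟩
  add_mem' {a b} ha hb v := by
    obtain ⟨N, hN⟩ := ha v
    obtain ⟨M, hM⟩ := hb v
    exact ⟨max N M, fun n hn => by
      simp [hN n (le_trans (le_max_left _ _) hn), hM n (le_trans (le_max_right _ _) hn)]⟩
  smul_mem' c a ha v := by
    obtain ⟨N, hN⟩ := ha v
    exact ⟨N, fun n hn => by simp [hN n hn]⟩

namespace FormalField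

variable {V : Type u} [AddCommGroup V] [Module ℂ V]

theorem exists_trunc_nat (a : FormalField V) (q : ℤ) (v : V) :
    ∃ M : ℕ, ∀ i : ℕ, M ≤ i → a.1 (q + i) v = 0 := by
  obtain ⟨N, hN⟩ := a.2 v
  exact ⟨(N - q).toNat, fun i hi => hN _ (by omega)⟩

theorem expand_support (a b : FormalField V) (r p q : ℤ) (v : V) :
    Function.HasFiniteSupport fun i : ℕ =>
      ((-1) ^ i * Ring.choose r i : ℤ) • a.1 (p + r - i) (b.1 (q + i) v) := by
  obtain ⟨M, hM⟩ := exists_trunc_nat b q v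
  refine (Finset.range M).finite_toSet.subset fun i hi => ?_
  by_contra hi'
  simp only [Finset.coe_range, Set.mem_Iio, not_lt] at hi'
  exact hi (by simp [hM i hi'])

/-- The modes of `(x - w)^r a(x) b(w)`, where `(x - w)^r` is expanded in powers of `w / x`. -/
def expandProd (a b : FormalField V) (r p q : ℤ) : Module.End ℂ V where
  toFun v := ∑ᶠ i : ℕ, ((-1) ^ i * Ring.choose r i : ℤ) • a.1 (p + r - i) (b.1 (q + i) v)
  map_add' v w := by
    rw [← finsum_add_distrib (expand_support a b r p q v) (expand_support a b r p q w)]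
    simp
  map_smul' c v := by
    rw [RingHom.id_apply, smul_finsum' _ (expand_support a b r p q v)]
    refine finsum_congr fun i => ?_
    rw [map_smul, map_smul, smul_comm]

theorem expandProd_apply (a b : FormalField V) (r p q : ℤ) (v : V) :
    expandProd a b r p q v =
      ∑ᶠ i : ℕ, ((-1) ^ i * Ring.choose r i : ℤ) • a.1 (p + r - i) (b.1 (q + i) v) := rfl

theorem expandProd_eq_sum (a b : FormalField V) (r p q : ℤ) {v : V} {M : ℕ}
    (hM : ∀ i : ℕ, M ≤ i → b.1 (q + i) v = 0) :
    expandProd a b r p q v = ∑ i ∈ Finset.range M,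
      ((-1) ^ i * Ring.choose r i : ℤ) • a.1 (p + r - i) (b.1 (q + i) v) := by
  refine finsum_eq_sum_of_support_subset _ fun i hi => ?_
  by_contra hi'
  simp only [Finset.coe_range, Set.mem_Iio, not_lt] at hi'
  exact hi (by simp [hM i hi'])

theorem expandProd_eq_zero (a b : FormalField V) (r p q : ℤ) {v : V}
    (h : ∀ i : ℕ, b.1 (q + i) v = 0) : expandProd a b r p q v = 0 := by
  rw [expandProd_eq_sum a b r p q (M := 0) fun i _ => h i, Finset.sum_range_zero]

theorem expandProd_zero (a b : FormalField V) (p q : ℤ) :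
    expandProd a b 0 p q = a.1 p * b.1 q := by
  ext v
  rw [expandProd_apply, finsum_eq_single _ 0]
  · simp
  · intro i hi
    obtain ⟨j, rfl⟩ := Nat.exists_eq_succ_of_ne_zero hi
    simp [Ring.choose_zero_succ]

theorem expandProd_succ (a b : FormalField V) (r p q : ℤ) :
    expandProd a b (r + 1) p q = expandProd a b r (p + 1) q - expandProd a b r p (q + 1) := by
  ext v
  obtain ⟨M, hM⟩ := exists_trunc_nat b q v
  have hM1 : ∀ i : ℕ, M + 1 ≤ i → b.1 (q + i) v = 0 := fun i hi => hM i (by omega)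
  have hM2 : ∀ i : ℕ, M ≤ i → b.1 (q + 1 + i) v = 0 := fun i hi => by
    have := hM (i + 1) (by omega)
    push_cast at this
    rwa [add_assoc, add_comm 1 (i : ℤ)]
  rw [LinearMap.sub_apply, expandProd_eq_sum _ _ _ _ _ hM1, expandProd_eq_sum _ _ _ _ _ hM1,
    expandProd_eq_sum _ _ _ _ _ hM2, Finset.sum_range_succ', Finset.sum_range_succ',
    add_sub_right_comm (∑ k ∈ _, _), ← Finset.sum_sub_distrib]
  congr 1
  · refine Finset.sum_congr rfl fun i _ => ?_
    rw [Ring.choose_succ_succ, show p + (r + 1) - ((i + 1 : ℕ) : ℤ) = p + r - i by push_cast; ring,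
      show p + 1 + r - ((i + 1 : ℕ) : ℤ) = p + r - i by push_cast; ring,
      show q + ((i + 1 : ℕ) : ℤ) = q + 1 + i by push_cast; ring, ← sub_smul]
    congr 1
    ring
  · simp [add_comm, add_left_comm]

theorem expandProd_add_left (a a' b : FormalField V) (r p q : ℤ) :
    expandProd (a + a') b r p q = expandProd a b r p q + expandProd a' b r p q := by
  ext v
  obtain ⟨M, hM⟩ := exists_trunc_nat b q v
  simp [expandProd_eq_sum _ _ _ _ _ hM, Finset.sum_add_distrib]

theorem expandProd_smul_left (c : ℂ) (a b : FormalField V) (r p q : ℤ) :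
    expandProd (c • a) b r p q = c • expandProd a b r p q := by
  ext v
  obtain ⟨M, hM⟩ := exists_trunc_nat b q v
  simp only [expandProd_eq_sum _ _ _ _ _ hM, LinearMap.smul_apply, Finset.smul_sum]
  exact Finset.sum_congr rfl fun i _ => by simp [smul_comm c]

theorem expandProd_add_right (a b b' : FormalField V) (r p q : ℤ) :
    expandProd a (b + b') r p q = expandProd a b r p q + expandProd a b' r p q := by
  ext v
  rw [LinearMap.add_apply, expandProd_apply, expandProd_apply, expandProd_apply,
    ← finsum_add_distrib (expand_support a b r p q v) (expand_support a b' r p q v)]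
  simp

theorem expandProd_smul_right (c : ℂ) (a b : FormalField V) (r p q : ℤ) :
    expandProd a (c • b) r p q = c • expandProd a b r p q := by
  ext v
  rw [LinearMap.smul_apply, expandProd_apply, expandProd_apply,
    smul_finsum' _ (expand_support a b r p q v)]
  exact finsum_congr fun i => by simp [smul_comm c]

/-- The modes of `(x - w)^r [a(x), b(w)]`, where `(x - w)^r` is expanded in powers of `w / x` in
front of `a(x) b(w)` and in powers of `x / w` in front of `b(w) a(x)`. -/
def locBracket (a b : FormalField V) (r p q : ℤ) : Module.End ℂ V :=
  expandProd a b r p q - ((-1 : ℂ) ^ r) • expandProd b a r q p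

theorem locBracket_zero (a b : FormalField V) (p q : ℤ) :
    locBracket a b 0 p q = a.1 p * b.1 q - b.1 q * a.1 p := by
  simp [locBracket, expandProd_zero]

theorem locBracket_succ (a b : FormalField V) (r p q : ℤ) :
    locBracket a b (r + 1) p q = locBracket a b r (p + 1) q - locBracket a b r p (q + 1) := by
  rw [locBracket, locBracket, locBracket, expandProd_succ, expandProd_succ, zpow_add₀ (by norm_num),
    zpow_one, mul_neg_one, neg_smul, smul_sub]
  abel

theorem locBracket_swap (a b : FormalField V) (r p q : ℤ) :
    locBracket b a r q p = -((-1 : ℂ) ^ r • locBracket a b r p q) := by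
  rw [locBracket, locBracket, smul_sub, smul_smul, ← mul_zpow]
  simp

theorem locBracket_add_left (a a' b : FormalField V) (r p q : ℤ) :
    locBracket (a + a') b r p q = locBracket a b r p q + locBracket a' b r p q := by
  rw [locBracket, expandProd_add_left, expandProd_add_right, smul_add, locBracket, locBracket]
  abel

theorem locBracket_smul_left (c : ℂ) (a b : FormalField V) (r p q : ℤ) :
    locBracket (c • a) b r p q = c • locBracket a b r p q := by
  rw [locBracket, expandProd_smul_left, expandProd_smul_right, locBracket, smul_sub, smul_comm c]

/-- `(x - w)^N [a(x), b(w)] = 0`. -/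
def IsLocalOfOrder (a b : FormalField V) (N : ℕ) : Prop :=
  ∀ p q : ℤ, locBracket a b N p q = 0

/-- Mutual locality of two fields. -/
def IsLocal (a b : FormalField V) : Prop := ∃ N : ℕ, IsLocalOfOrder a b N

theorem IsLocalOfOrder.mono {a b : FormalField V} {N : ℕ} (h : IsLocalOfOrder a b N) {M : ℕ}
    (hM : N ≤ M) : IsLocalOfOrder a b M := by
  induction M, hM using Nat.le_induction with
  | base => exact h
  | succ M _ ih =>
    intro p q
    rw [Nat.cast_succ, locBracket_succ, ih, ih, sub_zero]

theorem IsLocalOfOrder.locBracket_eq_zero {a b : FormalField V} {N : ℕ}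
    (h : IsLocalOfOrder a b N) {r : ℤ} (hr : N ≤ r) (p q : ℤ) : locBracket a b r p q = 0 := by
  obtain ⟨M, rfl⟩ := Int.eq_ofNat_of_zero_le (by omega : 0 ≤ r)
  exact h.mono (by omega) p q

theorem IsLocalOfOrder.symm {a b : FormalField V} {N : ℕ} (h : IsLocalOfOrder a b N) :
    IsLocalOfOrder b a N := fun p q => by
  rw [locBracket_swap a b, h, smul_zero, neg_zero]

theorem IsLocal.symm {a b : FormalField V} (h : IsLocal a b) : IsLocal b a :=
  ⟨h.choose, h.choose_spec.symm⟩

theorem IsLocal.add_left {a a' b : FormalField V} (h : IsLocal a b) (h' : IsLocal a' b) :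
    IsLocal (a + a') b := by
  obtain ⟨N, hN⟩ := h
  obtain ⟨M, hM⟩ := h'
  refine ⟨max N M, fun p q => ?_⟩
  rw [locBracket_add_left, hN.mono (le_max_left _ _), hM.mono (le_max_right _ _), add_zero]

theorem IsLocal.smul_left {a b : FormalField V} (h : IsLocal a b) (c : ℂ) :
    IsLocal (c • a) b := by
  obtain ⟨N, hN⟩ := h
  refine ⟨N, fun p q => ?_⟩
  rw [locBracket_smul_left, hN, smul_zero]

/-- The identity field. -/
def idField (V : Type u) [AddCommGroup V] [Module ℂ V] : FormalField V :=
  ⟨fun n => if n = -1 then 1 else 0, fun v => ⟨0, fun n hn => by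
    simp only [if_neg (show ¬ n = -1 by omega), LinearMap.zero_apply]⟩⟩

theorem idField_apply (n : ℤ) (v : V) : (idField V).1 n v = if n = -1 then v else 0 := by
  simp only [idField]
  split_ifs <;> rfl

theorem isLocal_idField (b : FormalField V) : IsLocal (idField V) b := by
  refine ⟨0, fun p q => ?_⟩
  rw [Nat.cast_zero, locBracket_zero]
  simp only [idField]
  split_ifs <;> simp

/-- The `n`-th product of two fields: `Res_x (x - w)^n [a(x), b(w)]`. -/
def nthProd (a b : FormalField V) (n : ℤ) : FormalField V :=
  ⟨fun q => locBracket a b n 0 q, fun v => by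
    obtain ⟨N, hN⟩ := b.2 v
    obtain ⟨M, hM⟩ := exists_trunc_nat a 0 v
    have h1 : ∀ i : ℕ, ∃ K : ℤ, ∀ k, K ≤ k → b.1 k (a.1 (0 + i) v) = 0 := fun i => b.2 _
    choose K hK using h1
    obtain ⟨B, hB⟩ : ∃ B : ℤ, ∀ i < M, K i ≤ B := by
      obtain ⟨B, hB⟩ := ((Finset.range M).image K).exists_le
      exact ⟨B, fun i hi => hB _ (Finset.mem_image_of_mem _ (Finset.mem_range.2 hi))⟩
    refine ⟨max N (B + M - n), fun q hq => ?_⟩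
    simp only [locBracket]
    rw [LinearMap.sub_apply, LinearMap.smul_apply,
      expandProd_eq_zero a b _ _ _ (fun i => hN _ (by omega)), expandProd_eq_sum _ _ _ _ _ hM,
      Finset.sum_eq_zero, smul_zero, sub_zero]
    intro i hi
    rw [Finset.mem_range] at hi
    have := hB i hi
    rw [hK i _ (by omega), smul_zero]⟩

theorem nthProd_coe (a b : FormalField V) (n q : ℤ) :
    (nthProd a b n).1 q = locBracket a b n 0 q := rfl

theorem nthProd_eq_zero {a b : FormalField V} {N : ℕ} (h : IsLocalOfOrder a b N) {n : ℤ}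
    (hn : N ≤ n) : nthProd a b n = 0 :=
  Subtype.ext (funext fun q => h.locBracket_eq_zero hn 0 q)

/-! ### The Borcherds identity for local fields -/

/-- The left-hand side of the Borcherds identity, with the sum truncated to `i < M`. -/
def borcherdsSum (a b : FormalField V) (M : ℕ) (p q r : ℤ) : Module.End ℂ V :=
  ∑ i ∈ Finset.range M, (Ring.choose p i : ℤ) • (nthProd a b (r + i)).1 (p + q - i)

theorem borcherdsSum_succ {a b : FormalField V} {N : ℕ} (h : IsLocalOfOrder a b N) {M : ℕ}
    (p q : ℤ) {r : ℤ} (hM : N ≤ r + M) : borcherdsSum a b (M + 1) (p + 1) q r =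
      borcherdsSum a b (M + 1) p (q + 1) r + borcherdsSum a b (M + 1) p q (r + 1) := by
  unfold borcherdsSum
  rw [Finset.sum_range_succ', Finset.sum_range_succ', Finset.sum_range_succ _ M,
    nthProd_eq_zero h (n := r + 1 + M) (by omega)]
  simp only [Submodule.coe_zero, Pi.zero_apply, smul_zero, add_zero]
  rw [add_right_comm (∑ k ∈ _, _), ← Finset.sum_add_distrib]
  congr 1
  · refine Finset.sum_congr rfl fun i _ => ?_
    rw [Ring.choose_succ_succ, add_smul, add_comm,
      show p + 1 + q - ((i + 1 : ℕ) : ℤ) = p + q - i by push_cast; ring,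
      show p + (q + 1) - ((i + 1 : ℕ) : ℤ) = p + q - i by push_cast; ring,
      show r + ((i + 1 : ℕ) : ℤ) = r + 1 + i by push_cast; ring]
  · simp [add_comm, add_left_comm]

/-- The Borcherds identity for `p ≥ 0`, by induction on `p` from the definition of the products. -/
theorem borcherds_of_nonneg {a b : FormalField V} {N : ℕ} (h : IsLocalOfOrder a b N) (k : ℕ) :
    ∀ (M : ℕ) (q r : ℤ), N ≤ r + M → borcherdsSum a b (M + 1) k q r = locBracket a b r k q := by
  induction k with
  | zero =>
    intro M q r _
    unfold borcherdsSum
    rw [Finset.sum_range_succ', Finset.sum_eq_zero]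
    · simp [nthProd_coe]
    · intro i _
      simp [Ring.choose_zero_succ]
  | succ k ih =>
    intro M q r hM
    rw [Nat.cast_succ, borcherdsSum_succ h _ _ hM, ih _ _ _ hM, ih _ _ _ (by omega),
      locBracket_succ]
    abel

/-- The Borcherds identity for mutually local fields. Both sides satisfy the same Pascal-type
recursion in `p`, agree for `p = 0` by definition, and vanish for large `r` by locality. -/
theorem borcherds_of_isLocal {a b : FormalField V} {N : ℕ} (h : IsLocalOfOrder a b N)
    (p q r : ℤ) (M : ℕ) (hM : N ≤ r + M) :
    borcherdsSum a b (M + 1) p q r = locBracket a b r p q := by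
  rcases le_or_gt 0 p with hp | hp
  · obtain ⟨k, rfl⟩ := Int.eq_ofNat_of_zero_le hp
    exact borcherds_of_nonneg h k M q r hM
  · obtain ⟨k, hk⟩ := Int.eq_ofNat_of_zero_le (by omega : 0 ≤ -p)
    obtain rfl : p = -k := by omega
    clear hp hk
    induction k generalizing q r M with
    | zero => simpa using borcherds_of_nonneg h 0 M q r hM
    | succ k ih =>
      -- descending induction on `r`, starting from the range where both sides vanish
      suffices H : ∀ (j : ℕ) (q r : ℤ) (M : ℕ), N ≤ r + M → N ≤ r + j →
          borcherdsSum a b (M + 1) (-((k + 1 : ℕ) : ℤ)) q r =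
            locBracket a b r (-((k + 1 : ℕ) : ℤ)) q from H M q r M hM hM
      intro j
      induction j with
      | zero =>
        intro q r M _ hr
        rw [h.locBracket_eq_zero (by simpa using hr)]
        exact Finset.sum_eq_zero fun i _ => by
          rw [nthProd_eq_zero h (by push_cast at hr; omega)]; simp
      | succ j ihj =>
        intro q r M hM hr
        have e1 := borcherdsSum_succ h (-((k + 1 : ℕ) : ℤ)) (q - 1) hM
        have e2 := locBracket_succ a b r (-((k + 1 : ℕ) : ℤ)) (q - 1)
        rw [sub_add_cancel, show -((k + 1 : ℕ) : ℤ) + 1 = -k by push_cast; ring] at e1 e2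
        rw [ih _ _ _ hM, ihj (q - 1) (r + 1) M (by omega) (by push_cast at hr; omega), e2] at e1
        rw [← sub_eq_iff_eq_add] at e1
        rw [← e1]
        abel

/-! ### Locality of products of fields -/

section Dong

theorem commute_sub_sub {R : Type*} [Ring R] {a b c d : R} (hac : Commute a c) (had : Commute a d)
    (hbc : Commute b c) (hbd : Commute b d) : Commute (a - b) (c - d) :=
  (hac.sub_right had).sub_left (hbc.sub_right hbd)

variable (V) in
/-- Formal distributions in three variables, given by their modes. -/
abbrev Modes : Type u := ℤ → ℤ → ℤ → Module.End ℂ V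

variable (V) in
/-- Multiplication by the first variable. -/
def shiftX : Module.End ℂ (Modes V) where
  toFun f p q s := f (p + 1) q s
  map_add' _ _ := rfl
  map_smul' _ _ := rfl

variable (V) in
/-- Multiplication by the second variable. -/
def shiftW : Module.End ℂ (Modes V) where
  toFun f p q s := f p (q + 1) s
  map_add' _ _ := rfl
  map_smul' _ _ := rfl

variable (V) in
/-- Multiplication by the third variable. -/
def shiftZ : Module.End ℂ (Modes V) where
  toFun f p q s := f p q (s + 1)
  map_add' _ _ := rfl
  map_smul' _ _ := rfl

variable (V) in
/-- Exchange of the first two variables. -/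
def swapXW : Module.End ℂ (Modes V) where
  toFun f p q s := f q p s
  map_add' _ _ := rfl
  map_smul' _ _ := rfl

theorem commute_XW : Commute (shiftX V) (shiftW V) := rfl
theorem commute_XZ : Commute (shiftX V) (shiftZ V) := rfl
theorem commute_WZ : Commute (shiftW V) (shiftZ V) := rfl

/-- The modes of `(x - w)^r a(x) b(w)` commuted with `c(z)`. -/
def expandComm (a b c : FormalField V) (r : ℤ) : Modes V := fun p q s =>
  expandProd a b r p q * c.1 s - c.1 s * expandProd a b r p q

theorem sub_expandComm (a b c : FormalField V) (r : ℤ) :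
    (shiftX V - shiftW V) (expandComm a b c r) = expandComm a b c (r + 1) := by
  funext p q s
  change expandComm a b c r (p + 1) q s - expandComm a b c r p (q + 1) s = _
  simp only [expandComm, expandProd_succ]
  noncomm_ring

/-- Distributions that are truncated in the second variable, uniformly in the first. -/
def IsTruncW (f : Modes V) : Prop :=
  ∀ (s : ℤ) (v : V), ∃ N : ℤ, ∀ q, N ≤ q → ∀ p, f p q s v = 0

theorem IsTruncW.sub {f g : Modes V} (hf : IsTruncW f) (hg : IsTruncW g) : IsTruncW (f - g) := by
  intro s v
  obtain ⟨N, hN⟩ := hf s v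
  obtain ⟨M, hM⟩ := hg s v
  refine ⟨max N M, fun q hq p => ?_⟩
  change f p q s v - g p q s v = 0
  rw [hN q (by omega), hM q (by omega), sub_zero]

theorem IsTruncW.mul_X {f : Modes V} (hf : IsTruncW f) : IsTruncW (shiftX V f) := by
  intro s v
  obtain ⟨N, hN⟩ := hf s v
  exact ⟨N, fun q hq p => hN q hq (p + 1)⟩

theorem IsTruncW.mul_W {f : Modes V} (hf : IsTruncW f) : IsTruncW (shiftW V f) := by
  intro s v
  obtain ⟨N, hN⟩ := hf s v
  exact ⟨N, fun q hq p => hN (q + 1) (by omega) p⟩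

theorem IsTruncW.mul_Z {f : Modes V} (hf : IsTruncW f) : IsTruncW (shiftZ V f) := by
  intro s v
  obtain ⟨N, hN⟩ := hf (s + 1) v
  exact ⟨N, fun q hq p => hN q hq p⟩

theorem IsTruncW.pow {D : Module.End ℂ (Modes V)} (hD : ∀ f, IsTruncW f → IsTruncW (D f))
    (n : ℕ) : ∀ f, IsTruncW f → IsTruncW ((D ^ n) f) := by
  induction n with
  | zero => exact fun f hf => hf
  | succ n ih =>
    intro f hf
    rw [pow_succ]
    exact ih _ (hD f hf)

/-- A truncated distribution that is killed by `x - w` is zero. -/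
theorem IsTruncW.eq_zero {f : Modes V} (hf : IsTruncW f)
    (h : (shiftX V - shiftW V) f = 0) : f = 0 := by
  have h1 : ∀ p q s, f (p + 1) q s = f p (q + 1) s := fun p q s => by
    have := congrFun (congrFun (congrFun h p) q) s
    exact sub_eq_zero.1 this
  have h2 : ∀ (i : ℕ) (p q s : ℤ), f p q s = f (p - i) (q + i) s := by
    intro i
    induction i with
    | zero => intro p q s; simp
    | succ i ih =>
      intro p q s
      rw [ih p q s, show p - (i : ℤ) = (p - ((i + 1 : ℕ) : ℤ)) + 1 by push_cast; ring, h1]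
      congr 1
      push_cast; ring
  funext p q s
  ext v
  obtain ⟨N, hN⟩ := hf s v
  rw [h2 (N - q).toNat p q s, hN _ (by omega)]
  rfl

theorem isTruncW_expandComm (a b c : FormalField V) (r : ℤ) : IsTruncW (expandComm a b c r) := by
  intro s v
  obtain ⟨N, hN⟩ := b.2 v
  obtain ⟨M, hM⟩ := b.2 (c.1 s v)
  refine ⟨max N M, fun q hq p => ?_⟩
  change expandProd a b r p q (c.1 s v) - c.1 s (expandProd a b r p q v) = 0
  rw [expandProd_eq_zero _ _ _ _ _ (fun i => hN _ (by omega)),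
    expandProd_eq_zero _ _ _ _ _ (fun i => hM _ (by omega)), map_zero, sub_zero]

/-- The polynomial `(w - z)^N (x - z)^N`. -/
def dongPoly (V : Type u) [AddCommGroup V] [Module ℂ V] (N : ℕ) : Module.End ℂ (Modes V) :=
  (shiftW V - shiftZ V) ^ N * (shiftX V - shiftZ V) ^ N

theorem commute_WZ_XZ : Commute (shiftW V - shiftZ V) (shiftX V - shiftZ V) :=
  commute_sub_sub commute_XW.symm commute_WZ commute_XZ.symm (Commute.refl (shiftZ V))

theorem commute_dongPoly_XW (N : ℕ) : Commute (dongPoly V N) (shiftX V - shiftW V) := by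
  have h1 : Commute (shiftW V - shiftZ V) (shiftX V - shiftW V) :=
    commute_sub_sub commute_XW.symm (Commute.refl (shiftW V)) commute_XZ.symm commute_WZ.symm
  have h2 : Commute (shiftX V - shiftZ V) (shiftX V - shiftW V) :=
    commute_sub_sub (Commute.refl (shiftX V)) commute_XW commute_XZ.symm commute_WZ.symm
  exact (h1.pow_left N).mul_left (h2.pow_left N)

theorem pow_XZ_apply (a b c : FormalField V) (k : ℕ) : ((shiftX V - shiftZ V) ^ k)
    (fun p q s => (a.1 p * c.1 s - c.1 s * a.1 p) * b.1 q) =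
      fun p q s => locBracket a c k p s * b.1 q := by
  induction k with
  | zero => funext p q s; simp [locBracket_zero]
  | succ k ih =>
    rw [pow_succ', Module.End.mul_apply, ih]
    funext p q s
    rw [Nat.cast_succ, locBracket_succ, sub_mul]
    rfl

theorem pow_WZ_apply (a b c : FormalField V) (k : ℕ) : ((shiftW V - shiftZ V) ^ k)
    (fun p q s => a.1 p * (b.1 q * c.1 s - c.1 s * b.1 q)) =
      fun p q s => a.1 p * locBracket b c k q s := by
  induction k with
  | zero => funext p q s; simp [locBracket_zero]
  | succ k ih =>
    rw [pow_succ', Module.End.mul_apply, ih]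
    funext p q s
    rw [Nat.cast_succ, locBracket_succ, mul_sub]
    rfl

theorem dongPoly_expandComm {a b c : FormalField V} {N : ℕ} (hac : IsLocalOfOrder a c N)
    (hbc : IsLocalOfOrder b c N) (r : ℤ) : dongPoly V N (expandComm a b c r) = 0 := by
  have h0 : dongPoly V N (expandComm a b c 0) = 0 := by
    have e : expandComm a b c 0 =
        (fun p q s => (a.1 p * c.1 s - c.1 s * a.1 p) * b.1 q) +
        fun p q s => a.1 p * (b.1 q * c.1 s - c.1 s * b.1 q) := by
      funext p q s
      simp only [expandComm, expandProd_zero, Pi.add_apply]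
      noncomm_ring
    rw [e, map_add]
    have e1 : dongPoly V N (fun p q s => (a.1 p * c.1 s - c.1 s * a.1 p) * b.1 q) = 0 := by
      rw [dongPoly, Module.End.mul_apply, pow_XZ_apply]
      have : (fun p q s => locBracket a c N p s * b.1 q) = (0 : Modes V) := by
        funext p q s
        rw [hac, zero_mul]
        rfl
      rw [this, map_zero]
    have e2 : dongPoly V N (fun p q s => a.1 p * (b.1 q * c.1 s - c.1 s * b.1 q)) = 0 := by
      rw [dongPoly, (commute_WZ_XZ.pow_pow N N).eq, Module.End.mul_apply, pow_WZ_apply]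
      have : (fun p q s => a.1 p * locBracket b c N q s) = (0 : Modes V) := by
        funext p q s
        rw [hbc, mul_zero]
        rfl
      rw [this, map_zero]
    rw [e1, e2, add_zero]
  have hc : ∀ f, (shiftX V - shiftW V) (dongPoly V N f) = dongPoly V N ((shiftX V - shiftW V) f) :=
    fun f => (LinearMap.congr_fun (commute_dongPoly_XW N).eq f).symm
  induction r with
  | zero => exact h0
  | succ i ih => rw [← sub_expandComm, ← hc, ih, map_zero]
  | pred i ih =>
    refine IsTruncW.eq_zero ?_ (by rw [hc, sub_expandComm, sub_add_cancel, ih])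
    rw [dongPoly, Module.End.mul_apply]
    exact IsTruncW.pow (fun f hf => hf.mul_W.sub hf.mul_Z) _ _
      (IsTruncW.pow (fun f hf => hf.mul_X.sub hf.mul_Z) _ _ (isTruncW_expandComm a b c _))

theorem dongPoly_swap (N : ℕ) : SemiconjBy (swapXW V) (dongPoly V N) (dongPoly V N) := by
  have hX : SemiconjBy (swapXW V) (shiftX V) (shiftW V) := rfl
  have hW : SemiconjBy (swapXW V) (shiftW V) (shiftX V) := rfl
  have hZ : SemiconjBy (swapXW V) (shiftZ V) (shiftZ V) := rfl
  have h1 := ((hW.sub_right hZ).pow_right N).mul_right ((hX.sub_right hZ).pow_right N)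
  rwa [← (commute_WZ_XZ.pow_pow N N).eq] at h1

/-- The modes of `(x - w)^r [a(x), b(w)]` commuted with `c(z)`. -/
def bracketComm (a b c : FormalField V) (r : ℤ) : Modes V := fun p q s =>
  locBracket a b r p q * c.1 s - c.1 s * locBracket a b r p q

theorem bracketComm_eq (a b c : FormalField V) (r : ℤ) : bracketComm a b c r =
    expandComm a b c r - ((-1 : ℂ) ^ r) • swapXW V (expandComm b a c r) := by
  funext p q s
  change _ = (expandProd a b r p q * c.1 s - c.1 s * expandProd a b r p q) -
    ((-1 : ℂ) ^ r) • (expandProd b a r q p * c.1 s - c.1 s * expandProd b a r q p)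
  rw [bracketComm, locBracket, sub_mul, mul_sub, smul_mul_assoc, mul_smul_comm, smul_sub]
  abel

theorem dongPoly_bracketComm {a b c : FormalField V} {N : ℕ} (hac : IsLocalOfOrder a c N)
    (hbc : IsLocalOfOrder b c N) (r : ℤ) : dongPoly V N (bracketComm a b c r) = 0 := by
  have h : dongPoly V N (swapXW V (expandComm b a c r)) =
      swapXW V (dongPoly V N (expandComm b a c r)) :=
    (LinearMap.congr_fun (dongPoly_swap N).eq _).symm
  rw [bracketComm_eq, map_sub, map_smul, h, dongPoly_expandComm hac hbc,
    dongPoly_expandComm hbc hac, map_zero, smul_zero, sub_zero]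

theorem pow_XW_bracketComm (a b c : FormalField V) (r : ℤ) (k : ℕ) :
    ((shiftX V - shiftW V) ^ k) (bracketComm a b c r) = bracketComm a b c (r + k) := by
  induction k with
  | zero => simp
  | succ k ih =>
    rw [pow_succ', Module.End.mul_apply, ih]
    funext p q s
    rw [Nat.cast_succ, ← add_assoc, bracketComm, locBracket_succ]
    change bracketComm a b c (r + k) (p + 1) q s - bracketComm a b c (r + k) p (q + 1) s = _
    simp only [bracketComm]
    noncomm_ring

theorem pow_WZ_bracketComm (a b c : FormalField V) (r : ℤ) (k : ℕ) (q s : ℤ) :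
    ((shiftW V - shiftZ V) ^ k) (bracketComm a b c r) 0 q s =
      locBracket (nthProd a b r) c k q s := by
  induction k generalizing q s with
  | zero => simp [locBracket_zero, bracketComm, nthProd_coe]
  | succ k ih =>
    rw [pow_succ', Module.End.mul_apply, Nat.cast_succ, locBracket_succ, ← ih, ← ih]
    rfl

/-- Dong's lemma: the products of two fields that are local with respect to each other and to `c`
are local with respect to `c`. Writing `w - z = (w - x) + (x - z)`, every term in the expansion of
`(w - z)^N ((w - x) + (x - z))^(K + N)` contains either `(w - x)^K`, which kills
`(x - w)^r [a(x), b(w)]` for large `K`, or `(w - z)^N (x - z)^N`. -/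
theorem IsLocal.nthProd_left {a b c : FormalField V} (hab : IsLocal a b) (hac : IsLocal a c)
    (hbc : IsLocal b c) (r : ℤ) : IsLocal (nthProd a b r) c := by
  obtain ⟨N₀, h0⟩ := hab
  obtain ⟨N₁, h1⟩ := hac
  obtain ⟨N₂, h2⟩ := hbc
  set N := max N₁ N₂
  replace h1 := h1.mono (le_max_left N₁ N₂)
  replace h2 := h2.mono (le_max_right N₁ N₂)
  set K := (N₀ - r).toNat
  refine ⟨N + (K + N), fun q s => ?_⟩
  rw [← pow_WZ_bracketComm]
  suffices H : ((shiftW V - shiftZ V) ^ (N + (K + N))) (bracketComm a b c r) = 0 by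
    rw [H]; rfl
  have hcomm : Commute (shiftW V - shiftX V) (shiftX V - shiftZ V) :=
    commute_sub_sub commute_XW.symm commute_WZ (Commute.refl (shiftX V)) commute_XZ
  have hcomm' : Commute (shiftW V - shiftZ V) (shiftW V - shiftX V) :=
    commute_sub_sub (Commute.refl (shiftW V)) commute_XW.symm commute_WZ.symm commute_XZ.symm
  have hL : ∀ i, K ≤ i → ((shiftW V - shiftX V) ^ i) (bracketComm a b c r) = 0 := by
    intro i hi
    have : bracketComm a b c (r + i) = 0 := by
      funext p q s
      rw [bracketComm, h0.locBracket_eq_zero (by omega), zero_mul, mul_zero, sub_zero]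
      rfl
    have e : shiftW V - shiftX V = (-1 : ℂ) • (shiftX V - shiftW V) := by
      module
    rw [e, smul_pow, LinearMap.smul_apply, pow_XW_bracketComm, this, smul_zero]
  have hQ : ∀ i j, N ≤ j → ((shiftW V - shiftZ V) ^ N * ((shiftW V - shiftX V) ^ i *
      (shiftX V - shiftZ V) ^ j)) (bracketComm a b c r) = 0 := by
    intro i j hj
    obtain ⟨l, rfl⟩ := Nat.exists_eq_add_of_le' hj
    have hA := ((hcomm'.pow_pow N i).mul_right (commute_WZ_XZ.pow_pow N l)).eq
    rw [pow_add, ← mul_assoc _ _ ((shiftX V - shiftZ V) ^ N), ← mul_assoc, hA, mul_assoc,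
      Module.End.mul_apply]
    exact (congrArg _ (dongPoly_bracketComm h1 h2 r)).trans (map_zero _)
  rw [pow_add]
  nth_rw 2 [← sub_add_sub_cancel (shiftW V) (shiftX V) (shiftZ V)]
  rw [hcomm.add_pow, Finset.mul_sum, LinearMap.sum_apply]
  refine Finset.sum_eq_zero fun i hi => ?_
  rw [Finset.mem_range] at hi
  rw [← nsmul_eq_mul', mul_smul_comm, LinearMap.smul_apply]
  refine (congrArg _ ?_).trans (smul_zero _)
  rcases le_or_gt K i with hK | hK
  · rw [(hcomm.pow_pow _ _).eq, Module.End.mul_apply, Module.End.mul_apply, hL i hK, map_zero,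
      map_zero]
  · exact hQ _ _ (by omega)

end Dong

end FormalField

namespace FormalField

/-! ### Vertex algebras from generating fields -/

variable {V : Type u} [AddCommGroup V] [Module ℂ V]

/-- `[T, a(z)] = a'(z)`. -/
def IsCovariant (T : Module.End ℂ V) (a : FormalField V) : Prop :=
  ∀ (n : ℤ) (v : V), T (a.1 n v) = a.1 n (T v) - (n : ℂ) • a.1 (n - 1) v

theorem succ_mul_choose (r : ℤ) (i : ℕ) :
    ((i : ℤ) + 1) * Ring.choose r (i + 1) = Ring.choose r i * (r - i) := by
  have := Ring.choose_smul_choose r (Nat.le_succ i)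
  simpa [Nat.choose_succ_self_right] using this

/-- The product `(x - w)^r a(x) b(w)` is covariant, since `(x - w)^r` is killed by
`∂/∂x + ∂/∂w`. -/
theorem translate_expandProd {T : Module.End ℂ V} {a b : FormalField V} (ha : IsCovariant T a)
    (hb : IsCovariant T b) (r p q : ℤ) (v : V) :
    T (expandProd a b r p q v) = expandProd a b r p q (T v) - (p : ℂ) • expandProd a b r (p - 1) q v
      - (q : ℂ) • expandProd a b r p (q - 1) v := by
  obtain ⟨M, hM⟩ := exists_trunc_nat b (q - 1) v
  have hM1 : ∀ i : ℕ, M ≤ i → b.1 (q + i) v = 0 := fun i hi => by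
    have := hM (i + 1) (by omega)
    rwa [show q - 1 + ((i + 1 : ℕ) : ℤ) = q + i by push_cast; ring] at this
  have hM2 : ∀ i : ℕ, M ≤ i → b.1 (q + i) (T v) = 0 := fun i hi => by
    have := hb (q + i) v
    rw [hM1 i hi, show q + i - 1 = q - 1 + (i : ℤ) by ring, hM i hi] at this
    simpa using this.symm
  rw [expandProd_eq_sum _ _ _ _ _ hM1, expandProd_eq_sum _ _ _ _ _ hM2,
    expandProd_eq_sum _ _ _ _ _ hM1, expandProd_eq_sum _ _ _ _ _ hM]
  have key : ∑ i ∈ Finset.range M, ((-1) ^ i * Ring.choose r i * (r - i) : ℤ) •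
        a.1 (p - 1 + r - i) (b.1 (q + i) v) +
      ∑ i ∈ Finset.range M, ((-1) ^ i * Ring.choose r i * i : ℤ) •
        a.1 (p + r - i) (b.1 (q - 1 + i) v) = 0 := by
    have h2 : ∑ i ∈ Finset.range M, ((-1) ^ i * Ring.choose r i * i : ℤ) •
        a.1 (p + r - i) (b.1 (q - 1 + i) v) =
        ∑ i ∈ Finset.range (M + 1), ((-1) ^ i * Ring.choose r i * i : ℤ) •
        a.1 (p + r - i) (b.1 (q - 1 + i) v) := by
      rw [Finset.sum_range_succ, hM M le_rfl, map_zero, smul_zero, add_zero]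
    rw [h2, Finset.sum_range_succ', Nat.cast_zero, mul_zero, zero_smul, add_zero,
      ← Finset.sum_add_distrib]
    refine Finset.sum_eq_zero fun i _ => ?_
    rw [show p + r - ((i + 1 : ℕ) : ℤ) = p - 1 + r - i by push_cast; ring,
      show q - 1 + ((i + 1 : ℕ) : ℤ) = q + i by push_cast; ring, ← add_smul]
    have := succ_mul_choose r i
    rw [show ((-1) ^ i * Ring.choose r i * (r - i) + (-1) ^ (i + 1) * Ring.choose r (i + 1) *
      ((i + 1 : ℕ) : ℤ) : ℤ) = (-1) ^ i * (Ring.choose r i * (r - i) -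
        ((i : ℤ) + 1) * Ring.choose r (i + 1)) by push_cast; ring, this]
    simp
  rw [← sub_zero (_ - _ - _), ← key, map_sum, Finset.smul_sum, Finset.smul_sum,
    ← Finset.sum_sub_distrib, ← Finset.sum_sub_distrib, ← Finset.sum_add_distrib,
    ← Finset.sum_sub_distrib]
  refine Finset.sum_congr rfl fun i _ => ?_
  rw [map_zsmul, ha, hb, map_sub, map_smul, show p + r - i - 1 = p - 1 + r - (i : ℤ) by ring,
    show q + i - 1 = q - 1 + (i : ℤ) by ring]
  simp only [← Int.cast_smul_eq_zsmul ℂ]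
  push_cast
  module

theorem translate_locBracket {T : Module.End ℂ V} {a b : FormalField V} (ha : IsCovariant T a)
    (hb : IsCovariant T b) (r p q : ℤ) (v : V) :
    T (locBracket a b r p q v) = locBracket a b r p q (T v) - (p : ℂ) • locBracket a b r (p - 1) q v
      - (q : ℂ) • locBracket a b r p (q - 1) v := by
  simp only [locBracket, LinearMap.sub_apply, LinearMap.smul_apply, map_sub, map_smul]
  rw [translate_expandProd ha hb, translate_expandProd hb ha]
  module

/-- `a(n)𝟏 = 0` for `n ≥ 0`. -/
def IsCreative (one : V) (a : FormalField V) : Prop := ∀ n : ℤ, 0 ≤ n → a.1 n one = 0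

theorem locBracket_creative {one : V} {a b : FormalField V} (ha : IsCreative one a)
    (hb : IsCreative one b) (r : ℤ) {q : ℤ} (hq : 0 ≤ q) : locBracket a b r 0 q one = 0 := by
  rw [locBracket, LinearMap.sub_apply, LinearMap.smul_apply,
    expandProd_eq_zero a b _ _ _ (fun i => hb _ (by omega)),
    expandProd_eq_zero b a _ _ _ (fun i => ha _ (by omega)), smul_zero, sub_zero]

theorem expandProd_neg_one {one : V} (a : FormalField V) {b : FormalField V}
    (hb : IsCreative one b) (r p : ℤ) :
    expandProd a b r p (-1) one = a.1 (p + r) (b.1 (-1) one) := by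
  rw [expandProd_eq_sum a b r p (-1) (M := 1) (fun i hi => hb _ (by omega))]
  simp

theorem locBracket_neg_one {one : V} {a b : FormalField V} (ha : IsCreative one a)
    (hb : IsCreative one b) (r : ℤ) : locBracket a b r 0 (-1) one = a.1 r (b.1 (-1) one) := by
  rw [locBracket, LinearMap.sub_apply, LinearMap.smul_apply, expandProd_neg_one a hb,
    expandProd_eq_zero b a _ _ _ (fun i => ha _ (by omega)), smul_zero, sub_zero, zero_add]

/-- The hypotheses of the reconstruction theorem: a set of mutually local, translation covariant
fields on `V` that generates `V` from the vacuum. -/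
structure IsGeneratingSystem (one : V) (T : Module.End ℂ V) (S : Set (FormalField V)) : Prop where
  translate_one : T one = 0
  covariant : ∀ a ∈ S, IsCovariant T a
  creative : ∀ a ∈ S, IsCreative one a
  isLocal : ∀ a ∈ S, ∀ b ∈ S, IsLocal a b
  generates : ∀ W : Submodule ℂ V, one ∈ W → (∀ a ∈ S, ∀ (n : ℤ), ∀ w ∈ W, a.1 n w ∈ W) → W = ⊤

/-- The fields obtained from those in `S` and the identity by linear combinations and products
of mutually local fields. -/
inductive Generated (S : Set (FormalField V)) : FormalField V → Prop
  | of (a) : a ∈ S → Generated S a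
  | id : Generated S (idField V)
  | add (a b) : Generated S a → Generated S b → Generated S (a + b)
  | smul (c : ℂ) (a) : Generated S a → Generated S (c • a)
  | prod (a b) (n : ℤ) : Generated S a → Generated S b → IsLocal a b →
      Generated S (nthProd a b n)

namespace IsGeneratingSystem

variable {one : V} {T : Module.End ℂ V} {S : Set (FormalField V)}
  (hS : IsGeneratingSystem one T S)

include hS

theorem generated_covariant {a : FormalField V} (ha : Generated S a) : IsCovariant T a := by
  induction ha with
  | of a ha => exact hS.covariant a ha
  | id =>
    intro n v
    simp only [idField_apply]
    by_cases h : n = -1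
    · subst h; norm_num
    · by_cases h' : n = 0
      · subst h'; simp
      · simp only [if_neg h, if_neg (show ¬ n - 1 = -1 by omega)]; simp
  | add a b _ _ iha ihb =>
    intro n v
    have h1 := iha n v
    have h2 := ihb n v
    simp only [Submodule.coe_add, Pi.add_apply, LinearMap.add_apply, map_add, h1, h2]
    module
  | smul c a _ iha =>
    intro n v
    have h1 := iha n v
    simp only [Submodule.coe_smul, Pi.smul_apply, LinearMap.smul_apply, map_smul, h1]
    module
  | prod a b n _ _ _ iha ihb =>
    intro q v
    have h := translate_locBracket iha ihb n 0 q v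
    rw [Int.cast_zero, zero_smul, sub_zero] at h
    exact h

theorem generated_creative {a : FormalField V} (ha : Generated S a) : IsCreative one a := by
  induction ha with
  | of a ha => exact hS.creative a ha
  | id => exact fun n hn => by rw [idField_apply, if_neg (by omega)]
  | add a b _ _ iha ihb =>
    intro n hn
    simp only [Submodule.coe_add, Pi.add_apply, LinearMap.add_apply, iha n hn, ihb n hn, add_zero]
  | smul c a _ iha =>
    intro n hn
    simp only [Submodule.coe_smul, Pi.smul_apply, LinearMap.smul_apply, iha n hn, smul_zero]
  | prod a b n _ _ _ iha ihb => exact fun q hq => locBracket_creative iha ihb n hq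

theorem generated_isLocal {a b : FormalField V} (ha : Generated S a) (hb : Generated S b) :
    IsLocal a b := by
  have key : ∀ c, (∀ s ∈ S, IsLocal s c) → ∀ {a}, Generated S a → IsLocal a c := by
    intro c hc a ha
    induction ha with
    | of a ha => exact hc a ha
    | id => exact isLocal_idField c
    | add a b _ _ iha ihb => exact iha.add_left ihb
    | smul k a _ iha => exact iha.smul_left k
    | prod a b n _ _ hab iha ihb => exact hab.nthProd_left iha ihb n
  exact key b (fun s hs => (key s (fun t ht => hS.isLocal t ht s hs) hb).symm) ha

omit hS in
/-- The space of generated fields. -/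
def generatedSpace (S : Set (FormalField V)) : Submodule ℂ (FormalField V) where
  carrier := {a | Generated S a}
  zero_mem' := by
    have := Generated.smul (S := S) 0 _ Generated.id
    rwa [zero_smul] at this
  add_mem' := Generated.add _ _
  smul_mem' c _ := Generated.smul c _

omit hS in
/-- The state `a(-1)𝟏` of a generated field `a`. -/
def state (one : V) (S : Set (FormalField V)) : generatedSpace S →ₗ[ℂ] V where
  toFun a := a.1.1 (-1) one
  map_add' _ _ := rfl
  map_smul' _ _ := rfl

omit hS in
theorem state_apply (a : generatedSpace S) : state one S a = a.1.1 (-1) one := rfl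

/-- Products of generated fields. -/
def mulGenerated (a b : generatedSpace S) (n : ℤ) : generatedSpace S :=
  ⟨nthProd a.1 b.1 n, Generated.prod _ _ n a.2 b.2 (hS.generated_isLocal a.2 b.2)⟩

/-- The state of `a(n)b` is `a(n)` applied to the state of `b`, so that the products of fields
correspond to the products in `V`. -/
theorem state_mulGenerated (a b : generatedSpace S) (n : ℤ) :
    state one S (hS.mulGenerated a b n) = a.1.1 n (state one S b) :=
  locBracket_neg_one (hS.generated_creative a.2) (hS.generated_creative b.2) n

theorem state_surjective : Function.Surjective (state one S) := by
  rw [← LinearMap.range_eq_top]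
  refine hS.generates _ ⟨⟨idField V, Generated.id⟩, ?_⟩ ?_
  · rw [state_apply, idField_apply, if_pos rfl]
  · rintro a ha n _ ⟨b, rfl⟩
    exact ⟨hS.mulGenerated ⟨a, Generated.of a ha⟩ b n, hS.state_mulGenerated _ b n⟩

/-- A field is determined by its state: covariance determines `a(z)𝟏`, and locality then
determines `a(z)` on all states. -/
theorem state_injective : Function.Injective (state one S) := by
  rw [injective_iff_map_eq_zero]
  intro a ha
  have h1 : ∀ k : ℕ, a.1.1 (-1 - k) one = 0 := by
    intro k
    induction k with
    | zero => rw [Nat.cast_zero, sub_zero]; exact ha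
    | succ k ih =>
      have h := hS.generated_covariant a.2 (-1 - k) one
      rw [hS.translate_one, ih, map_zero, map_zero, zero_sub, eq_comm, neg_eq_zero,
        smul_eq_zero] at h
      rcases h with h | h
      · have h' : ((-1 - k : ℤ) : ℂ) = ((0 : ℤ) : ℂ) := by simpa using h
        rw [Int.cast_inj] at h'
        omega
      · rw [← h]; push_cast; ring_nf
  have h2 : ∀ n, a.1.1 n one = 0 := by
    intro n
    rcases le_or_gt 0 n with hn | hn
    · exact hS.generated_creative a.2 n hn
    · have := h1 (-1 - n).toNat
      rwa [show -1 - ((-1 - n).toNat : ℤ) = n by omega] at this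
  refine Subtype.ext (Subtype.ext (funext fun n => LinearMap.ext fun v => ?_))
  obtain ⟨b, rfl⟩ := hS.state_surjective v
  obtain ⟨N, hN⟩ := hS.generated_isLocal a.2 b.2
  have h3 := LinearMap.congr_fun (hN (n - N) (-1)) one
  rw [locBracket, LinearMap.sub_apply, LinearMap.smul_apply,
    expandProd_neg_one a.1 (hS.generated_creative b.2),
    expandProd_eq_zero b.1 a.1 _ _ _ (fun i => h2 _), smul_zero, sub_zero, sub_add_cancel] at h3
  exact h3

/-- The correspondence between fields and states. -/
def stateEquiv : generatedSpace S ≃ₗ[ℂ] V :=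
  LinearEquiv.ofBijective (state one S) ⟨hS.state_injective, hS.state_surjective⟩

/-- The field of the state `a(n)b` is the `n`-th product of the fields of `a` and `b`. -/
theorem stateEquiv_symm_product (a b : V) (n : ℤ) :
    hS.stateEquiv.symm ((hS.stateEquiv.symm a).1.1 n b) =
      hS.mulGenerated (hS.stateEquiv.symm a) (hS.stateEquiv.symm b) n := by
  rw [LinearEquiv.symm_apply_eq]
  refine Eq.trans ?_ (hS.state_mulGenerated _ _ n).symm
  exact congrArg _ (hS.stateEquiv.apply_symm_apply b).symm

/-- The vertex algebra structure determined by a generating system of fields. -/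
@[reducible]
def vertexAlgebra (h1 : one ≠ 0) : VertexAlgebra V where
  nProd n := { toFun := fun a => (hS.stateEquiv.symm a).1.1 n
               map_add' := fun a b => by simp
               map_smul' := fun c a => by simp }
  vac := one
  vac_ne_zero := h1
  truncation a b := (hS.stateEquiv.symm a).1.2 b
  nProd_vac_of_nonneg a n hn := hS.generated_creative (hS.stateEquiv.symm a).2 n hn
  nProd_neg_one_vac a := hS.stateEquiv.apply_symm_apply a
  borcherds a b c p q r := by
    obtain ⟨N, hN⟩ := hS.generated_isLocal (hS.stateEquiv.symm a).2 (hS.stateEquiv.symm b).2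
    have h := LinearMap.congr_fun
      (borcherds_of_isLocal hN p q r (N - r).toNat (by omega)) c
    simp only [LinearMap.coe_mk, AddHom.coe_mk, hS.stateEquiv_symm_product, smul_sub]
    refine Eq.trans ?_ (h.trans ?_)
    · rw [borcherdsSum, LinearMap.sum_apply]
      refine finsum_eq_sum_of_support_subset _ fun i hi => ?_
      by_contra hi'
      simp only [Finset.coe_range, Set.mem_Iio, not_lt] at hi'
      refine hi ?_
      change Ring.choose p i • (nthProd _ _ (r + i)).1 (p + q - i) c = 0
      rw [nthProd_eq_zero hN (by omega)]
      exact smul_zero _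
    · rw [locBracket, LinearMap.sub_apply, LinearMap.smul_apply, expandProd_apply,
        expandProd_apply, smul_finsum' _ (expand_support ..), ← finsum_sub_distrib]
      · exact finsum_congr fun i => by rw [smul_comm ((-1 : ℂ) ^ r)]
      · exact expand_support ..
      · exact (expand_support (hS.stateEquiv.symm b).1 (hS.stateEquiv.symm a).1 r q p c).subset
          fun i hi hi' => hi (by simp only at hi' ⊢; rw [hi', smul_zero])

/-- The generating fields are the fields of their states. -/
theorem nProd_of_mem (h1 : one ≠ 0) {a : FormalField V} (ha : a ∈ S) (n : ℤ) :
    (hS.vertexAlgebra h1).nProd n (a.1 (-1) one) = a.1 n := by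
  have : hS.stateEquiv.symm (a.1 (-1) one) = ⟨a, Generated.of a ha⟩ := by
    rw [LinearEquiv.symm_apply_eq]; rfl
  change (hS.stateEquiv.symm (a.1 (-1) one)).1.1 n = _
  rw [this]

end IsGeneratingSystem

end FormalField

/-! ### Coefficients of exponentials -/

section Exp

variable {R : Type u} [Ring R] [Algebra ℂ R]

/-- The Euler operator `z d/dz` on power series. -/
def eulerSeries (f : PowerSeries R) : PowerSeries R :=
  PowerSeries.mk fun n => (n : ℂ) • PowerSeries.coeff n f

theorem eulerSeries_mul (f g : PowerSeries R) :
    eulerSeries (f * g) = eulerSeries f * g + f * eulerSeries g := by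
  ext n
  rw [map_add, eulerSeries, PowerSeries.coeff_mk, PowerSeries.coeff_mul, PowerSeries.coeff_mul,
    PowerSeries.coeff_mul, Finset.smul_sum, ← Finset.sum_add_distrib]
  refine Finset.sum_congr rfl fun p hp => ?_
  rw [Finset.HasAntidiagonal.mem_antidiagonal] at hp
  rw [eulerSeries, eulerSeries, PowerSeries.coeff_mk, PowerSeries.coeff_mk, ← hp, smul_mul_assoc,
    mul_smul_comm, ← add_smul]
  push_cast
  rfl

variable {f : PowerSeries R}

theorem commute_eulerSeries
    (hc : ∀ i j, Commute (PowerSeries.coeff i f) (PowerSeries.coeff j f)) :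
    Commute f (eulerSeries f) := by
  ext n
  rw [PowerSeries.coeff_mul, PowerSeries.coeff_mul, ← Finset.Nat.sum_antidiagonal_swap]
  refine Finset.sum_congr rfl fun p _ => ?_
  simp only [eulerSeries, PowerSeries.coeff_mk, Prod.fst_swap, Prod.snd_swap]
  rw [mul_smul_comm, smul_mul_assoc, (hc p.2 p.1).eq]

theorem eulerSeries_pow (hc : ∀ i j, Commute (PowerSeries.coeff i f) (PowerSeries.coeff j f))
    (m : ℕ) : eulerSeries (f ^ (m + 1)) = (m + 1) • (eulerSeries f * f ^ m) := by
  induction m with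
  | zero => simp
  | succ m ih =>
    rw [pow_succ, eulerSeries_mul, ih, smul_mul_assoc, mul_assoc, ← pow_succ,
      ((commute_eulerSeries hc).pow_left (m + 1)).eq, ← succ_nsmul]

omit [Algebra ℂ R] in
theorem coeff_pow_eq_zero (h0 : PowerSeries.coeff 0 f = 0) {n m : ℕ} (h : n < m) :
    PowerSeries.coeff n (f ^ m) = 0 := by
  induction m generalizing n with
  | zero => omega
  | succ m ih =>
    rw [pow_succ, PowerSeries.coeff_mul]
    refine Finset.sum_eq_zero fun p hp => ?_
    rw [Finset.HasAntidiagonal.mem_antidiagonal] at hp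
    rcases Nat.lt_or_ge p.1 m with h1 | h1
    · rw [ih h1, zero_mul]
    · rw [show p.2 = 0 by omega, h0, mul_zero]

theorem expCoeff_zero : expCoeff f 0 = 1 := by
  simp [expCoeff]

/-- The recursion expressing that `exp f` has logarithmic derivative `f'`. -/
theorem smul_expCoeff (h0 : PowerSeries.coeff 0 f = 0)
    (hc : ∀ i j, Commute (PowerSeries.coeff i f) (PowerSeries.coeff j f)) (k : ℕ) :
    (k : ℂ) • expCoeff f k = ∑ i ∈ Finset.range k,
      (((i + 1 : ℕ) : ℂ) • PowerSeries.coeff (i + 1) f) * expCoeff f (k - 1 - i) := by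
  have h1 : ∀ m, (k : ℂ) • (((m + 1)! : ℂ)⁻¹ • PowerSeries.coeff k (f ^ (m + 1))) =
      (m ! : ℂ)⁻¹ • PowerSeries.coeff k (eulerSeries f * f ^ m) := by
    intro m
    have : (k : ℂ) • PowerSeries.coeff k (f ^ (m + 1)) =
        PowerSeries.coeff k (eulerSeries (f ^ (m + 1))) := by
      rw [eulerSeries, PowerSeries.coeff_mk]
    rw [smul_comm, this, eulerSeries_pow hc, map_nsmul, ← Nat.cast_smul_eq_nsmul ℂ, smul_smul,
      Nat.factorial_succ]
    congr 1
    have : ((m + 1 : ℕ) : ℂ) ≠ 0 := Nat.cast_ne_zero.2 (Nat.succ_ne_zero m)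
    push_cast at this ⊢
    field_simp
  have h2 : ∀ m, PowerSeries.coeff k (eulerSeries f * f ^ m) = ∑ i ∈ Finset.range k,
      (((i + 1 : ℕ) : ℂ) • PowerSeries.coeff (i + 1) f) *
        PowerSeries.coeff (k - 1 - i) (f ^ m) := by
    intro m
    rw [PowerSeries.coeff_mul, Finset.Nat.sum_antidiagonal_eq_sum_range_succ_mk,
      Finset.sum_range_succ']
    simp only [eulerSeries, PowerSeries.coeff_mk, Nat.cast_zero, zero_smul, zero_mul, add_zero]
    refine Finset.sum_congr rfl fun i _ => ?_
    rw [show k - (i + 1) = k - 1 - i by omega]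
  rw [expCoeff, Finset.smul_sum, Finset.sum_range_succ']
  simp only [h1, h2]
  have h3 : (k : ℂ) • ((0 ! : ℂ)⁻¹ • PowerSeries.coeff k (f ^ 0)) = 0 := by
    rcases Nat.eq_zero_or_pos k with rfl | hk
    · simp
    · rw [pow_zero, PowerSeries.coeff_one, if_neg (by omega), smul_zero, smul_zero]
  rw [h3, add_zero]
  simp only [Finset.smul_sum]
  rw [Finset.sum_comm]
  refine Finset.sum_congr rfl fun i hi => ?_
  rw [Finset.mem_range] at hi
  rw [expCoeff, Finset.mul_sum]
  simp only [mul_smul_comm]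
  refine (Finset.sum_subset (Finset.range_mono (by omega)) fun m _ hm => ?_).symm
  rw [Finset.mem_range, not_lt] at hm
  rw [coeff_pow_eq_zero h0 (by omega), mul_zero, smul_zero]

end Exp

/-- `Γ k` is the coefficient of `z^k` in `exp (∑ i, a i z^(i+1) / (i+1))`, characterized by the
resulting recursion. The index `k` ranges over the integers, with `Γ k = 0` for `k < 0`. -/
structure IsExpSeq {E : Type u} [Ring E] [Algebra ℂ E] (a : ℕ → E) (Γ : ℤ → E) : Prop where
  of_neg : ∀ k, k < 0 → Γ k = 0
  zero : Γ 0 = 1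
  recursion : ∀ (k : ℤ) (M : ℕ), k ≤ M → (k : ℂ) • Γ k = ∑ i ∈ Finset.range M, a i * Γ (k - 1 - i)

/-- The coefficients of an exponential, extended by zero to negative indices. -/
def expCoeffInt {E : Type u} [Ring E] [Algebra ℂ E] (f : PowerSeries E) (k : ℤ) : E :=
  if 0 ≤ k then expCoeff f k.toNat else 0

theorem isExpSeq_expCoeff {E : Type u} [Ring E] [Algebra ℂ E] {f : PowerSeries E}
    (h0 : PowerSeries.coeff 0 f = 0)
    (hc : ∀ i j, Commute (PowerSeries.coeff i f) (PowerSeries.coeff j f)) :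
    IsExpSeq (fun i => ((i + 1 : ℕ) : ℂ) • PowerSeries.coeff (i + 1) f) (expCoeffInt f) where
  of_neg k hk := if_neg (by omega)
  zero := by simp [expCoeffInt, expCoeff_zero]
  recursion k M hM := by
    rcases lt_or_ge k 0 with hk | hk
    · rw [expCoeffInt, if_neg (by omega), smul_zero, Finset.sum_eq_zero]
      intro i _
      rw [expCoeffInt, if_neg (by omega), mul_zero]
    · obtain ⟨k, rfl⟩ := Int.eq_ofNat_of_zero_le hk
      rw [expCoeffInt, if_pos hk, Int.toNat_natCast, Int.cast_natCast, smul_expCoeff h0 hc]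
      refine (Finset.sum_congr rfl fun i hi => ?_).trans
        (Finset.sum_subset (Finset.range_mono (by omega)) fun i _ hi => ?_)
      · rw [Finset.mem_range] at hi
        rw [expCoeffInt, if_pos (by omega), show ((k : ℤ) - 1 - i).toNat = k - 1 - i by omega]
      · rw [Finset.mem_range, not_lt] at hi
        rw [expCoeffInt, if_neg (by omega), mul_zero]

namespace IsExpSeq

variable {E : Type u} [Ring E] [Algebra ℂ E] {a : ℕ → E} {Γ : ℤ → E}

/-- Strong induction along the recursion. -/
theorem induction {p : ℤ → Prop} (neg : ∀ k, k < 0 → p k) (zero : p 0)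
    (step : ∀ k, 0 < k → (∀ j, j < k → p j) → p k) (k : ℤ) : p k := by
  suffices H : ∀ n : ℕ, ∀ k : ℤ, k < n → p k from H (k + 1).toNat k (by omega)
  intro n
  induction n with
  | zero => exact fun k hk => neg k (by omega)
  | succ n ih =>
    intro k hk
    rcases lt_trichotomy k 0 with h | h | h
    · exact neg k h
    · exact h ▸ zero
    · exact step k h fun j hj => ih j (by push_cast at hk; omega)

theorem smul_cancel {M : Type*} [AddCommGroup M] [Module ℂ M] {k : ℤ} (hk : 0 < k) {x y : M}
    (h : (k : ℂ) • x = (k : ℂ) • y) : x = y :=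
  smul_right_injective M (r := (k : ℂ)) (by exact_mod_cast hk.ne') h

/-- Commutator of the exponential with an operator whose commutators with the exponent are
scalars. -/
theorem commutator (hΓ : IsExpSeq a Γ) (h : E) (m : ℕ) (c : ℂ)
    (ha : ∀ i, h * a i - a i * h = if i = m then (((m + 1 : ℕ) : ℂ) * c) • 1 else 0) (k : ℤ) :
    h * Γ k - Γ k * h = c • Γ (k - (m + 1)) := by
  induction k using induction with
  | neg k hk => rw [hΓ.of_neg k hk, hΓ.of_neg _ (by omega)]; simp
  | zero => rw [hΓ.zero, hΓ.of_neg _ (by omega)]; simp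
  | step k hk ih =>
    refine smul_cancel hk ?_
    have h1 := hΓ.recursion k (max k.toNat (m + 1)) (by omega)
    have h2 := hΓ.recursion (k - (m + 1)) (max k.toNat (m + 1)) (by omega)
    rw [smul_sub, ← mul_smul_comm, ← smul_mul_assoc, h1, Finset.mul_sum, Finset.sum_mul,
      ← Finset.sum_sub_distrib]
    have h3 : ∀ i ∈ Finset.range (max k.toNat (m + 1)),
        h * (a i * Γ (k - 1 - i)) - a i * Γ (k - 1 - i) * h =
          (if i = m then (((m + 1 : ℕ) : ℂ) * c) • Γ (k - (m + 1)) else 0) +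
            c • (a i * Γ (k - (m + 1) - 1 - i)) := by
      intro i _
      have e1 := ha i
      have e2 := ih (k - 1 - i) (by omega)
      rw [show k - 1 - (i : ℤ) - (m + 1) = k - (m + 1) - 1 - i by ring] at e2
      rw [← mul_smul_comm, ← e2]
      have : h * (a i * Γ (k - 1 - i)) - a i * Γ (k - 1 - i) * h =
          (h * a i - a i * h) * Γ (k - 1 - i) +
            a i * (h * Γ (k - 1 - i) - Γ (k - 1 - i) * h) := by noncomm_ring
      rw [this, e1]
      congr 1
      split_ifs with him
      · rw [smul_mul_assoc, one_mul, him]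
        congr 2; ring
      · rw [zero_mul]
    rw [Finset.sum_congr rfl h3, Finset.sum_add_distrib, Finset.sum_ite_eq', if_pos (by simp),
      ← Finset.smul_sum, ← h2]
    push_cast
    module

/-- Commutation of the exponential with an operator that commutes with the exponent. -/
theorem commute (hΓ : IsExpSeq a Γ) (h : E) (ha : ∀ i, Commute h (a i)) (k : ℤ) :
    Commute h (Γ k) := by
  have := hΓ.commutator h 0 0 (fun i => by simp [(ha i).eq]) k
  rw [zero_smul, sub_eq_zero] at this
  exact this

end IsExpSeq

/-! ### The Fock space -/

namespace Fock

variable {H : Type u} [AddCommGroup H] [Module ℂ H]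

theorem gen_add (h h' : H) (k : ℕ) : gen (h + h') k = gen h k + gen h' k := by
  simp [gen]

theorem gen_smul (c : ℂ) (h : H) (k : ℕ) : gen (c • h) k = c • gen h k := by
  rw [gen, ← Finsupp.smul_single, map_smul]; rfl

theorem ι_mem_of_gen {S : Submodule ℂ (Fock H)} (w : ℕ →₀ H) {v : Fock H}
    (h : ∀ (h : H) (k : ℕ), gen h k * v ∈ S) : SymmetricAlgebra.ι ℂ (ℕ →₀ H) w * v ∈ S := by
  induction w using Finsupp.induction_linear with
  | zero => rw [map_zero, zero_mul]; exact S.zero_mem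
  | add f g hf hg => rw [map_add, add_mul]; exact S.add_mem hf hg
  | single k x => exact h x k

/-- The Fock space is generated from `1` by the creation operators. -/
theorem eq_top_of_gen_mul {S : Submodule ℂ (Fock H)} (h1 : (1 : Fock H) ∈ S)
    (h : ∀ (h : H) (k : ℕ), ∀ v ∈ S, gen h k * v ∈ S) : S = ⊤ := by
  have key : ∀ x : Fock H, ∀ v ∈ S, x * v ∈ S := by
    intro x
    induction x using SymmetricAlgebra.induction with
    | algebraMap r => intro v hv; rw [← Algebra.smul_def]; exact S.smul_mem r hv
    | ι w => exact fun v hv => ι_mem_of_gen w fun x k => h x k v hv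
    | mul a b ha hb => intro v hv; rw [mul_assoc]; exact ha _ (hb v hv)
    | add a b ha hb => intro v hv; rw [add_mul]; exact S.add_mem (ha v hv) (hb v hv)
  rw [eq_top_iff]
  intro x _
  simpa using key x 1 h1

@[elab_as_elim]
theorem induction {p : Fock H → Prop} (one : p 1)
    (gen_mul : ∀ (h : H) (k : ℕ) (v : Fock H), p v → p (gen h k * v))
    (add : ∀ v w, p v → p w → p (v + w)) (smul : ∀ (c : ℂ) v, p v → p (c • v)) (v : Fock H) :
    p v := by
  let S : Submodule ℂ (Fock H) :=
    { carrier := {v | p v}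
      add_mem' := fun hv hw => add _ _ hv hw
      zero_mem' := by simpa using smul 0 1 one
      smul_mem' := fun c v hv => smul c v hv }
  have : v ∈ S := by
    rw [eq_top_of_gen_mul (S := S) one gen_mul]; trivial
  exact this

theorem adjoin_range_ι (W : Type u) [AddCommGroup W] [Module ℂ W] :
    Algebra.adjoin ℂ (Set.range (SymmetricAlgebra.ι ℂ W)) = ⊤ := by
  rw [eq_top_iff]
  intro x _
  induction x using SymmetricAlgebra.induction with
  | algebraMap r => exact Subalgebra.algebraMap_mem _ r
  | ι w => exact Algebra.subset_adjoin ⟨w, rfl⟩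
  | mul a b ha hb => exact Subalgebra.mul_mem _ (ha trivial) (hb trivial)
  | add a b ha hb => exact Subalgebra.add_mem _ (ha trivial) (hb trivial)

theorem derivation_ext {W : Type u} [AddCommGroup W] [Module ℂ W]
    {D D' : Derivation ℂ (SymmetricAlgebra ℂ W) (SymmetricAlgebra ℂ W)}
    (h : ∀ w, D (SymmetricAlgebra.ι ℂ W w) = D' (SymmetricAlgebra.ι ℂ W w)) : D = D' :=
  Derivation.ext_of_adjoin_eq_top _ (adjoin_range_ι W) (by rintro _ ⟨w, rfl⟩; exact h w)

/-- The derivation of the symmetric algebra of `W` that extends an endomorphism of `W`. -/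
def derivationOfLinear {W : Type u} [AddCommGroup W] [Module ℂ W] (t : W →ₗ[ℂ] W) :
    Derivation ℂ (SymmetricAlgebra ℂ W) (SymmetricAlgebra ℂ W) :=
  letI S := SymmetricAlgebra ℂ W
  letI f : S →ₐ[ℂ] TrivSqZeroExt S S := SymmetricAlgebra.lift
    ((TrivSqZeroExt.inlAlgHom ℂ S S).toLinearMap ∘ₗ SymmetricAlgebra.ι ℂ W
      + (TrivSqZeroExt.inrHom S S).restrictScalars ℂ ∘ₗ SymmetricAlgebra.ι ℂ W ∘ₗ t)
  Derivation.mk' ((TrivSqZeroExt.sndHom S S).restrictScalars ℂ ∘ₗ f.toLinearMap) (by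
    have hf : ∀ x, (f x).fst = x := fun x => by
      have : (TrivSqZeroExt.fstHom ℂ S S).comp f = AlgHom.id ℂ S := by
        apply SymmetricAlgebra.algHom_ext
        ext w
        simp [f]
        rfl
      exact congrArg (fun g => g x) this
    intro a b
    simp [hf, mul_comm b])

theorem derivationOfLinear_ι {W : Type u} [AddCommGroup W] [Module ℂ W] (t : W →ₗ[ℂ] W) (w : W) :
    derivationOfLinear t (SymmetricAlgebra.ι ℂ W w) = SymmetricAlgebra.ι ℂ W (t w) := by
  simp [derivationOfLinear]

variable (B : LinearMap.BilinForm ℂ H)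

theorem heis_negSucc_apply (h : H) (k : ℕ) (v : Fock H) :
    heis B h (Int.negSucc k) v = gen h k * v := rfl

theorem heis_neg_apply (h : H) (k : ℕ) (v : Fock H) :
    heis B h (-1 - k) v = gen h k * v := by
  rw [show (-1 - k : ℤ) = Int.negSucc k by omega]
  rfl

theorem heis_zero (h : H) : heis B h 0 = 0 := rfl

/-- The derivation by which `h(k+1)` acts. -/
def annihilator (h : H) (k : ℕ) : Derivation ℂ (Fock H) (Fock H) :=
  contraction (((k : ℂ) + 1) • (B h ∘ₗ Finsupp.lapply k))

theorem heis_pos_apply (h : H) (k : ℕ) (v : Fock H) :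
    heis B h (k + 1 : ℤ) v = annihilator B h k v := rfl

theorem annihilator_gen (h h' : H) (k l : ℕ) : annihilator B h k (gen h' l) =
    (if l = k then ((k : ℂ) + 1) * B h h' else 0) • 1 := by
  rw [annihilator, gen, contraction_ι, Algebra.algebraMap_eq_smul_one]
  congr 1
  simp only [LinearMap.smul_apply, LinearMap.comp_apply, Finsupp.lapply_apply,
    Finsupp.single_apply, smul_eq_mul]
  split_ifs <;> simp

theorem annihilator_gen_mul (h h' : H) (k l : ℕ) (v : Fock H) :
    annihilator B h k (gen h' l * v) = gen h' l * annihilator B h k v +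
      (if l = k then ((k : ℂ) + 1) * B h h' else 0) • v := by
  rw [Derivation.leibniz, annihilator_gen, smul_eq_mul, smul_eq_mul, mul_smul_comm, mul_one]

theorem annihilator_comm (h h' : H) (k l : ℕ) (v : Fock H) :
    annihilator B h k (annihilator B h' l v) = annihilator B h' l (annihilator B h k v) := by
  have : ⁅annihilator B h k, annihilator B h' l⁆ = 0 := derivation_ext fun w => by
    rw [Derivation.commutator_apply, annihilator, annihilator, contraction_ι, contraction_ι,
      Derivation.map_algebraMap, Derivation.map_algebraMap, sub_zero]
    rfl
  have := DFunLike.congr_fun this v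
  rw [Derivation.commutator_apply] at this
  exact sub_eq_zero.1 this

/-- The canonical commutation relations. -/
theorem heis_comm (hB : B.IsSymm) (h h' : H) (m n : ℤ) (v : Fock H) :
    heis B h m (heis B h' n v) = heis B h' n (heis B h m v)
      + (if m + n = 0 then (m : ℂ) * B h h' else 0) • v := by
  rcases m with (_ | m) | m <;> rcases n with (_ | n) | n
  · simp [heis_zero]
  · simp [heis_zero]
  · simp [heis_zero]
  · rw [if_neg (by simp; omega), zero_smul, add_zero]
    exact (map_zero (annihilator B h m))
  · rw [if_neg (by simp; omega), zero_smul, add_zero]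
    exact annihilator_comm B h h' m n v
  · change annihilator B h m (gen h' n * v) = gen h' n * annihilator B h m v + _
    rw [annihilator_gen_mul]
    congr 2
    have : (Int.ofNat (m + 1) + Int.negSucc n = 0) ↔ n = m := by
      simp only [Int.ofNat_eq_natCast]; omega
    simp only [this]
    simp
  · simp [heis_zero]
  · change gen h m * annihilator B h' n v = annihilator B h' n (gen h m * v) + _
    rw [annihilator_gen_mul]
    have : (Int.negSucc m + Int.ofNat (n + 1) = 0) ↔ m = n := by
      simp only [Int.ofNat_eq_natCast]; omega
    simp only [this]
    split_ifs with hmn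
    · subst hmn
      rw [add_assoc, ← add_smul, hB.eq h' h, Int.cast_negSucc]
      push_cast
      rw [show ((m : ℂ) + 1) * B h h' + -((m : ℂ) + 1) * B h h' = 0 by ring, zero_smul, add_zero]
    · simp
  · rw [if_neg (by omega), zero_smul, add_zero]
    change gen h m * (gen h' n * v) = gen h' n * (gen h m * v)
    ring

theorem heis_pos_one (h : H) {n : ℤ} (hn : 0 ≤ n) : heis B h n 1 = 0 := by
  rcases n with (_ | n) | n
  · rfl
  · exact Derivation.map_one_eq_zero _
  · omega

end Fock

namespace Fock

variable {H : Type u} [AddCommGroup H] [Module ℂ H] {B : LinearMap.BilinForm ℂ H}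

/-! ### Vertex operators on the Fock space -/

variable (B) in
/-- The operators `creation`, extended by zero to negative indices. -/
def creationInt (α : H) : ℤ → Module.End ℂ (Fock H) :=
  expCoeffInt (PowerSeries.mk fun n : ℕ =>
    if n = 0 then 0 else ((n : ℂ)⁻¹) • Fock.heis B α (-(n : ℤ)))

variable (B) in
/-- The operators `annihilation`, extended by zero to negative indices. -/
def annihilationInt (α : H) : ℤ → Module.End ℂ (Fock H) :=
  expCoeffInt (PowerSeries.mk fun n : ℕ =>
    if n = 0 then 0 else (-(n : ℂ))⁻¹ • Fock.heis B α (n : ℤ))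

theorem creationInt_natCast (α : H) (k : ℕ) : creationInt B α k = creation B α k := by
  rw [creationInt, expCoeffInt, if_pos (by omega), Int.toNat_natCast, creation]

theorem annihilationInt_natCast (α : H) (k : ℕ) :
    annihilationInt B α k = annihilation B α k := by
  rw [annihilationInt, expCoeffInt, if_pos (by omega), Int.toNat_natCast, annihilation]

theorem heis_commute (hB : B.IsSymm) (h h' : H) {m n : ℤ} (hmn : m + n ≠ 0) :
    Commute (heis B h m) (heis B h' n) := by
  ext v
  have := heis_comm B hB h h' m n v
  rwa [if_neg hmn, zero_smul, add_zero] at this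

theorem isExpSeq_creationInt (hB : B.IsSymm) (α : H) :
    IsExpSeq (fun i => heis B α (-1 - i)) (creationInt B α) := by
  have := isExpSeq_expCoeff (f := PowerSeries.mk fun n : ℕ =>
    if n = 0 then 0 else ((n : ℂ)⁻¹) • Fock.heis B α (-(n : ℤ))) (by simp) (by
      intro i j
      simp only [PowerSeries.coeff_mk]
      split_ifs with hi hj hj
      · exact Commute.zero_left _
      · exact Commute.zero_left _
      · exact Commute.zero_right _
      · exact ((heis_commute hB α α (by omega)).smul_left _).smul_right _)
  refine (congrArg (fun a => IsExpSeq a _) (funext fun i => ?_)).mpr this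
  have hi : ((i + 1 : ℕ) : ℂ) ≠ 0 := Nat.cast_ne_zero.2 (Nat.succ_ne_zero i)
  rw [PowerSeries.coeff_mk, if_neg (Nat.succ_ne_zero i), smul_smul, mul_inv_cancel₀ hi, one_smul]
  congr 1
  push_cast; ring

theorem isExpSeq_annihilationInt (hB : B.IsSymm) (α : H) :
    IsExpSeq (fun i => -heis B α (i + 1)) (annihilationInt B α) := by
  have := isExpSeq_expCoeff (f := PowerSeries.mk fun n : ℕ =>
    if n = 0 then 0 else (-(n : ℂ))⁻¹ • Fock.heis B α (n : ℤ)) (by simp) (by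
      intro i j
      simp only [PowerSeries.coeff_mk]
      split_ifs with hi hj hj
      · exact Commute.zero_left _
      · exact Commute.zero_left _
      · exact Commute.zero_right _
      · exact ((heis_commute hB α α (by omega)).smul_left _).smul_right _)
  refine (congrArg (fun a => IsExpSeq a _) (funext fun i => ?_)).mpr this
  have hi : ((i + 1 : ℕ) : ℂ) ≠ 0 := Nat.cast_ne_zero.2 (Nat.succ_ne_zero i)
  rw [PowerSeries.coeff_mk, if_neg (Nat.succ_ne_zero i), smul_smul, inv_neg, mul_neg,
    mul_inv_cancel₀ hi, neg_one_smul]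
  push_cast
  rfl

theorem heis_annihilationInt_commute (hB : B.IsSymm) (h α : H) {n : ℤ} (hn : 0 ≤ n) (k : ℤ)
    (v : Fock H) :
    heis B h n (annihilationInt B α k v) = annihilationInt B α k (heis B h n v) :=
  LinearMap.congr_fun ((isExpSeq_annihilationInt hB α).commute (heis B h n)
    (fun i => (heis_commute hB h α (by omega)).neg_right) k).eq v

theorem heis_creationInt_commute (hB : B.IsSymm) (h α : H) {n : ℤ} (hn : n ≤ 0) (k : ℤ)
    (v : Fock H) :
    heis B h n (creationInt B α k v) = creationInt B α k (heis B h n v) :=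
  LinearMap.congr_fun ((isExpSeq_creationInt hB α).commute (heis B h n)
    (fun i => heis_commute hB h α (by omega)) k).eq v

theorem heis_creationInt (hB : B.IsSymm) (h α : H) (m : ℕ) (k : ℤ) (v : Fock H) :
    heis B h (m + 1) (creationInt B α k v) = creationInt B α k (heis B h (m + 1) v) +
      B h α • creationInt B α (k - (m + 1)) v := by
  have := (isExpSeq_creationInt hB α).commutator (heis B h (m + 1)) m (B h α) (fun i => by
    ext v
    have e := heis_comm B hB h α (m + 1) (-1 - i) v
    have e' : ((m : ℤ) + 1 + (-1 - i) = 0) ↔ i = m := by omega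
    rw [LinearMap.sub_apply, Module.End.mul_apply, Module.End.mul_apply, e, add_sub_cancel_left]
    simp only [e']
    split_ifs
    · push_cast; rfl
    · simp) k
  have := LinearMap.congr_fun this v
  rw [LinearMap.sub_apply, Module.End.mul_apply, Module.End.mul_apply, sub_eq_iff_eq_add'] at this
  exact this

theorem heis_annihilationInt (hB : B.IsSymm) (h α : H) (m : ℕ) (k : ℤ) (v : Fock H) :
    heis B h (-1 - m) (annihilationInt B α k v) = annihilationInt B α k (heis B h (-1 - m) v) +
      B h α • annihilationInt B α (k - (m + 1)) v := by
  have := (isExpSeq_annihilationInt hB α).commutator (heis B h (-1 - m)) m (B h α) (fun i => by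
    ext v
    have e := heis_comm B hB h α (-1 - m) (i + 1) v
    have e' : ((-1 - m : ℤ) + (i + 1) = 0) ↔ i = m := by omega
    rw [LinearMap.sub_apply, Module.End.mul_apply, Module.End.mul_apply, LinearMap.neg_apply,
      LinearMap.neg_apply, map_neg, e]
    simp only [e']
    split_ifs
    · push_cast
      simp only [LinearMap.smul_apply, Module.End.one_apply]
      module
    · simp) k
  have := LinearMap.congr_fun this v
  rw [LinearMap.sub_apply, Module.End.mul_apply, Module.End.mul_apply, sub_eq_iff_eq_add'] at this
  exact this

theorem annihilationInt_one (hB : B.IsSymm) (α : H) {k : ℤ} (hk : k ≠ 0) :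
    annihilationInt B α k 1 = 0 := by
  rcases lt_or_gt_of_ne hk with hk | hk
  · rw [(isExpSeq_annihilationInt hB α).of_neg k hk]; rfl
  · refine IsExpSeq.smul_cancel hk ?_
    rw [← LinearMap.smul_apply, (isExpSeq_annihilationInt hB α).recursion k k.toNat (by omega),
      smul_zero, LinearMap.sum_apply]
    refine Finset.sum_eq_zero fun i _ => ?_
    rw [Module.End.mul_apply, LinearMap.neg_apply,
      heis_annihilationInt_commute hB α α (by omega), heis_pos_one B α (by omega), map_zero,
      neg_zero]

theorem annihilationInt_trunc (hB : B.IsSymm) (α : H) (v : Fock H) :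
    ∃ K : ℕ, ∀ k : ℤ, K ≤ k → annihilationInt B α k v = 0 := by
  induction v using Fock.induction with
  | one => exact ⟨1, fun k hk => annihilationInt_one hB α (by omega)⟩
  | gen_mul h m v ih =>
    obtain ⟨K, hK⟩ := ih
    refine ⟨K + m + 1, fun k hk => ?_⟩
    have := heis_annihilationInt hB h α m k v
    rw [hK k (by omega), hK _ (by omega), map_zero, smul_zero, add_zero, heis_neg_apply] at this
    exact this.symm
  | add v w hv hw =>
    obtain ⟨K, hK⟩ := hv
    obtain ⟨L, hL⟩ := hw
    exact ⟨max K L, fun k hk => by rw [map_add, hK k (by omega), hL k (by omega), add_zero]⟩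
  | smul c v hv =>
    obtain ⟨K, hK⟩ := hv
    exact ⟨K, fun k hk => by rw [map_smul, hK k hk, smul_zero]⟩

theorem vertexCoeff_eq_sum (hB : B.IsSymm) (α : H) (m : ℤ) {v : Fock H} {K : ℕ}
    (hK : ∀ k : ℤ, K ≤ k → annihilationInt B α k v = 0) :
    vertexCoeff B α m v =
      ∑ k ∈ Finset.range K, creationInt B α (m + k) (annihilationInt B α k v) := by
  rw [vertexCoeff]
  have hinj : Set.InjOn (fun k : ℕ => ((m + k).toNat, k)) (Finset.range K : Set ℕ) :=
    fun i _ j _ h => (Prod.ext_iff.1 h).2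
  rw [finsum_eq_sum_of_support_subset (s := (Finset.range K).image fun k : ℕ =>
      ((m + (k : ℤ)).toNat, k)),
    Finset.sum_image hinj]
  · refine Finset.sum_congr rfl fun k _ => ?_
    rw [finsum_eq_if]
    by_cases hk : 0 ≤ m + k
    · rw [if_pos (by dsimp only; omega), ← creationInt_natCast, ← annihilationInt_natCast,
        Int.toNat_of_nonneg hk]
    · rw [if_neg (by dsimp only; omega), (isExpSeq_creationInt hB α).of_neg _ (by omega)]
      rfl
  · rintro ⟨i, j⟩ hij
    simp only [Function.mem_support, finsum_eq_if] at hij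
    by_cases h : (i : ℤ) - j = m
    · rw [if_pos h] at hij
      simp only [Finset.coe_image, Finset.coe_range, Set.mem_image, Set.mem_Iio, Prod.mk.injEq,
        exists_eq_right_right]
      refine ⟨?_, by omega⟩
      by_contra hj
      refine hij ?_
      rw [← annihilationInt_natCast, hK _ (by omega), map_zero]
    · rw [if_neg h] at hij
      exact (hij rfl).elim

/-- The operator `vertexCoeff`, the coefficient of `z^m` in the vertex operator of `α` without
its factor `z^(α, β)`. -/
def vertexOp (hB : B.IsSymm) (α : H) (m : ℤ) : Module.End ℂ (Fock H) where
  toFun v := vertexCoeff B α m v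
  map_add' v w := by
    obtain ⟨K, hK⟩ := annihilationInt_trunc hB α v
    obtain ⟨L, hL⟩ := annihilationInt_trunc hB α w
    rw [vertexCoeff_eq_sum hB α m (v := v) (K := max K L) fun k hk => hK k (by omega),
      vertexCoeff_eq_sum hB α m (v := w) (K := max K L) fun k hk => hL k (by omega),
      vertexCoeff_eq_sum hB α m (v := v + w) (K := max K L) fun k hk => by
        rw [map_add, hK k (by omega), hL k (by omega), add_zero], ← Finset.sum_add_distrib]
    simp
  map_smul' c v := by
    obtain ⟨K, hK⟩ := annihilationInt_trunc hB α v
    rw [vertexCoeff_eq_sum hB α m hK, vertexCoeff_eq_sum hB α m (v := c • v) (K := K) fun k hk => by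
        rw [map_smul, hK k hk, smul_zero], Finset.smul_sum]
    simp

theorem vertexOp_eq_sum (hB : B.IsSymm) (α : H) (m : ℤ) {v : Fock H} {K : ℕ}
    (hK : ∀ k : ℤ, K ≤ k → annihilationInt B α k v = 0) :
    vertexOp hB α m v =
      ∑ k ∈ Finset.range K, creationInt B α (m + k) (annihilationInt B α k v) :=
  vertexCoeff_eq_sum hB α m hK

theorem vertexOp_one (hB : B.IsSymm) (α : H) (m : ℤ) :
    vertexOp hB α m 1 = creationInt B α m 1 := by
  rw [vertexOp_eq_sum hB α m (K := 1) (fun k hk => annihilationInt_one hB α (by omega)),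
    Finset.sum_range_one, Nat.cast_zero, add_zero, (isExpSeq_annihilationInt hB α).zero]
  rfl

theorem vertexOp_trunc (hB : B.IsSymm) (α : H) (v : Fock H) :
    ∃ M : ℤ, ∀ m, m < M → vertexOp hB α m v = 0 := by
  obtain ⟨K, hK⟩ := annihilationInt_trunc hB α v
  refine ⟨-K, fun m hm => ?_⟩
  rw [vertexOp_eq_sum hB α m hK]
  refine Finset.sum_eq_zero fun k hk => ?_
  rw [Finset.mem_range] at hk
  rw [(isExpSeq_creationInt hB α).of_neg _ (by omega)]
  rfl

/-- Vertex operators have commutator `[h(n), Γ(z)] = (h, α) z^n Γ(z)` with `h(n)`. -/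
theorem heis_vertexOp (hB : B.IsSymm) (h α : H) {n : ℤ} (hn : n ≠ 0) (m : ℤ) (v : Fock H) :
    heis B h n (vertexOp hB α m v) = vertexOp hB α m (heis B h n v) +
      B h α • vertexOp hB α (m - n) v := by
  obtain ⟨K, hK⟩ := annihilationInt_trunc hB α v
  rcases lt_or_gt_of_ne hn with hn | hn
  · obtain ⟨l, rfl⟩ : ∃ l : ℕ, n = -1 - l := ⟨(-1 - n).toNat, by omega⟩
    have hK' : ∀ k : ℤ, ((K + (l + 1) : ℕ) : ℤ) ≤ k →
        annihilationInt B α k (heis B h (-1 - l) v) = 0 := by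
      intro k hk
      have := heis_annihilationInt hB h α l k v
      rw [hK k (by omega), hK _ (by omega), map_zero, smul_zero, add_zero] at this
      exact this.symm
    rw [vertexOp_eq_sum hB α m (K := K + (l + 1)) (fun k hk => hK k (by omega)),
      vertexOp_eq_sum hB α m hK', vertexOp_eq_sum hB α _ hK, map_sum]
    have h1 : ∀ k ∈ Finset.range (K + (l + 1)), heis B h (-1 - l)
        (creationInt B α (m + k) (annihilationInt B α k v)) =
        creationInt B α (m + k) (annihilationInt B α k (heis B h (-1 - l) v)) +
          B h α • creationInt B α (m + k) (annihilationInt B α (k - (l + 1)) v) := by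
      intro k _
      rw [heis_creationInt_commute hB h α (by omega), heis_annihilationInt hB, map_add, map_smul]
    rw [Finset.sum_congr rfl h1, Finset.sum_add_distrib, ← Finset.smul_sum]
    congr 2
    rw [add_comm K, Finset.sum_range_add, Finset.sum_eq_zero, zero_add]
    · refine Finset.sum_congr rfl fun k _ => ?_
      congr 2
      · push_cast; ring
      · congr 1; push_cast; ring
    · intro k hk
      rw [Finset.mem_range] at hk
      rw [(isExpSeq_annihilationInt hB α).of_neg _ (by omega), LinearMap.zero_apply, map_zero]
  · obtain ⟨l, rfl⟩ : ∃ l : ℕ, n = l + 1 := ⟨(n - 1).toNat, by omega⟩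
    have hK' : ∀ k : ℤ, K ≤ k → annihilationInt B α k (heis B h (l + 1) v) = 0 := by
      intro k hk
      rw [← heis_annihilationInt_commute hB h α (by omega), hK k hk, map_zero]
    rw [vertexOp_eq_sum hB α m hK, vertexOp_eq_sum hB α m hK', vertexOp_eq_sum hB α _ hK,
      map_sum, Finset.smul_sum, ← Finset.sum_add_distrib]
    refine Finset.sum_congr rfl fun k _ => ?_
    rw [heis_creationInt hB, heis_annihilationInt_commute hB h α (by omega)]
    congr 4
    ring

/-! ### The translation operator on the Fock space -/

/-- The linear map `h ⊗ t^(-k-1) ↦ (k+1) h ⊗ t^(-k-2)`, that is, `-d/dt`. -/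
def shift (H : Type u) [AddCommGroup H] [Module ℂ H] : (ℕ →₀ H) →ₗ[ℂ] (ℕ →₀ H) :=
  Finsupp.lsum ℂ fun k : ℕ => ((k : ℂ) + 1) • Finsupp.lsingle (k + 1)

theorem shift_zero (w : ℕ →₀ H) : shift H w 0 = 0 := by
  induction w using Finsupp.induction_linear with
  | zero => simp
  | add f g hf hg => rw [map_add, Finsupp.add_apply, hf, hg, add_zero]
  | single k x => simp [shift]

theorem shift_succ (w : ℕ →₀ H) (n : ℕ) : shift H w (n + 1) = ((n : ℂ) + 1) • w n := by
  induction w using Finsupp.induction_linear with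
  | zero => simp
  | add f g hf hg =>
    rw [map_add (shift H), Finsupp.add_apply, hf, hg, Finsupp.add_apply, smul_add]
  | single k x =>
    simp only [shift, Finsupp.lsum_single, LinearMap.smul_apply, Finsupp.lsingle_apply,
      Finsupp.smul_apply, Finsupp.single_apply, Nat.add_right_cancel_iff]
    split_ifs with hk
    · rw [hk]
    · simp

/-- The translation operator of the Fock space, the derivation that maps `h(-k-1)𝟏` to
`(k+1) h(-k-2)𝟏`. -/
def translation (H : Type u) [AddCommGroup H] [Module ℂ H] : Derivation ℂ (Fock H) (Fock H) :=
  derivationOfLinear (shift H)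

theorem translation_gen (h : H) (k : ℕ) :
    translation H (gen h k) = ((k : ℂ) + 1) • gen h (k + 1) := by
  rw [translation, gen, derivationOfLinear_ι]
  simp [shift, gen, ← map_smul]

theorem translation_one : translation H 1 = 0 := Derivation.map_one_eq_zero _

theorem annihilator_ι (h : H) (k : ℕ) (w : ℕ →₀ H) :
    annihilator B h k (SymmetricAlgebra.ι ℂ _ w) =
      algebraMap ℂ _ (((k : ℂ) + 1) * B h (w k)) := by
  rw [annihilator, contraction_ι]; rfl

/-- `[T, h(n)] = -n h(n-1)`. -/
theorem translation_heis (h : H) (n : ℤ) (v : Fock H) :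
    translation H (heis B h n v) = heis B h n (translation H v) - (n : ℂ) • heis B h (n - 1) v := by
  rcases n with (_ | n) | n
  · simp [heis_zero]
  · have hz : heis B h ((0 : ℕ) : ℤ) = 0 := rfl
    have key : ∀ w : ℕ →₀ H, annihilator B h n (derivationOfLinear (shift H)
        (SymmetricAlgebra.ι ℂ _ w)) = ((n : ℂ) + 1) • heis B h n (SymmetricAlgebra.ι ℂ _ w) := by
      intro w
      rw [derivationOfLinear_ι, annihilator_ι]
      rcases n with _ | n
      · rw [shift_zero, hz]
        simp
      · rw [shift_succ, map_smul, smul_eq_mul, Nat.cast_succ]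
        change _ = _ • annihilator B h n _
        rw [annihilator_ι, Algebra.smul_def, ← map_mul]
    -- a commutator of derivations is a derivation, so that it is determined on generators
    have h2 : ∀ v, ⁅translation H, annihilator B h n⁆ v = -(((n : ℂ) + 1) • heis B h n v) := by
      intro v
      rcases n with _ | n
      · have : ⁅translation H, annihilator B h 0⁆ = 0 := derivation_ext fun w => by
          rw [Derivation.commutator_apply, annihilator_ι, Derivation.map_algebraMap, translation,
            key, hz]
          simp
        rw [this, hz]
        simp
      · have : ⁅translation H, annihilator B h (n + 1)⁆ =
            -((((n + 1 : ℕ) : ℂ) + 1) • annihilator B h n) := derivation_ext fun w => by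
          rw [Derivation.commutator_apply, annihilator_ι, Derivation.map_algebraMap, translation,
            key, zero_sub]
          rfl
        rw [this]
        rfl
    have h3 := h2 v
    rw [Derivation.commutator_apply, sub_eq_iff_eq_add'] at h3
    change translation H (annihilator B h n v) = annihilator B h n (translation H v) - _
    rw [h3, ← sub_eq_add_neg]
    congr 2
    · simp
    · simp
  · change translation H (gen h n * v) = gen h n * translation H v - _
    rw [Derivation.leibniz, translation_gen, smul_eq_mul, smul_eq_mul, mul_smul_comm,
      show Int.negSucc n - 1 = Int.negSucc (n + 1) by omega, heis_negSucc_apply, Int.cast_negSucc,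
      mul_comm v]
    push_cast
    module

/-- The creation part `Γ(z)` of a vertex operator satisfies `Γ'(z)𝟏 = (T + α(-1)) Γ(z)𝟏`. -/
theorem translation_creationInt (hB : B.IsSymm) (α : H) (k : ℤ) :
    translation H (creationInt B α k 1) + gen α 0 * creationInt B α k 1 =
      ((k : ℂ) + 1) • creationInt B α (k + 1) 1 := by
  have hrec : ∀ (k : ℤ) (M : ℕ), k ≤ M → (k : ℂ) • creationInt B α k 1 =
      ∑ i ∈ Finset.range M, heis B α (-1 - i) (creationInt B α (k - 1 - i) 1) := by
    intro k M hM
    rw [← LinearMap.smul_apply, (isExpSeq_creationInt hB α).recursion k M hM, LinearMap.sum_apply]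
    rfl
  have hneg := fun k hk => (isExpSeq_creationInt hB α).of_neg k hk
  induction k using IsExpSeq.induction with
  | neg k hk =>
    rw [hneg k hk, LinearMap.zero_apply, map_zero, mul_zero, add_zero]
    rcases eq_or_ne k (-1) with rfl | hk'
    · simp
    · rw [hneg (k + 1) (by omega)]; simp
  | zero =>
    have := hrec 1 1 le_rfl
    rw [Finset.sum_range_one] at this
    simp only [Int.cast_one, one_smul, Nat.cast_zero, sub_zero, sub_self] at this
    rw [zero_add, this, (isExpSeq_creationInt hB α).zero, Module.End.one_apply, translation_one]
    simp only [Int.cast_zero, zero_add, one_smul]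
    rfl
  | step k hk ih =>
    refine IsExpSeq.smul_cancel hk ?_
    set M := k.toNat
    have e0 := hrec k M (by omega)
    have e1 := hrec (k + 1) (M + 1) (by omega)
    rw [smul_add, ← mul_smul_comm, ← Derivation.map_smul, e0, map_sum, Finset.mul_sum,
      ← Finset.sum_add_distrib]
    have e2 : ∀ i ∈ Finset.range M, translation H (heis B α (-1 - i)
        (creationInt B α (k - 1 - i) 1)) + gen α 0 * heis B α (-1 - i)
          (creationInt B α (k - 1 - i) 1) =
        (((i + 1 : ℕ) : ℂ)) • heis B α (-1 - ((i + 1 : ℕ) : ℤ))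
          (creationInt B α (k + 1 - 1 - ((i + 1 : ℕ) : ℤ)) 1) +
        ((k : ℂ) - i) • heis B α (-1 - i) (creationInt B α (k + 1 - 1 - i) 1) := by
      intro i _
      have h1 := congrArg (heis B α (-1 - i)) (ih (k - 1 - i) (by omega))
      rw [map_add, map_smul, heis_neg_apply B α i (gen α 0 * _), mul_left_comm,
        ← heis_neg_apply B α i] at h1
      rw [translation_heis, sub_add_eq_add_sub, h1]
      rw [show k - 1 - (i : ℤ) + 1 = k + 1 - 1 - i by ring,
        show (-1 - (i : ℤ)) - 1 = -1 - ((i + 1 : ℕ) : ℤ) by push_cast; ring,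
        show k - 1 - (i : ℤ) = k + 1 - 1 - ((i + 1 : ℕ) : ℤ) by push_cast; ring]
      push_cast
      module
    have e3 : ∑ i ∈ Finset.range M, (((i + 1 : ℕ) : ℂ)) • heis B α (-1 - ((i + 1 : ℕ) : ℤ))
          (creationInt B α (k + 1 - 1 - ((i + 1 : ℕ) : ℤ)) 1) =
        ∑ i ∈ Finset.range (M + 1), (i : ℂ) • heis B α (-1 - (i : ℤ))
          (creationInt B α (k + 1 - 1 - (i : ℤ)) 1) := by
      rw [Finset.sum_range_succ', Nat.cast_zero, zero_smul, add_zero]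
    have e4 : ∑ i ∈ Finset.range M, ((k : ℂ) - i) • heis B α (-1 - (i : ℤ))
          (creationInt B α (k + 1 - 1 - i) 1) =
        ∑ i ∈ Finset.range (M + 1), ((k : ℂ) - i) • heis B α (-1 - (i : ℤ))
          (creationInt B α (k + 1 - 1 - i) 1) := by
      have : (k : ℂ) - (M : ℂ) = 0 := by
        rw [sub_eq_zero, ← Int.cast_natCast, Int.toNat_of_nonneg hk.le]
      rw [Finset.sum_range_succ, this, zero_smul, add_zero]
    push_cast at e1
    rw [Finset.sum_congr rfl e2, Finset.sum_add_distrib, e3, e4, ← Finset.sum_add_distrib, e1,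
      Finset.smul_sum]
    exact Finset.sum_congr rfl fun i _ => by rw [← add_smul, add_sub_cancel]

end Fock

namespace Fock

variable {H : Type u} [AddCommGroup H] [Module ℂ H] {B : LinearMap.BilinForm ℂ H}

/-! ### Products of vertex operators -/

theorem nsmul_choose_eq_sum (s : ℤ) (i : ℕ) :
    (i : ℤ) * ((-1) ^ i * Ring.choose s i) =
      -s * ∑ m ∈ Finset.range i, (-1) ^ m * Ring.choose s m := by
  induction i with
  | zero => simp
  | succ i ih =>
    rw [Finset.sum_range_succ, mul_add, ← ih]
    have := FormalField.succ_mul_choose s i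
    push_cast
    rw [mul_left_comm, this, pow_succ]
    ring

/-- `Γ₋(z) Γ₊(w)𝟏 = (1 - w/z)^s Γ₊(w)𝟏`, where `Γ₋` is the annihilation part of the vertex operator
of `α`, `Γ₊` is the creation part of that of `β`, and `s = (α, β)`. -/
theorem annihilationInt_creationInt_one (hB : B.IsSymm) {α β : H} {s : ℤ} (hs : B α β = s)
    (k : ℤ) (i : ℕ) : annihilationInt B α i (creationInt B β k 1) =
      ((-1) ^ i * Ring.choose s i : ℤ) • creationInt B β (k - i) 1 := by
  have hrec : ∀ (k : ℤ) (M : ℕ), k ≤ M → (k : ℂ) • creationInt B β k 1 =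
      ∑ i ∈ Finset.range M, heis B β (-1 - i) (creationInt B β (k - 1 - i) 1) := by
    intro k M hM
    rw [← LinearMap.smul_apply, (isExpSeq_creationInt hB β).recursion k M hM, LinearMap.sum_apply]
    rfl
  have hneg : ∀ k, k < 0 → creationInt B β k 1 = 0 := fun k hk => by
    rw [(isExpSeq_creationInt hB β).of_neg k hk]; rfl
  induction k using IsExpSeq.induction generalizing i with
  | neg k hk => rw [hneg k hk, hneg _ (by omega), map_zero, smul_zero]
  | zero =>
    rcases Nat.eq_zero_or_pos i with rfl | hi
    · rw [Nat.cast_zero, (isExpSeq_annihilationInt hB α).zero]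
      simp
    · rw [hneg (0 - i) (by omega), smul_zero, (isExpSeq_creationInt hB β).zero,
          Module.End.one_apply,
        annihilationInt_one hB α (by omega)]
  | step k hk ih =>
    refine IsExpSeq.smul_cancel hk ?_
    set M := max k.toNat i
    rw [← map_smul, hrec k M (by omega), map_sum]
    have h1 : ∀ m ∈ Finset.range M, annihilationInt B α i (heis B β (-1 - m)
        (creationInt B β (k - 1 - m) 1)) = ((-1) ^ i * Ring.choose s i : ℤ) •
          heis B β (-1 - m) (creationInt B β (k - i - 1 - m) 1) -
        if m < i then (s : ℤ) • ((-1) ^ (i - 1 - m) * Ring.choose s (i - 1 - m) : ℤ) •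
          creationInt B β (k - i) 1 else 0 := by
      intro m _
      have h2 := heis_annihilationInt hB β α m i (creationInt B β (k - 1 - m) 1)
      rw [ih _ (by omega), ← sub_eq_iff_eq_add] at h2
      rw [← h2, map_zsmul, show k - 1 - (m : ℤ) - i = k - i - 1 - m by ring, ← hB.eq α β, hs]
      congr 1
      split_ifs with hm
      · rw [show (i : ℤ) - (m + 1) = ((i - 1 - m : ℕ) : ℤ) by omega, ih _ (by omega),
          show k - 1 - (m : ℤ) - ((i - 1 - m : ℕ) : ℤ) = k - i by omega, Int.cast_smul_eq_zsmul]
      · rw [(isExpSeq_annihilationInt hB α).of_neg _ (by omega), LinearMap.zero_apply, smul_zero]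
    have h3 : ∑ m ∈ Finset.range M, (if m < i then
        (s : ℤ) • ((-1) ^ (i - 1 - m) * Ring.choose s (i - 1 - m) : ℤ) • creationInt B β (k - i) 1
          else 0) = -((i : ℤ) * ((-1) ^ i * Ring.choose s i)) • creationInt B β (k - i) 1 := by
      rw [← Finset.sum_filter, show (Finset.range M).filter (· < i) = Finset.range i by
        ext m; simp only [Finset.mem_filter, Finset.mem_range]; omega, ← Finset.smul_sum,
        Finset.sum_range_reflect (fun m => ((-1) ^ m * Ring.choose s m : ℤ) •
          creationInt B β (k - i) 1) i, ← Finset.sum_smul, smul_smul, nsmul_choose_eq_sum, neg_mul,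
        neg_neg]
    rw [Finset.sum_congr rfl h1, Finset.sum_sub_distrib, h3, ← Finset.smul_sum,
      ← hrec (k - i) M (by omega)]
    rw [← Int.cast_smul_eq_zsmul ℂ, ← Int.cast_smul_eq_zsmul ℂ, ← Int.cast_smul_eq_zsmul ℂ]
    push_cast
    module

theorem vertexOp_creationInt_one (hB : B.IsSymm) {α β : H} {s : ℤ} (hs : B α β = s)
    (m k : ℤ) {M : ℕ} (hM : k < M) : vertexOp hB α m (creationInt B β k 1) =
      ∑ i ∈ Finset.range M, ((-1) ^ i * Ring.choose s i : ℤ) •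
        creationInt B α (m + i) (creationInt B β (k - i) 1) := by
  rw [vertexOp_eq_sum hB α m (K := M)]
  · refine Finset.sum_congr rfl fun i _ => ?_
    rw [annihilationInt_creationInt_one hB hs, map_zsmul]
  · intro j hj
    obtain ⟨j, rfl⟩ := Int.eq_ofNat_of_zero_le (by omega : 0 ≤ j)
    rw [annihilationInt_creationInt_one hB hs, (isExpSeq_creationInt hB β).of_neg _ (by omega)]
    simp

theorem creationInt_comm (hB : B.IsSymm) (α β : H) (m k : ℤ) (v : Fock H) :
    creationInt B α m (creationInt B β k v) = creationInt B β k (creationInt B α m v) := by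
  have := (isExpSeq_creationInt hB β).commute (creationInt B α m) (fun i => by
    refine (Commute.symm ?_)
    exact (isExpSeq_creationInt hB α).commute (heis B β (-1 - i))
      (fun j => heis_commute hB β α (by omega)) m) k
  exact LinearMap.congr_fun this.eq v

end Fock

/-! ### Binomial expansions of functions of two indices -/

/-- If `g` is regarded as the modes of a series in `x` and `w`, these are the modes of its product
with `(x - w)^r`, expanded in nonnegative powers of `w` and truncated to `M` terms. -/
def expandSum {E : Type*} [AddCommGroup E] (g : ℤ → ℤ → E) (M : ℕ) (r p q : ℤ) : E :=
  ∑ i ∈ Finset.range M, ((-1) ^ i * Ring.choose r i : ℤ) • g (p + r - i) (q + i)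

theorem expandSum_succ {E : Type*} [AddCommGroup E] {g : ℤ → ℤ → E} {M : ℕ} (r p q : ℤ)
    (hM : ∀ p, g p (q + M) = 0) : expandSum g M (r + 1) p q =
      expandSum g M r (p + 1) q - expandSum g M r p (q + 1) := by
  rcases M with _ | M
  · simp [expandSum]
  rw [expandSum, expandSum, expandSum, Finset.sum_range_succ',
    Finset.sum_range_succ' _ M, Finset.sum_range_succ _ M]
  have hl : g (p + r - M) (q + 1 + M) = 0 := by
    have := hM (p + r - M)
    rwa [Nat.cast_succ, add_comm (M : ℤ) 1, ← add_assoc] at this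
  rw [hl, smul_zero, add_zero]
  have : ∀ i ∈ Finset.range M, ((-1) ^ (i + 1) * Ring.choose (r + 1) (i + 1) : ℤ) •
      g (p + (r + 1) - ((i + 1 : ℕ) : ℤ)) (q + ((i + 1 : ℕ) : ℤ)) =
      ((-1) ^ (i + 1) * Ring.choose r (i + 1) : ℤ) •
        g (p + 1 + r - ((i + 1 : ℕ) : ℤ)) (q + ((i + 1 : ℕ) : ℤ)) -
      ((-1) ^ i * Ring.choose r i : ℤ) • g (p + r - i) (q + 1 + i) := by
    intro i _
    rw [Ring.choose_succ_succ, show p + (r + 1) - ((i + 1 : ℕ) : ℤ) = p + r - i by push_cast; ring,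
      show p + 1 + r - ((i + 1 : ℕ) : ℤ) = p + r - i by push_cast; ring,
      show q + ((i + 1 : ℕ) : ℤ) = q + 1 + i by push_cast; ring, ← sub_smul]
    congr 1
    ring
  rw [Finset.sum_congr rfl this, Finset.sum_sub_distrib]
  simp only [pow_zero, Ring.choose_zero_right, Nat.cast_zero]
  rw [show p + (r + 1) - 0 = p + 1 + r - 0 by ring]
  abel

/-- For a nonnegative exponent `R` the expansions in the two directions differ by the sign
`(-1)^R`. -/
theorem expandSum_swap {E : Type*} [AddCommGroup E] (g : ℤ → ℤ → E) (R : ℕ) {M M' : ℕ}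
    (hM : R < M) (hM' : R < M') (p q : ℤ) :
    expandSum g M R p q = (-1 : ℤ) ^ R • expandSum (fun q p => g p q) M' R q p := by
  have key : ∀ (g : ℤ → ℤ → E) {M : ℕ} (_ : R < M) (p q : ℤ), expandSum g M R p q =
      expandSum g (R + 1) R p q := fun g M hM p q => by
    refine (Finset.sum_subset (Finset.range_mono (by omega)) fun i _ hi => ?_).symm
    rw [Finset.mem_range, not_lt] at hi
    rw [Ring.choose_natCast, Nat.choose_eq_zero_of_lt (by omega)]
    simp
  rw [key g hM, key _ hM', expandSum, expandSum, ← Finset.sum_range_reflect, Finset.smul_sum]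
  refine Finset.sum_congr rfl fun i hi => ?_
  rw [Finset.mem_range] at hi
  obtain ⟨j, rfl⟩ := Nat.exists_eq_add_of_le (Nat.lt_succ_iff.1 hi)
  rw [show i + j + 1 - 1 - i = j by omega, Ring.choose_natCast, Ring.choose_natCast, smul_smul,
    Nat.choose_symm_add]
  rw [← mul_assoc]
  congr 2
  · rw [← pow_add, show i + j + i = j + 2 * i by ring, pow_add, pow_mul]
    simp
  · push_cast; ring
  · push_cast; ring

/-! ### Operators on `M_H(0) ⊗ A` -/

namespace AHPair

variable (P : AHPair.{u})

open Classical in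
/-- The decomposition of `A` as the direct sum of its graded pieces. -/
def decomposition : P.A ≃ₗ[ℂ] DirectSum P.H fun β => P.grade β :=
  (LinearEquiv.ofBijective (DirectSum.coeLinearMap P.grade)
    (show Function.Bijective (DirectSum.coeLinearMap P.grade) from P.isInternal)).symm

open Classical in
theorem decomposition_apply {β : P.H} {b : P.A} (hb : b ∈ P.grade β) :
    P.decomposition b = DirectSum.lof ℂ P.H (fun β => P.grade β) β ⟨b, hb⟩ := by
  rw [decomposition, LinearEquiv.symm_apply_eq, LinearEquiv.ofBijective_apply,
    DirectSum.coeLinearMap_lof]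

open Classical in
/-- The linear map on `A` that is given by `F β` on `A^β`. -/
def gradedMap {M : Type*} [AddCommGroup M] [Module ℂ M] (F : P.H → P.A →ₗ[ℂ] M) : P.A →ₗ[ℂ] M :=
  DirectSum.toModule ℂ P.H M (fun β => F β ∘ₗ (P.grade β).subtype) ∘ₗ
    P.decomposition.toLinearMap

theorem gradedMap_apply {M : Type*} [AddCommGroup M] [Module ℂ M] (F : P.H → P.A →ₗ[ℂ] M)
    {β : P.H} {b : P.A} (hb : b ∈ P.grade β) : P.gradedMap F b = F β b := by
  rw [gradedMap, LinearMap.comp_apply, LinearEquiv.coe_coe, decomposition_apply P hb,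
    DirectSum.toModule_lof]
  rfl

/-- The underlying space `M_H(0) ⊗ A` of the lattice vertex algebra. -/
abbrev Lattice : Type u := Fock P.H ⊗[ℂ] P.A

variable {P}

theorem lattice_ext {M : Type*} [AddCommGroup M] [Module ℂ M] {f g : P.Lattice →ₗ[ℂ] M}
    (h : ∀ β, ∀ b ∈ P.grade β, ∀ v, f (v ⊗ₜ b) = g (v ⊗ₜ b)) : f = g :=
  TensorProduct.ext' fun v b => LinearMap.congr_fun (P.linearMap_ext
    (f := f ∘ₗ TensorProduct.mk ℂ _ _ v) (g := g ∘ₗ TensorProduct.mk ℂ _ _ v)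
    fun β b hb => h β b hb v) b

theorem lattice_induction {p : P.Lattice → Prop} (tmul : ∀ β, ∀ b ∈ P.grade β, ∀ v, p (v ⊗ₜ b))
    (zero : p 0) (add : ∀ x y, p x → p y → p (x + y)) (x : P.Lattice) : p x := by
  induction x using TensorProduct.induction_on with
  | zero => exact zero
  | add x y hx hy => exact add x y hx hy
  | tmul v b =>
    exact P.grade_induction (p := fun b => p (v ⊗ₜ b)) (fun β b hb => tmul β b hb v)
      (by rwa [TensorProduct.tmul_zero])
      (fun a b ha hb => by rw [TensorProduct.tmul_add]; exact add _ _ ha hb) b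

/-- The operator `v ⊗ b ↦ F β v ⊗ g b` for `b ∈ A^β`. -/
def gradedOp (F : P.H → Module.End ℂ (Fock P.H)) (g : P.A →ₗ[ℂ] P.A) : Module.End ℂ P.Lattice :=
  TensorProduct.lift (P.gradedMap (M := Fock P.H →ₗ[ℂ] P.Lattice)
    fun β => (TensorProduct.mk ℂ (Fock P.H) P.A ∘ₗ F β).flip ∘ₗ g).flip

theorem gradedOp_apply (F : P.H → Module.End ℂ (Fock P.H)) (g : P.A →ₗ[ℂ] P.A) {β : P.H}
    {b : P.A} (hb : b ∈ P.grade β) (v : Fock P.H) : gradedOp F g (v ⊗ₜ b) = F β v ⊗ₜ g b := by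
  rw [gradedOp, TensorProduct.lift.tmul, LinearMap.flip_apply, gradedMap_apply P _ hb]
  rfl

/-- The action of `h(n)`. -/
def heisOp (h : P.H) (n : ℤ) : Module.End ℂ P.Lattice :=
  gradedOp (fun β => if n = 0 then P.form h β • 1 else Fock.heis P.form h n) LinearMap.id

theorem heisOp_zero (h : P.H) {β : P.H} {b : P.A} (hb : b ∈ P.grade β) (v : Fock P.H) :
    heisOp h 0 (v ⊗ₜ b) = P.form h β • (v ⊗ₜ b) := by
  rw [heisOp, gradedOp_apply _ _ hb, if_pos rfl]
  rfl

theorem heisOp_of_ne (h : P.H) {n : ℤ} (hn : n ≠ 0) (v : Fock P.H) (b : P.A) :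
    heisOp h n (v ⊗ₜ b) = Fock.heis P.form h n v ⊗ₜ b :=
  P.grade_induction (p := fun b => heisOp h n (v ⊗ₜ b) = Fock.heis P.form h n v ⊗ₜ b)
    (fun β b hb => by rw [heisOp, gradedOp_apply _ _ hb, if_neg hn]; rfl)
    (by simp) (fun a b ha hb => by simp [TensorProduct.tmul_add, ha, hb]) b

theorem heisOp_neg (h : P.H) (k : ℕ) (v : Fock P.H) (b : P.A) :
    heisOp h (-1 - k) (v ⊗ₜ b) = (Fock.gen h k * v) ⊗ₜ b := by
  rw [heisOp_of_ne h (by omega), Fock.heis_neg_apply]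

theorem heisOp_pos_one (h : P.H) {n : ℤ} (hn : 0 < n) (b : P.A) :
    heisOp h n ((1 : Fock P.H) ⊗ₜ b) = 0 := by
  rw [heisOp_of_ne h hn.ne', Fock.heis_pos_one _ _ hn.le, TensorProduct.zero_tmul]

/-- Linear maps are determined by their values on `1 ⊗ b` and the action of `h(n)`, `n < 0`. -/
theorem lattice_ext_heisOp {M : Type*} [AddCommGroup M] [Module ℂ M] {f g : P.Lattice →ₗ[ℂ] M}
    (one : ∀ β, ∀ b ∈ P.grade β, f (1 ⊗ₜ b) = g (1 ⊗ₜ b))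
    (heis : ∀ (h : P.H) (k : ℕ) (x : P.Lattice), f x = g x →
      f (heisOp h (-1 - k) x) = g (heisOp h (-1 - k) x)) : f = g :=
  lattice_ext fun β b hb v => by
    induction v using Fock.induction with
    | one => exact one β b hb
    | gen_mul h k v ih => rw [← heisOp_neg]; exact heis h k _ ih
    | add v w hv hw => rw [TensorProduct.add_tmul, map_add, map_add, hv, hw]
    | smul c v hv => rw [← TensorProduct.smul_tmul', map_smul, map_smul, hv]

open Classical in
/-- The coefficient of `z^(-n-1)` of `z^(α, β)` times the vertex operator of `α`, and zero if
`(α, β)` is not an integer. -/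
def shiftedVertexOp (α : P.H) (n : ℤ) (β : P.H) : Module.End ℂ (Fock P.H) :=
  if h : ∃ N : ℤ, P.form α β = N then Fock.vertexOp P.isSymm α (-n - 1 - h.choose) else 0

theorem shiftedVertexOp_eq {α β : P.H} {N : ℤ} (h : P.form α β = N) (n : ℤ) :
    shiftedVertexOp α n β = Fock.vertexOp P.isSymm α (-n - 1 - N) := by
  have h' : ∃ N : ℤ, P.form α β = N := ⟨N, h⟩
  have : h'.choose = N := Int.cast_injective (α := ℂ) (h'.choose_spec.symm.trans h)
  rw [shiftedVertexOp, dif_pos h', this]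

theorem shiftedVertexOp_eq_zero {α β : P.H} (h : ∀ N : ℤ, P.form α β ≠ N) (n : ℤ) :
    shiftedVertexOp α n β = 0 :=
  dif_neg fun ⟨N, hN⟩ => h N hN

/-- The `n`-th mode of the field of `𝟏 ⊗ a`, for `a ∈ A^α`. -/
def vertexMode (α : P.H) (a : P.A) (n : ℤ) : Module.End ℂ P.Lattice :=
  gradedOp (shiftedVertexOp α n) (LinearMap.mulLeft ℂ a)

theorem vertexMode_apply (α : P.H) (a : P.A) (n : ℤ) {β : P.H} {b : P.A} (hb : b ∈ P.grade β)
    (v : Fock P.H) : vertexMode α a n (v ⊗ₜ b) = shiftedVertexOp α n β v ⊗ₜ (a * b) :=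
  gradedOp_apply _ _ hb v

/-- The translation operator: `T = T_M + β(-1)` on `M_H(0) ⊗ A^β`. -/
def translate (P : AHPair.{u}) : Module.End ℂ P.Lattice :=
  gradedOp (fun β => (Fock.translation P.H).toLinearMap + LinearMap.mulLeft ℂ (Fock.gen β 0))
    LinearMap.id

theorem translate_apply {β : P.H} {b : P.A} (hb : b ∈ P.grade β) (v : Fock P.H) :
    translate P (v ⊗ₜ b) = (Fock.translation P.H v + Fock.gen β 0 * v) ⊗ₜ b :=
  gradedOp_apply _ _ hb v

/-- The canonical commutation relations. -/
theorem heisOp_comm (h h' : P.H) (m n : ℤ) (x : P.Lattice) :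
    heisOp h m (heisOp h' n x) = heisOp h' n (heisOp h m x) +
      (if m + n = 0 then (m : ℂ) * P.form h h' else 0) • x := by
  induction x using lattice_induction with
  | zero => simp
  | add x y hx hy => simp only [map_add, hx, hy, smul_add]; abel
  | tmul β b hb v =>
    rcases eq_or_ne m 0 with rfl | hm
    · rcases eq_or_ne n 0 with rfl | hn
      · simp [heisOp_zero _ hb, smul_comm (P.form h β)]
      · rw [heisOp_of_ne _ hn, heisOp_zero _ hb, heisOp_zero _ hb, map_smul, heisOp_of_ne _ hn]
        simp
    · rcases eq_or_ne n 0 with rfl | hn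
      · rw [heisOp_of_ne _ hm, heisOp_zero _ hb, heisOp_zero _ hb, map_smul, heisOp_of_ne _ hm,
          if_neg (by simpa using hm)]
        simp
      · simp only [heisOp_of_ne _ hm, heisOp_of_ne _ hn]
        rw [Fock.heis_comm _ P.isSymm, TensorProduct.add_tmul, TensorProduct.smul_tmul']

/-- `[h(n), Y(a, z)] = (h, α) z^n Y(a, z)` for `a ∈ A^α`. -/
theorem heisOp_vertexMode (h : P.H) {α : P.H} {a : P.A} (ha : a ∈ P.grade α) (n m : ℤ)
    (x : P.Lattice) : heisOp h n (vertexMode α a m x) =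
      vertexMode α a m (heisOp h n x) + P.form h α • vertexMode α a (m + n) x := by
  induction x using lattice_induction with
  | zero => simp
  | add x y hx hy => simp only [map_add, hx, hy, smul_add]; abel
  | tmul β b hb v =>
    rcases eq_or_ne n 0 with rfl | hn
    · rw [heisOp_zero _ hb, map_smul, vertexMode_apply α a m hb, heisOp_zero _ (P.mul_mem ha hb),
        add_zero, vertexMode_apply α a m hb, ← add_smul, map_add, add_comm]
    · rw [heisOp_of_ne _ hn, vertexMode_apply α a m hb, vertexMode_apply α a _ hb,
        vertexMode_apply α a _ hb, heisOp_of_ne _ hn, TensorProduct.smul_tmul',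
        ← TensorProduct.add_tmul]
      congr 1
      by_cases h' : ∃ N : ℤ, P.form α β = N
      · obtain ⟨N, hN⟩ := h'
        rw [shiftedVertexOp_eq hN, shiftedVertexOp_eq hN, Fock.heis_vertexOp P.isSymm h α hn]
        congr 4
        ring
      · rw [shiftedVertexOp_eq_zero (not_exists.1 h'), shiftedVertexOp_eq_zero (not_exists.1 h')]
        simp

theorem heisOp_trunc (h : P.H) (x : P.Lattice) : ∃ N : ℤ, ∀ n, N ≤ n → heisOp h n x = 0 := by
  induction x using lattice_induction with
  | zero => exact ⟨0, fun n _ => map_zero _⟩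
  | add x y hx hy =>
    obtain ⟨N, hN⟩ := hx
    obtain ⟨M, hM⟩ := hy
    exact ⟨max N M, fun n hn => by rw [map_add, hN n (by omega), hM n (by omega), add_zero]⟩
  | tmul β b hb v =>
    induction v using Fock.induction with
    | one => exact ⟨1, fun n hn => heisOp_pos_one h (by omega) b⟩
    | gen_mul h' k v ih =>
      obtain ⟨N, hN⟩ := ih
      refine ⟨max N (k + 2), fun n hn => ?_⟩
      rw [← heisOp_neg, heisOp_comm, hN n (by omega), if_neg (by omega), map_zero, zero_smul,
        add_zero]
    | add v w hv hw =>
      obtain ⟨N, hN⟩ := hv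
      obtain ⟨M, hM⟩ := hw
      exact ⟨max N M, fun n hn => by
        rw [TensorProduct.add_tmul, map_add, hN n (by omega), hM n (by omega), add_zero]⟩
    | smul c v hv =>
      obtain ⟨N, hN⟩ := hv
      exact ⟨N, fun n hn => by rw [← TensorProduct.smul_tmul', map_smul, hN n hn, smul_zero]⟩

theorem vertexMode_trunc (α : P.H) (a : P.A) (x : P.Lattice) :
    ∃ N : ℤ, ∀ n, N ≤ n → vertexMode α a n x = 0 := by
  induction x using lattice_induction with
  | zero => exact ⟨0, fun n _ => map_zero _⟩
  | add x y hx hy =>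
    obtain ⟨N, hN⟩ := hx
    obtain ⟨M, hM⟩ := hy
    exact ⟨max N M, fun n hn => by rw [map_add, hN n (by omega), hM n (by omega), add_zero]⟩
  | tmul β b hb v =>
    by_cases h' : ∃ N : ℤ, P.form α β = N
    · obtain ⟨N, hN⟩ := h'
      obtain ⟨M, hM⟩ := Fock.vertexOp_trunc P.isSymm α v
      refine ⟨-N - M, fun n hn => ?_⟩
      rw [vertexMode_apply α a n hb, shiftedVertexOp_eq hN, hM _ (by omega),
        TensorProduct.zero_tmul]
    · refine ⟨0, fun n _ => ?_⟩
      rw [vertexMode_apply α a n hb, shiftedVertexOp_eq_zero (not_exists.1 h'),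
        LinearMap.zero_apply, TensorProduct.zero_tmul]

/-- The field `∑ n, h(n) z^(-n-1)`. -/
def heisField (h : P.H) : FormalField P.Lattice := ⟨heisOp h, heisOp_trunc h⟩

/-- The field of `𝟏 ⊗ a`, for `a ∈ A^α`. -/
def vertexField (α : P.H) (a : P.A) : FormalField P.Lattice :=
  ⟨vertexMode α a, vertexMode_trunc α a⟩

/-- The fields that generate the vertex algebra structure of `M_H(0) ⊗ A`. -/
inductive IsLatticeField (P : AHPair.{u}) : FormalField P.Lattice → Prop
  | heis (h : P.H) : IsLatticeField P (heisField h)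
  | vertex (α : P.H) (a : P.A) (ha : a ∈ P.grade α) : IsLatticeField P (vertexField α a)

theorem translate_one : translate P (1 ⊗ₜ 1) = 0 := by
  rw [translate_apply P.one_mem, Fock.translation_one, Fock.gen]
  simp

theorem translate_heisOp (h : P.H) : FormalField.IsCovariant (translate P) (heisField h) := by
  intro n x
  change translate P (heisOp h n x) = heisOp h n (translate P x) - (n : ℂ) • heisOp h (n - 1) x
  induction x using lattice_induction with
  | zero => simp
  | add x y hx hy => simp only [map_add, hx, hy, smul_add]; abel
  | tmul β b hb v =>
    rcases eq_or_ne n 0 with rfl | hn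
    · rw [heisOp_zero h hb, map_smul, translate_apply hb, heisOp_zero h hb]
      simp
    · rw [heisOp_of_ne h hn, translate_apply hb, translate_apply hb, heisOp_of_ne h hn]
      have h0 : Fock.gen β 0 * v = Fock.heis P.form β (-1 - (0 : ℕ)) v :=
        (Fock.heis_neg_apply _ _ _ _).symm
      have h1 : Fock.gen β 0 * Fock.heis P.form h n v =
          Fock.heis P.form β (-1 - (0 : ℕ)) (Fock.heis P.form h n v) :=
        (Fock.heis_neg_apply _ _ _ _).symm
      rw [h0, h1, Fock.translation_heis, map_add,
        Fock.heis_comm _ P.isSymm h β n (-1 - (0 : ℕ)) v]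
      rcases eq_or_ne n 1 with rfl | hn1
      · rw [sub_self, heisOp_zero h hb, Fock.heis_zero]
        simp [TensorProduct.add_tmul, TensorProduct.smul_tmul']
        abel
      · rw [heisOp_of_ne h (by omega), if_neg (by push_cast; omega), TensorProduct.smul_tmul',
          ← TensorProduct.sub_tmul]
        congr 1
        module

theorem vertexMode_one {α β : P.H} {N : ℤ} (hN : P.form α β = N) {b : P.A} (hb : b ∈ P.grade β)
    (a : P.A) (n : ℤ) : vertexMode α a n (1 ⊗ₜ b) =
      Fock.creationInt P.form α (-n - 1 - N) 1 ⊗ₜ (a * b) := by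
  rw [vertexMode_apply α a n hb, shiftedVertexOp_eq hN, Fock.vertexOp_one]

theorem vertexMode_eq_zero {α β : P.H} (h : ∀ N : ℤ, P.form α β ≠ N) {b : P.A}
    (hb : b ∈ P.grade β) (a : P.A) (n : ℤ) (v : Fock P.H) : vertexMode α a n (v ⊗ₜ b) = 0 := by
  rw [vertexMode_apply α a n hb, shiftedVertexOp_eq_zero h, LinearMap.zero_apply,
    TensorProduct.zero_tmul]

theorem translate_vertexMode_one {α β : P.H} {a b : P.A} (ha : a ∈ P.grade α)
    (hb : b ∈ P.grade β) (n : ℤ) : translate P (vertexMode α a n (1 ⊗ₜ b)) =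
      vertexMode α a n (translate P (1 ⊗ₜ b)) - (n : ℂ) • vertexMode α a (n - 1) (1 ⊗ₜ b) := by
  have hT : translate P (1 ⊗ₜ b) = heisOp β (-1 - (0 : ℕ)) (1 ⊗ₜ b) := by
    rw [translate_apply hb, heisOp_neg, Fock.translation_one, zero_add]
  by_cases h : ∃ N : ℤ, P.form α β = N
  · obtain ⟨N, hN⟩ := h
    have hN' : P.form β α = N := by rw [← hN, ← P.isSymm.eq β α]
    have h1 := heisOp_vertexMode β ha (-1 - (0 : ℕ)) n (1 ⊗ₜ b)
    rw [← sub_eq_iff_eq_add] at h1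
    rw [hT, ← h1, vertexMode_one hN hb, vertexMode_one hN hb, vertexMode_one hN hb, hN',
      heisOp_neg, translate_apply (P.mul_mem ha hb), Fock.gen_add, add_mul, ← add_assoc,
      Fock.translation_creationInt P.isSymm,
      show -(n + (-1 - ((0 : ℕ) : ℤ))) - 1 - N = -n - 1 - N + 1 by push_cast; ring,
      show -(n - 1) - 1 - N = -n - 1 - N + 1 by ring]
    simp only [TensorProduct.add_tmul, ← TensorProduct.smul_tmul']
    push_cast
    module
  · rw [not_exists] at h
    rw [translate_apply hb, vertexMode_eq_zero h hb, vertexMode_eq_zero h hb,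
      vertexMode_eq_zero h hb]
    simp

theorem translate_vertexMode {α : P.H} {a : P.A} (ha : a ∈ P.grade α) :
    FormalField.IsCovariant (translate P) (vertexField α a) := by
  have key : ∀ β, ∀ b ∈ P.grade β, ∀ (v : Fock P.H) (n : ℤ),
      translate P (vertexMode α a n (v ⊗ₜ b)) =
        vertexMode α a n (translate P (v ⊗ₜ b)) - (n : ℂ) • vertexMode α a (n - 1) (v ⊗ₜ b) := by
    intro β b hb v
    induction v using Fock.induction with
    | one => exact translate_vertexMode_one ha hb
    | gen_mul h k v ih =>
      intro n
      rw [← heisOp_neg]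
      set x := v ⊗ₜ[ℂ] b
      have hc := fun m y => (sub_eq_iff_eq_add.2 (heisOp_vertexMode h ha (-1 - k) m y)).symm
      have hc' := fun m y => (sub_eq_iff_eq_add.2 (heisOp_vertexMode h ha (-1 - k - 1) m y)).symm
      have ht := fun y => translate_heisOp h (-1 - k) y
      change ∀ y, translate P (heisOp h (-1 - k) y) = heisOp h (-1 - k) (translate P y) -
        ((-1 - k : ℤ) : ℂ) • heisOp h (-1 - k - 1) y at ht
      simp only [hc, hc', ht, ih, map_sub, map_smul]
      rw [show n + (-1 - (k : ℤ) - 1) = n + (-1 - k) - 1 by ring,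
        show n - 1 + (-1 - (k : ℤ)) = n + (-1 - k) - 1 by ring]
      push_cast
      module
    | add v w hv hw =>
      intro n
      simp only [TensorProduct.add_tmul, map_add, hv, hw, smul_add]; abel
    | smul c v hv =>
      intro n
      simp only [← TensorProduct.smul_tmul', map_smul, hv, smul_sub, smul_comm c]
  intro n x
  change translate P (vertexMode α a n x) =
    vertexMode α a n (translate P x) - (n : ℂ) • vertexMode α a (n - 1) x
  induction x using lattice_induction with
  | zero => simp
  | add x y hx hy => simp only [map_add, hx, hy, smul_add]; abel
  | tmul β b hb v => exact key β b hb v n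

end AHPair

namespace AHPair

variable {P : AHPair.{u}}

/-! ### Locality of the generating fields -/

open FormalField

theorem isLocal_heis_heis (h h' : P.H) : IsLocal (heisField h) (heisField h') := by
  refine ⟨2, fun p q => ?_⟩
  have h0 : ∀ (p q : ℤ), locBracket (heisField h) (heisField h') 0 p q =
      (if p + q = 0 then (p : ℂ) * P.form h h' else 0) • 1 := fun p q => LinearMap.ext fun x => by
    rw [locBracket_zero]
    change heisOp h p (heisOp h' q x) - heisOp h' q (heisOp h p x) = _
    rw [heisOp_comm, add_sub_cancel_left]
    rfl
  rw [show ((2 : ℕ) : ℤ) = 0 + 1 + 1 by norm_num, locBracket_succ, locBracket_succ,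
    locBracket_succ, h0, h0, h0]
  by_cases hpq : p + q = -2
  · rw [if_pos (by omega), if_pos (by omega), if_pos (by omega)]
    push_cast
    module
  · rw [if_neg (by omega), if_neg (by omega), if_neg (by omega)]
    module

theorem isLocal_heis_vertex (h : P.H) {α : P.H} {a : P.A} (ha : a ∈ P.grade α) :
    IsLocal (heisField h) (vertexField α a) := by
  refine ⟨1, fun p q => ?_⟩
  have h0 : ∀ (p q : ℤ), locBracket (heisField h) (vertexField α a) 0 p q =
      P.form h α • vertexMode α a (q + p) := fun p q => LinearMap.ext fun x => by
    rw [locBracket_zero]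
    change heisOp h p (vertexMode α a q x) - vertexMode α a q (heisOp h p x) = _
    rw [heisOp_vertexMode h ha, add_sub_cancel_left]
    rfl
  rw [show ((1 : ℕ) : ℤ) = 0 + 1 by norm_num, locBracket_succ, h0, h0,
    show q + (p + 1) = q + 1 + p by ring]
  exact sub_self (P.form h α • vertexMode α a (q + 1 + p))

/-- The commutator of `h(n)` with `(z - w)^r [Y(a, z), Y(b, w)]`. -/
theorem heisOp_locBracket (h : P.H) {α β : P.H} {a b : P.A} (ha : a ∈ P.grade α)
    (hb : b ∈ P.grade β) (n : ℤ) (r : ℕ) (p q : ℤ) (x : P.Lattice) :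
    heisOp h n (locBracket (vertexField α a) (vertexField β b) r p q x) =
      locBracket (vertexField α a) (vertexField β b) r p q (heisOp h n x) +
      P.form h α • locBracket (vertexField α a) (vertexField β b) r (p + n) q x +
      P.form h β • locBracket (vertexField α a) (vertexField β b) r p (q + n) x := by
  induction r generalizing p q with
  | zero =>
    simp only [Nat.cast_zero, locBracket_zero]
    change heisOp h n (vertexMode α a p (vertexMode β b q x) -
        vertexMode β b q (vertexMode α a p x)) =
      (vertexMode α a p (vertexMode β b q (heisOp h n x)) -
        vertexMode β b q (vertexMode α a p (heisOp h n x))) +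
      P.form h α • (vertexMode α a (p + n) (vertexMode β b q x) -
        vertexMode β b q (vertexMode α a (p + n) x)) +
      P.form h β • (vertexMode α a p (vertexMode β b (q + n) x) -
        vertexMode β b (q + n) (vertexMode α a p x))
    rw [map_sub, heisOp_vertexMode h ha, heisOp_vertexMode h hb, heisOp_vertexMode h hb,
      heisOp_vertexMode h ha]
    simp only [map_add, map_smul]
    module
  | succ r ih =>
    simp only [Nat.cast_succ, locBracket_succ, LinearMap.sub_apply, map_sub, ih]
    rw [show p + 1 + n = p + n + 1 by ring, show q + 1 + n = q + n + 1 by ring]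
    module

theorem locBracket_eq_zero_of_zero {V : Type u} [AddCommGroup V] [Module ℂ V] {a b : FormalField V}
    {x : V} (h : ∀ p q, locBracket a b 0 p q x = 0) (r : ℕ) (p q : ℤ) :
    locBracket a b r p q x = 0 := by
  induction r generalizing p q with
  | zero => exact h p q
  | succ r ih => rw [Nat.cast_succ, locBracket_succ, LinearMap.sub_apply, ih, ih, sub_zero]

theorem expandProd_eq_expandSum {V : Type u} [AddCommGroup V] [Module ℂ V] {a b : FormalField V}
    {x : V} {g : ℤ → ℤ → V} {s Q : ℤ} (hg : ∀ p q, Q ≤ q → g p q = 0)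
    (h : ∀ (p q : ℤ) (M : ℕ), Q ≤ q + M → a.1 p (b.1 q x) = expandSum g M s p q)
    (r : ℕ) (p q : ℤ) (M : ℕ) (hM : Q ≤ q + M) :
    expandProd a b r p q x = expandSum g M (s + r) p q := by
  induction r generalizing p q with
  | zero => rw [Nat.cast_zero, expandProd_zero, add_zero]; exact h p q M hM
  | succ r ih =>
    rw [Nat.cast_succ, expandProd_succ, LinearMap.sub_apply, ih _ _ hM, ih _ _ (by omega),
      ← add_assoc, expandSum_succ _ _ _ fun p => hg _ _ hM]

/-- The modes of `Y(a, z) Y(b, w)` on `𝟏 ⊗ c`. -/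
theorem vertexMode_vertexMode_one {α β γ : P.H} {s t w : ℤ} (hs : P.form α β = s)
    (ht : P.form β γ = t) (hw : P.form α γ = w) {b c : P.A} (a : P.A) (hb : b ∈ P.grade β)
    (hc : c ∈ P.grade γ) (p q : ℤ) (M : ℕ) (hM : -t ≤ q + M) :
    vertexMode α a p (vertexMode β b q (1 ⊗ₜ c)) = expandSum (fun p q =>
      Fock.creationInt P.form α (-p - 1 - w) (Fock.creationInt P.form β (-q - 1 - t) 1) ⊗ₜ[ℂ]
        (a * (b * c))) M s p q := by
  rw [vertexMode_one ht hc, vertexMode_apply α a p (P.mul_mem hb hc),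
    shiftedVertexOp_eq (N := s + w) (by rw [map_add, hs, hw]; push_cast; rfl),
    Fock.vertexOp_creationInt_one P.isSymm hs _ _ (M := M) (by omega), TensorProduct.sum_tmul]
  refine Finset.sum_congr rfl fun i _ => ?_
  rw [TensorProduct.smul_tmul', show -p - 1 - (s + w) + i = -(p + s - i) - 1 - w by ring,
    show -q - 1 - t - i = -(q + i) - 1 - t by ring]

/-- On `𝟏 ⊗ c` both products of `Y(a, z)` and `Y(b, w)` are expansions of `(z - w)^(α, β)` times the
same series, up to the sign by which `a` and `b` commute. -/
theorem locBracket_vertex_one {α β γ : P.H} {s t w : ℤ} (hs : P.form α β = s)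
    (ht : P.form β γ = t) (hw : P.form α γ = w) {a b c : P.A} (ha : a ∈ P.grade α)
    (hb : b ∈ P.grade β) (hc : c ∈ P.grade γ) (p q : ℤ) :
    locBracket (vertexField α a) (vertexField β b) ((-s).toNat : ℕ) p q (1 ⊗ₜ c) = 0 := by
  set r := (-s).toNat
  obtain ⟨R, hR⟩ := Int.eq_ofNat_of_zero_le (by omega : 0 ≤ s + r)
  have hs' : P.form β α = s := by rw [← hs, ← P.isSymm.eq β α]
  have hneg : ∀ (δ : P.H) k, k < 0 → Fock.creationInt P.form δ k = 0 := fun δ =>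
    (Fock.isExpSeq_creationInt P.isSymm δ).of_neg
  set M := (max ((-t - q).toNat) ((-w - p).toNat)) + R + 1
  have e1 := expandProd_eq_expandSum (a := vertexField α a) (b := vertexField β b) (x := 1 ⊗ₜ c)
    (Q := -t) (fun p q hq => by rw [hneg β _ (by omega)]; simp)
    (fun p q M hM => vertexMode_vertexMode_one hs ht hw a hb hc p q M hM) r p q M (by omega)
  have e2 := expandProd_eq_expandSum (a := vertexField β b) (b := vertexField α a) (x := 1 ⊗ₜ c)
    (Q := -w) (fun p q hq => by rw [hneg α _ (by omega)]; simp)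
    (fun p q M hM => vertexMode_vertexMode_one hs' hw ht b ha hc p q M hM) r q p M (by omega)
  rw [locBracket, LinearMap.sub_apply, LinearMap.smul_apply, e1, e2, hR,
    expandSum_swap _ R (M := M) (M' := M) (by omega) (by omega), sub_eq_zero]
  unfold expandSum
  rw [Finset.smul_sum, Finset.smul_sum]
  refine Finset.sum_congr rfl fun i _ => ?_
  have hab : a * (b * c) = (-1 : ℂ) ^ s • (b * (a * c)) := by
    rw [← mul_assoc, P.mul_comm_sign ha hb s hs, smul_mul_assoc, mul_assoc]
  have hsign : (((-1 : ℤ) ^ R : ℤ) : ℂ) * (-1 : ℂ) ^ s = (-1 : ℂ) ^ (r : ℤ) := by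
    rw [show (((-1 : ℤ) ^ R : ℤ) : ℂ) = (-1 : ℂ) ^ (s + r) by rw [hR]; push_cast; rfl,
      zpow_add₀ (by norm_num), mul_right_comm, ← mul_zpow]
    norm_num
  dsimp only
  rw [hab, TensorProduct.tmul_smul, Fock.creationInt_comm P.isSymm α β,
    smul_comm _ ((-1 : ℂ) ^ s) (_ ⊗ₜ[ℂ] _), ← hsign, ← Int.cast_smul_eq_zsmul ℂ ((-1) ^ R),
    smul_smul]

theorem isLocal_vertex_vertex {α β : P.H} {a b : P.A} (ha : a ∈ P.grade α) (hb : b ∈ P.grade β) :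
    IsLocal (vertexField α a) (vertexField β b) := by
  -- it suffices to find an order that serves on all the vectors `1 ⊗ c`
  suffices h : ∃ r : ℕ, ∀ γ, ∀ c ∈ P.grade γ, ∀ p q : ℤ,
      locBracket (vertexField α a) (vertexField β b) r p q (1 ⊗ₜ c) = 0 by
    obtain ⟨r, hr⟩ := h
    have key : ∀ γ, ∀ c ∈ P.grade γ, ∀ (v : Fock P.H) (p q : ℤ),
        locBracket (vertexField α a) (vertexField β b) r p q (v ⊗ₜ c) = 0 := by
      intro γ c hc v
      induction v using Fock.induction with
      | one => exact hr γ c hc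
      | gen_mul h k v ih =>
        intro p q
        have := heisOp_locBracket h ha hb (-1 - k) r p q (v ⊗ₜ c)
        rw [ih, ih, ih, map_zero, smul_zero, smul_zero, add_zero, add_zero, heisOp_neg] at this
        exact this.symm
      | add v w hv hw => intro p q; rw [TensorProduct.add_tmul, map_add, hv, hw, add_zero]
      | smul k v hv => intro p q; rw [← TensorProduct.smul_tmul', map_smul, hv, smul_zero]
    exact ⟨r, fun p q => lattice_ext fun γ c hc v => key γ c hc v p q⟩
  -- both products vanish on `1 ⊗ c` if both `a (b c)` and `b (a c)` do, whatever the pairings are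
  have hcomm : ∀ γ, ∀ c ∈ P.grade γ, a * (b * c) = 0 → b * (a * c) = 0 → ∀ (r : ℕ) (p q : ℤ),
      locBracket (vertexField α a) (vertexField β b) r p q (1 ⊗ₜ c) = 0 := by
    intro γ c hc h1 h2
    refine locBracket_eq_zero_of_zero fun p q => ?_
    rw [locBracket_zero]
    change vertexMode α a p (vertexMode β b q (1 ⊗ₜ c)) -
      vertexMode β b q (vertexMode α a p (1 ⊗ₜ c)) = 0
    rw [vertexMode_apply β b q hc, vertexMode_apply α a p (P.mul_mem hb hc),
      vertexMode_apply α a p hc, vertexMode_apply β b q (P.mul_mem ha hc), h1, h2]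
    simp
  by_cases h : ∃ s : ℤ, P.form α β = s
  · obtain ⟨s, hs⟩ := h
    have hab : ∀ c, a * (b * c) = (-1 : ℂ) ^ s • (b * (a * c)) := fun c => by
      rw [← mul_assoc, P.mul_comm_sign ha hb s hs, smul_mul_assoc, mul_assoc]
    refine ⟨(-s).toNat, fun γ c hc p q => ?_⟩
    by_cases h0 : b * (a * c) = 0
    · exact hcomm γ c hc (by rw [hab, h0, smul_zero]) h0 _ p q
    · have h0' : a * (b * c) ≠ 0 := by
        rw [hab]; exact smul_ne_zero (zpow_ne_zero _ (by norm_num)) h0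
      obtain ⟨t, ht⟩ := P.integral_of_mul_ne_zero hb hc (right_ne_zero_of_mul h0')
      obtain ⟨w, hw⟩ := P.integral_of_mul_ne_zero ha hc (right_ne_zero_of_mul h0)
      exact locBracket_vertex_one hs ht hw ha hb hc p q
  · have h1 : a * b = 0 := by
      by_contra h'; exact h (P.integral_of_mul_ne_zero ha hb h')
    have h2 : b * a = 0 := by
      by_contra h'
      obtain ⟨n, hn⟩ := P.integral_of_mul_ne_zero hb ha h'
      exact h ⟨n, by rw [← hn, ← P.isSymm.eq β α]⟩
    exact ⟨0, fun γ c hc => hcomm γ c hc (by rw [← mul_assoc, h1, zero_mul])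
      (by rw [← mul_assoc, h2, zero_mul]) 0⟩

theorem isLocal_of_isLatticeField {a b : FormalField P.Lattice} (ha : IsLatticeField P a)
    (hb : IsLatticeField P b) : IsLocal a b := by
  cases ha with
  | heis h =>
    cases hb with
    | heis h' => exact isLocal_heis_heis h h'
    | vertex β b hb => exact isLocal_heis_vertex h hb
  | vertex α a ha =>
    cases hb with
    | heis h => exact (isLocal_heis_vertex h ha).symm
    | vertex β b hb => exact isLocal_vertex_vertex ha hb

/-! ### The lattice VH pair -/

theorem vertexMode_neg_one {α : P.H} (a : P.A) :
    vertexMode α a (-1) (1 ⊗ₜ 1) = 1 ⊗ₜ a := by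
  rw [vertexMode_one (N := 0) (by simp) P.one_mem, mul_one]
  simp only [neg_neg, sub_self, (Fock.isExpSeq_creationInt P.isSymm α).zero, Module.End.one_apply]

theorem heisOp_neg_one (h : P.H) : heisOp h (-1) (1 ⊗ₜ 1) = Fock.gen h 0 ⊗ₜ (1 : P.A) := by
  have := heisOp_neg h 0 1 (1 : P.A)
  rwa [Nat.cast_zero, sub_zero, mul_one] at this

theorem eq_top_of_stable {W : Submodule ℂ P.Lattice} (h1 : 1 ⊗ₜ 1 ∈ W)
    (hW : ∀ a, IsLatticeField P a → ∀ (n : ℤ), ∀ x ∈ W, a.1 n x ∈ W) : W = ⊤ := by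
  refine Submodule.eq_top_iff'.2 fun x => ?_
  induction x using lattice_induction with
  | zero => exact W.zero_mem
  | add x y hx hy => exact W.add_mem hx hy
  | tmul β b hb v =>
    induction v using Fock.induction with
    | one =>
      have := hW _ (.vertex β b hb) (-1) _ h1
      rwa [show (vertexField β b).1 (-1) _ = _ from vertexMode_neg_one b] at this
    | gen_mul h k v ih =>
      rw [← heisOp_neg]
      exact hW _ (.heis h) _ _ ih
    | add v w hv hw => rw [TensorProduct.add_tmul]; exact W.add_mem hv hw
    | smul c v hv => rw [← TensorProduct.smul_tmul']; exact W.smul_mem c hv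

theorem isGeneratingSystem (P : AHPair.{u}) :
    IsGeneratingSystem (1 ⊗ₜ 1) (translate P) {a | IsLatticeField P a} where
  translate_one := translate_one
  covariant a ha := by
    cases ha with
    | heis h => exact translate_heisOp h
    | vertex α a ha => exact translate_vertexMode ha
  creative a ha n hn := by
    cases ha with
    | heis h =>
      change heisOp h n (1 ⊗ₜ 1) = 0
      rcases hn.eq_or_lt with rfl | hn
      · rw [heisOp_zero h P.one_mem, map_zero, zero_smul]
      · exact heisOp_pos_one h hn 1
    | vertex α a ha =>
      change vertexMode α a n (1 ⊗ₜ 1) = 0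
      rw [vertexMode_one (N := 0) (by simp) P.one_mem,
        (Fock.isExpSeq_creationInt P.isSymm α).of_neg _ (by omega), LinearMap.zero_apply,
        TensorProduct.zero_tmul]
  isLocal a ha b hb := isLocal_of_isLatticeField ha hb
  generates W h1 hW := eq_top_of_stable h1 hW

/-- The vacuum expectation `M_H(0) → ℂ`, tensored with `A`. -/
def expectation (P : AHPair.{u}) : P.Lattice →ₗ[ℂ] P.A :=
  TensorProduct.lid ℂ P.A ∘ₗ
    (SymmetricAlgebra.algebraMapInv (R := ℂ) (M := ℕ →₀ P.H)).toLinearMap.rTensor P.A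

theorem expectation_one_tmul (a : P.A) : expectation P (1 ⊗ₜ a) = a := by
  simp [expectation]

theorem one_tmul_injective : Function.Injective fun a : P.A => (1 : Fock P.H) ⊗ₜ[ℂ] a :=
  fun a b h => by
    have := congrArg (expectation P) h
    rwa [expectation_one_tmul, expectation_one_tmul] at this

theorem one_tmul_one_ne_zero : (1 : Fock P.H) ⊗ₜ[ℂ] (1 : P.A) ≠ 0 := fun h =>
  one_ne_zero (α := P.A) (one_tmul_injective (P := P) (by
    change (1 : Fock P.H) ⊗ₜ[ℂ] (1 : P.A) = 1 ⊗ₜ 0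
    rw [h, TensorProduct.tmul_zero]))

instance latticeVertexAlgebra (P : AHPair.{u}) : VertexAlgebra P.Lattice :=
  (isGeneratingSystem P).vertexAlgebra one_tmul_one_ne_zero

theorem lattice_vac : (VertexAlgebra.vac : P.Lattice) = 1 ⊗ₜ 1 := rfl

theorem nProd_heis (h : P.H) (n : ℤ) (x : P.Lattice) :
    VertexAlgebra.nProd n (Fock.gen h 0 ⊗ₜ (1 : P.A)) x = heisOp h n x := by
  have := (isGeneratingSystem P).nProd_of_mem one_tmul_one_ne_zero (IsLatticeField.heis h) n
  rw [show (heisField h).1 (-1) _ = _ from heisOp_neg_one h] at this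
  exact LinearMap.congr_fun this x

theorem nProd_vertex {α : P.H} {a : P.A} (ha : a ∈ P.grade α) (n : ℤ) (x : P.Lattice) :
    VertexAlgebra.nProd n ((1 : Fock P.H) ⊗ₜ a) x = vertexMode α a n x := by
  have := (isGeneratingSystem P).nProd_of_mem one_tmul_one_ne_zero (IsLatticeField.vertex α a ha) n
  rw [show (vertexField α a).1 (-1) _ = _ from vertexMode_neg_one a] at this
  exact LinearMap.congr_fun this x

/-- The embedding `h ↦ h(-1)𝟏 ⊗ 1`. -/
def embed (P : AHPair.{u}) : P.H →ₗ[ℂ] P.Lattice where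
  toFun h := Fock.gen h 0 ⊗ₜ 1
  map_add' h h' := by rw [Fock.gen_add, TensorProduct.add_tmul]
  map_smul' c h := by rw [Fock.gen_smul, ← TensorProduct.smul_tmul']; rfl

theorem embed_apply (h : P.H) : embed P h = Fock.gen h 0 ⊗ₜ 1 := rfl

theorem heisOp_embed (h h' : P.H) (n : ℤ) (hn : 0 ≤ n) : heisOp h n (embed P h') =
    if n = 1 then P.form h h' • ((1 : Fock P.H) ⊗ₜ[ℂ] (1 : P.A)) else 0 := by
  have h0 : heisOp h n ((1 : Fock P.H) ⊗ₜ[ℂ] (1 : P.A)) = 0 := by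
    rcases hn.eq_or_lt with rfl | hn
    · rw [heisOp_zero h P.one_mem, map_zero, zero_smul]
    · exact heisOp_pos_one h hn 1
  rw [embed_apply, ← heisOp_neg_one, heisOp_comm, h0, map_zero, zero_add]
  by_cases h1 : n = 1
  · subst h1; simp
  · rw [if_neg (by omega), if_neg h1, zero_smul]

theorem embed_injective : Function.Injective (embed P) := by
  rw [injective_iff_map_eq_zero]
  intro h hh
  refine P.nondegenerate.2 h fun h' => ?_
  have := heisOp_embed h' h 1 zero_le_one
  rw [hh, map_zero, if_pos rfl, eq_comm, smul_eq_zero] at this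
  exact this.resolve_right one_tmul_one_ne_zero

/-- The space `H`, identified with a subspace of `M_H(0) ⊗ A`. -/
def embedEquiv (P : AHPair.{u}) : P.H ≃ₗ[ℂ] LinearMap.range (embed P) :=
  LinearEquiv.ofInjective (embed P) embed_injective

theorem coe_embedEquiv (h : P.H) : (embedEquiv P h : P.Lattice) = Fock.gen h 0 ⊗ₜ 1 := rfl

/-- The VH pair `𝒱(A, H) = (M_H(0) ⊗ A, H)`. -/
def latticePair (P : AHPair.{u}) : VHPair.{u} where
  V := P.Lattice
  H := LinearMap.range (embed P)
  form := P.form.compl₁₂ (embedEquiv P).symm.toLinearMap (embedEquiv P).symm.toLinearMap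
  nProd_one h h' := by
    obtain ⟨h, rfl⟩ := (embedEquiv P).surjective h
    obtain ⟨h', rfl⟩ := (embedEquiv P).surjective h'
    rw [coe_embedEquiv, nProd_heis]
    change heisOp h 1 (embed P h') = _
    rw [heisOp_embed h h' 1 zero_le_one, if_pos rfl]
    simp [lattice_vac]
  nProd_eq_zero h h' n hn := by
    obtain ⟨h, rfl⟩ := (embedEquiv P).surjective h
    obtain ⟨h', rfl⟩ := (embedEquiv P).surjective h'
    rw [coe_embedEquiv, nProd_heis]
    change heisOp h n (embed P h') = _
    rw [heisOp_embed h h' n (by omega), if_neg (by omega)]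
  nondegenerate := by
    refine ⟨fun h hh => ?_, fun h hh => ?_⟩
    · refine (embedEquiv P).symm.injective ?_
      rw [map_zero]
      refine P.nondegenerate.1 _ fun h' => ?_
      simpa using hh (embedEquiv P h')
    · refine (embedEquiv P).symm.injective ?_
      rw [map_zero]
      refine P.nondegenerate.2 _ fun h' => ?_
      simpa using hh (embedEquiv P h')

theorem latticePair_form (h h' : P.H) :
    (latticePair P).form (embedEquiv P h) (embedEquiv P h') = P.form h h' := by
  change P.form ((embedEquiv P).symm (embedEquiv P h)) ((embedEquiv P).symm (embedEquiv P h')) = _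
  simp only [LinearEquiv.symm_apply_apply]

/-- The defining identification of the lattice VH pair. -/
def latticeModel (P : AHPair.{u}) : LatticeModel P (latticePair P) where
  iso := LinearEquiv.refl ℂ _
  iso_one := rfl
  mem_H x := Iff.rfl
  nProd_zero_heis h β v b hb := by
    refine (nProd_heis h 0 (v ⊗ₜ b)).trans ?_
    rw [heisOp_zero h hb]
    rfl
  nProd_heis h v b n hn := (nProd_heis h n (v ⊗ₜ b)).trans (heisOp_of_ne h hn v b)
  nProd_vertex α β N hN a b v n ha hb := by
    refine (nProd_vertex ha n (v ⊗ₜ b)).trans ?_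
    rw [vertexMode_apply α a n hb, shiftedVertexOp_eq hN]
    rfl
  nProd_vertex_eq_zero α β h a b v n ha hb :=
    (nProd_vertex ha n (v ⊗ₜ b)).trans (vertexMode_eq_zero h hb a n v)

end AHPair

namespace Fock

variable {H : Type u} [AddCommGroup H] [Module ℂ H] {B : LinearMap.BilinForm ℂ H}

/-! ### Vacuum vectors of the lattice VH pair -/

/-- In coordinates a contraction is a partial derivative. -/
theorem equivMvPolynomial_contraction {W : Type u} {κ : Type*} [AddCommGroup W]
    [Module ℂ W] (b : Module.Basis κ ℂ W) (i : κ) (x : SymmetricAlgebra ℂ W) :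
    SymmetricAlgebra.equivMvPolynomial b (contraction (b.coord i) x) =
      MvPolynomial.pderiv i (SymmetricAlgebra.equivMvPolynomial b x) := by
  induction x using SymmetricAlgebra.induction with
  | algebraMap r =>
    rw [Derivation.map_algebraMap, AlgEquiv.commutes, Derivation.map_algebraMap, map_zero]
  | ι w =>
    rw [contraction_ι, AlgEquiv.commutes]
    have : Algebra.linearMap ℂ (MvPolynomial κ ℂ) ∘ₗ b.coord i =
        (MvPolynomial.pderiv i).toLinearMap ∘ₗ
          (SymmetricAlgebra.equivMvPolynomial b).toLinearMap ∘ₗ SymmetricAlgebra.ι ℂ W := by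
      refine b.ext fun j => ?_
      classical
      simp [MvPolynomial.pderiv_X, Finsupp.single_apply, Pi.single_apply, apply_ite]
    exact LinearMap.congr_fun this w
  | mul x y hx hy =>
    rw [Derivation.leibniz, map_mul, Derivation.leibniz, map_add, smul_eq_mul, smul_eq_mul,
      map_mul, map_mul, hx, hy, smul_eq_mul, smul_eq_mul]
  | add x y hx hy => simp only [map_add, hx, hy]

theorem eq_C_of_pderiv {κ : Type*} {p : MvPolynomial κ ℂ}
    (h : ∀ i, MvPolynomial.pderiv i p = 0) : p = MvPolynomial.C (MvPolynomial.coeff 0 p) := by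
  ext m
  classical
  rw [MvPolynomial.coeff_C]
  split_ifs with hm
  · rw [hm]
  · obtain ⟨i, hi⟩ : ∃ i, m i ≠ 0 := by
      by_contra! h'
      exact hm (Finsupp.ext h').symm
    have := congrArg (MvPolynomial.coeff (m - Finsupp.single i 1)) (h i)
    have hle : Finsupp.single i 1 ≤ m := by
      rw [Finsupp.single_le_iff]; omega
    rw [MvPolynomial.coeff_pderiv, tsub_add_cancel_of_le hle, MvPolynomial.coeff_zero] at this
    exact (mul_eq_zero.1 this).resolve_right (Nat.cast_add_one_ne_zero _)

/-- The vectors of the Fock space that are killed by all `h(n)`, `n ≥ 1`, are the scalars. -/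
theorem eq_algebraMap_of_annihilator [FiniteDimensional ℂ H] (hB : B.Nondegenerate) {v : Fock H}
    (hv : ∀ (h : H) (k : ℕ), annihilator B h k v = 0) : ∃ c : ℂ, v = algebraMap ℂ _ c := by
  let b : Module.Basis (Σ _ : ℕ, Fin (Module.finrank ℂ H)) ℂ (ℕ →₀ H) :=
    Finsupp.basis fun _ => Module.finBasis ℂ H
  have h1 : ∀ i, MvPolynomial.pderiv i (SymmetricAlgebra.equivMvPolynomial b v) = 0 := by
    rintro ⟨k, j⟩
    rw [← equivMvPolynomial_contraction]
    have h2 := hv ((B.toDual hB).symm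
      (((k : ℂ) + 1)⁻¹ • (Module.finBasis ℂ H).coord j)) k
    rw [annihilator] at h2
    have h3 : ((k : ℂ) + 1) • (B ((B.toDual hB).symm
        (((k : ℂ) + 1)⁻¹ • (Module.finBasis ℂ H).coord j)) ∘ₗ
          Finsupp.lapply k) = b.coord ⟨k, j⟩ := by
      refine LinearMap.ext fun w => ?_
      rw [LinearMap.smul_apply, LinearMap.comp_apply, LinearMap.BilinForm.apply_toDual_symm_apply,
        LinearMap.smul_apply, smul_smul,
        mul_inv_cancel₀ (Nat.cast_add_one_ne_zero k), one_smul]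
      simp [b]
    rw [h3] at h2
    rw [h2, map_zero]
  have h4 := eq_C_of_pderiv h1
  refine ⟨MvPolynomial.coeff 0 (SymmetricAlgebra.equivMvPolynomial b v),
    (SymmetricAlgebra.equivMvPolynomial b).injective ?_⟩
  rw [AlgEquiv.commutes]
  exact h4

end Fock

namespace AHPair

variable {P : AHPair.{u}}

/-- The vectors of `M_H(0) ⊗ A` that are killed by all `h(n)`, `n ≥ 1`, are those of `𝟏 ⊗ A`. -/
theorem eq_one_tmul_of_heisOp {x : P.Lattice}
    (hx : ∀ (h : P.H) (k : ℕ), heisOp h (k + 1) x = 0) : ∃ a, x = (1 : Fock P.H) ⊗ₜ a := by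
  classical
  let b := Module.Basis.ofVectorSpace ℂ P.A
  let E := TensorProduct.equivFinsuppOfBasisRight (M := Fock P.H) b
  have hE : ∀ (h : P.H) (k : ℕ) (x : P.Lattice) i,
      E (heisOp h (k + 1) x) i = Fock.annihilator P.form h k (E x i) := by
    intro h k x i
    induction x using TensorProduct.induction_on with
    | zero => simp
    | add x y hx hy => simp only [map_add, Finsupp.add_apply, hx, hy]
    | tmul v a =>
      rw [heisOp_of_ne h (by omega), Fock.heis_pos_apply]
      simp only [E, TensorProduct.equivFinsuppOfBasisRight_apply_tmul_apply, Derivation.map_smul]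
  have h1 : ∀ i, ∃ c : ℂ, E x i = algebraMap ℂ _ c := fun i =>
    Fock.eq_algebraMap_of_annihilator P.nondegenerate fun h k => by
      rw [← hE, hx, map_zero, Finsupp.zero_apply]
  choose c hc using h1
  refine ⟨(E x).sum fun i _ => c i • b i, ?_⟩
  have h2 := TensorProduct.equivFinsuppOfBasisRight_symm_apply (M := Fock P.H) b (E x)
  rw [show (TensorProduct.equivFinsuppOfBasisRight b).symm (E x) = x from E.symm_apply_apply x]
    at h2
  refine h2.trans ?_
  rw [Finsupp.sum, Finsupp.sum, TensorProduct.tmul_sum]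
  refine Finset.sum_congr rfl fun i _ => ?_
  rw [hc, Algebra.algebraMap_eq_smul_one, TensorProduct.smul_tmul]

/-- `A^α` is the joint eigenspace of the operators `h(0)` with the eigenvalues `(h, α)`: the form is
nondegenerate, so they separate the components of `a`. -/
theorem mem_grade_of_form {α : P.H} {a : P.A}
    (ha : ∀ h : P.H, heisOp h 0 ((1 : Fock P.H) ⊗ₜ a) = P.form h α • ((1 : Fock P.H) ⊗ₜ[ℂ] a)) :
    a ∈ P.grade α := by
  classical
  -- the eigenvalue `(h, α)` forces `(h, β) = (h, α)` whenever the component of `a` in `A^β` is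
  -- nonzero
  have h1 : ∀ (h β : P.H), P.form h β • P.decomposition a β = P.form h α • P.decomposition a β := by
    intro h β
    let D : P.A →ₗ[ℂ] P.A := P.gradedMap fun β => P.form h β • LinearMap.id
    have h2 : ∀ a, heisOp h 0 ((1 : Fock P.H) ⊗ₜ a) = (1 : Fock P.H) ⊗ₜ[ℂ] D a := fun a =>
      P.grade_induction (p := fun a => heisOp h 0 ((1 : Fock P.H) ⊗ₜ a) = (1 : Fock P.H) ⊗ₜ[ℂ] D a)
        (fun γ c hc => by
          rw [heisOp_zero h hc]; simp only [D]; rw [P.gradedMap_apply _ hc]; simp)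
        (by simp) (fun a b ha hb => by simp only [TensorProduct.tmul_add, map_add, ha, hb]) a
    have h3 : ∀ a, P.decomposition (D a) β = P.form h β • P.decomposition a β := fun a =>
      P.grade_induction (p := fun a => P.decomposition (D a) β = P.form h β • P.decomposition a β)
        (fun γ c hc => by
          have : D c = P.form h γ • c := by simp only [D]; rw [P.gradedMap_apply _ hc]; rfl
          rw [this, map_smul, P.decomposition_apply hc]
          by_cases hγ : γ = β
          · subst hγ; rfl
          · rw [DirectSum.smul_apply, DirectSum.lof_eq_of, DirectSum.of_eq_of_ne _ _ _ (Ne.symm hγ),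
              smul_zero, smul_zero])
        (by simp) (fun a b ha hb => by
          simp only [map_add, DirectSum.add_apply, ha, hb, smul_add]) a
    have h4 : D a = P.form h α • a := one_tmul_injective (P := P) (by
      change (1 : Fock P.H) ⊗ₜ[ℂ] D a = 1 ⊗ₜ (P.form h α • a)
      rw [← h2, ha, TensorProduct.tmul_smul])
    rw [← h3, h4, map_smul, DirectSum.smul_apply]
  have h2 : ∀ β, β ≠ α → P.decomposition a β = 0 := by
    intro β hβ
    by_contra h0
    refine hβ (sub_eq_zero.1 (P.nondegenerate.2 _ fun h => ?_))
    rw [map_sub, sub_eq_zero]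
    exact smul_left_injective ℂ h0 (h1 h β)
  have h3 : P.decomposition a =
      DirectSum.lof ℂ P.H (fun β => P.grade β) α (P.decomposition a α) := by
    refine DFinsupp.ext fun β => ?_
    by_cases hβ : β = α
    · subst hβ
      rw [DirectSum.lof_eq_of, DirectSum.of_eq_same]
    · rw [DirectSum.lof_eq_of, DirectSum.of_eq_of_ne _ _ _ hβ]
      exact h2 β hβ
  have h4 : a = (P.decomposition a α : P.A) := by
    refine P.decomposition.injective ?_
    rw [P.decomposition_apply (P.decomposition a α).2]
    exact h3
  rw [h4]
  exact (P.decomposition a α).2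

open VertexAlgebra VHPair

theorem one_tmul_mem_vacuumSpace {α : P.H} {a : P.A} (ha : a ∈ P.grade α) :
    ((1 : Fock P.H) ⊗ₜ[ℂ] a : (latticePair P).V) ∈
      (latticePair P).vacuumSpace (embedEquiv P α) := by
  refine (mem_vacuumSpace_iff (X := latticePair P)).2 ⟨?_, fun h n hn => ?_, fun h => ?_⟩
  · change nProd (V := P.Lattice) (-2) (1 ⊗ₜ a) (1 ⊗ₜ 1) =
      nProd (-1) (Fock.gen α 0 ⊗ₜ[ℂ] (1 : P.A)) (1 ⊗ₜ a)
    have h1 := (Fock.isExpSeq_creationInt P.isSymm α).recursion 1 1 le_rfl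
    rw [Finset.sum_range_one, Int.cast_one, one_smul, Nat.cast_zero, sub_zero, sub_zero, sub_self,
      (Fock.isExpSeq_creationInt P.isSymm α).zero, mul_one] at h1
    rw [nProd_vertex ha, nProd_heis, vertexMode_one (N := 0) (by simp) P.one_mem, mul_one,
      heisOp_of_ne α (by norm_num)]
    norm_num [h1]
  · obtain ⟨h, rfl⟩ := (embedEquiv P).surjective h
    exact (nProd_heis h n _).trans (heisOp_pos_one h (by omega) a)
  · obtain ⟨h, rfl⟩ := (embedEquiv P).surjective h
    rw [latticePair_form]
    exact (nProd_heis h 0 _).trans (heisOp_zero h ha 1)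

theorem exists_of_mem_vacuumSpace {α : P.H} {x : P.Lattice}
    (hx : x ∈ (latticePair P).vacuumSpace (embedEquiv P α)) :
    ∃ a ∈ P.grade α, (1 : Fock P.H) ⊗ₜ[ℂ] a = x := by
  have hw := isWeightVector_of_mem hx
  obtain ⟨a, rfl⟩ := eq_one_tmul_of_heisOp (x := x) fun h k =>
    (nProd_heis h (k + 1) x).symm.trans (hw.1 (embedEquiv P h) (k + 1) (by omega))
  refine ⟨a, mem_grade_of_form fun h => ?_, rfl⟩
  have := hw.2 (embedEquiv P h)
  rw [latticePair_form] at this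
  exact (nProd_heis h 0 _).symm.trans this

theorem leading_vertex {α β : P.H} {N : ℤ} (hN : P.form α β = N) {a b : P.A}
    (ha : a ∈ P.grade α) (hb : b ∈ P.grade β) :
    nProd (-N - 1) ((1 : Fock P.H) ⊗ₜ[ℂ] a) ((1 : Fock P.H) ⊗ₜ[ℂ] b) = 1 ⊗ₜ (a * b) := by
  rw [nProd_vertex ha, vertexMode_one hN hb, show -(-N - 1) - 1 - N = 0 by ring,
    (Fock.isExpSeq_creationInt P.isSymm α).zero]
  rfl

/-- The identification of `(A, H)` with `Ω(𝒱(A, H))`, given by `a ↦ 𝟏 ⊗ a`. -/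
def latticeVacuumModel (P : AHPair.{u}) : VacuumModel (latticePair P) P where
  isoH := (embedEquiv P).symm
  form_isoH _ _ := rfl
  incl := TensorProduct.mk ℂ (Fock P.H) P.A 1
  incl_injective := one_tmul_injective
  map_grade α := by
    obtain ⟨α, rfl⟩ := (embedEquiv P).surjective α
    refine Submodule.ext fun x => ⟨?_, fun hx => ?_⟩
    · rintro ⟨a, ha, rfl⟩
      erw [LinearEquiv.symm_apply_apply] at ha
      exact one_tmul_mem_vacuumSpace ha
    · obtain ⟨a, ha, rfl⟩ := exists_of_mem_vacuumSpace hx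
      refine ⟨a, ?_, rfl⟩
      erw [LinearEquiv.symm_apply_apply]
      exact ha
  incl_one := rfl
  mul_eq_nProd α β v w hv hw := by
    rintro ⟨n, hn⟩
    by_cases h : ∃ N : ℤ, P.form ((embedEquiv P).symm α) ((embedEquiv P).symm β) = N
    · obtain ⟨N, hN⟩ := h
      exact ⟨N, hN, (leading_vertex hN hv hw).symm⟩
    · exact (hn ((nProd_vertex hv n _).trans
        (vertexMode_eq_zero (not_exists.1 h) hw v n 1))).elim
  mul_eq_zero α β v w hv hw h := by
    by_contra h0
    obtain ⟨N, hN⟩ := P.integral_of_mul_ne_zero hv hw h0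
    exact h0 (one_tmul_injective (P := P) ((leading_vertex hN hv hw).symm.trans
      ((h (-N - 1)).trans (TensorProduct.tmul_zero _ _).symm)))

end AHPair

namespace VacuumModel

open VertexAlgebra VHPair

variable {X : VHPair.{u}} {P Q : AHPair.{u}}

/-- The canonical morphism between two identifications of `Ω(V, H)`. -/
def compare (m : VacuumModel X P) (m' : VacuumModel X Q) : P ⟶ Q :=
  m'.lift m.isoH.symm m.incl
    (fun α a ha => m.incl_mem (by rwa [LinearEquiv.apply_symm_apply]))
    (fun α β => by
      rw [← m.form_isoH, LinearEquiv.apply_symm_apply, LinearEquiv.apply_symm_apply])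
    m.incl_one
    (fun α β a ha b hb => m.incl_mul (by rwa [LinearEquiv.apply_symm_apply])
      (by rwa [LinearEquiv.apply_symm_apply]))

theorem incl_alg_compare (m : VacuumModel X P) (m' : VacuumModel X Q) (a : P.A) :
    m'.incl (AHPair.alg (m.compare m') a) = m.incl a := m'.incl_alg_lift _ _ _ _ _ _ a

theorem isom_compare (m : VacuumModel X P) (m' : VacuumModel X Q) (h : P.H) :
    AHPair.isom (m.compare m') h = m'.isoH (m.isoH.symm h) := rfl

theorem compare_comp_compare (m : VacuumModel X P) (m' : VacuumModel X Q) :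
    m.compare m' ≫ m'.compare m = 𝟙 P :=
  m.hom_ext (fun a => by
    rw [AHPair.alg_comp, incl_alg_compare, incl_alg_compare]; rfl) fun h => by
    rw [AHPair.isom_comp, isom_compare, isom_compare, LinearEquiv.symm_apply_apply,
      LinearEquiv.apply_symm_apply]
    rfl

instance isIso_compare (m : VacuumModel X P) (m' : VacuumModel X Q) : IsIso (m.compare m') :=
  ⟨m'.compare m, m.compare_comp_compare m', m'.compare_comp_compare m⟩

end VacuumModel

/-! ### The universal property of the lattice VH pair -/

open TensorAlgebra in
/-- The algebra homomorphism from a symmetric algebra to a not necessarily commutative algebra that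
extends a linear map whose values commute. -/
def symmetricLift {W R : Type*} [AddCommGroup W] [Module ℂ W] [Ring R] [Algebra ℂ R]
    (f : W →ₗ[ℂ] R) (hf : ∀ x y, Commute (f x) (f y)) : SymmetricAlgebra ℂ W →ₐ[ℂ] R :=
  RingCon.liftₐ (symRingCon ℂ W) (TensorAlgebra.lift ℂ f) (RingCon.ringConGen_le.2 (by
    rintro _ _ ⟨x, y⟩
    rw [RingCon.ker_apply]
    simpa using (hf x y).eq))

theorem symmetricLift_ι {W R : Type*} [AddCommGroup W] [Module ℂ W] [Ring R] [Algebra ℂ R]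
    (f : W →ₗ[ℂ] R) (hf : ∀ x y, Commute (f x) (f y)) (w : W) :
    symmetricLift f hf (SymmetricAlgebra.ι ℂ W w) = f w :=
  (TensorAlgebra.lift_ι_apply f w)

open VertexAlgebra VHPair AHPair

/-- The data of a morphism of AH pairs from `(A, H)` to `Ω(V, H)`, as an isometry of the spaces `H`
and a linear map `A → V`. -/
structure VacuumMap (P : AHPair.{u}) (Y : VHPair.{u}) where
  isom : P.H ≃ₗ[ℂ] Y.H
  form_isom : ∀ α β, Y.form (isom α) (isom β) = P.form α β
  map : P.A →ₗ[ℂ] Y.V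
  map_mem : ∀ α, ∀ a ∈ P.grade α, map a ∈ Y.vacuumSpace (isom α)
  map_one : map 1 = vac
  map_mul : ∀ α β, ∀ a ∈ P.grade α, ∀ b ∈ P.grade β,
    map (a * b) = leadingProd (isom α) (isom β) (map a) (map b)

namespace VacuumMap

variable {P : AHPair.{u}} {Y : VHPair.{u}} (μ : VacuumMap P Y)

/-- The linear map `h ⊗ t^(-k-1) ↦ h(-k-1)` into the endomorphisms of `V`. -/
def creators : (ℕ →₀ P.H) →ₗ[ℂ] Module.End ℂ Y.V :=
  Finsupp.lsum ℂ fun k : ℕ => nProd (-1 - k) ∘ₗ Y.H.subtype ∘ₗ μ.isom.toLinearMap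

theorem creators_single (h : P.H) (k : ℕ) :
    μ.creators (Finsupp.single k h) = nProd (-1 - k) (μ.isom h : Y.V) := by
  rw [creators, Finsupp.lsum_single]
  rfl

theorem commute_creators (w w' : ℕ →₀ P.H) : Commute (μ.creators w) (μ.creators w') := by
  induction w using Finsupp.induction_linear with
  | zero => rw [map_zero]; exact Commute.zero_left _
  | add f g hf hg => rw [map_add]; exact hf.add_left hg
  | single k h =>
    induction w' using Finsupp.induction_linear with
    | zero => rw [map_zero]; exact Commute.zero_right _
    | add f g hf hg => rw [map_add]; exact hf.add_right hg
    | single l h' =>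
      rw [creators_single, creators_single]
      refine LinearMap.ext fun v => ?_
      have := Y.heis_comm (μ.isom h) (μ.isom h') (-1 - k) (-1 - l) v
      rwa [if_neg (by omega), add_zero] at this

/-- The action on `V` of the negative half of the Heisenberg algebra. -/
def fockAction : Fock P.H →ₐ[ℂ] Module.End ℂ Y.V := symmetricLift μ.creators μ.commute_creators

theorem fockAction_gen_mul (h : P.H) (k : ℕ) (v : Fock P.H) (y : Y.V) :
    μ.fockAction (Fock.gen h k * v) y = nProd (-1 - k) (μ.isom h : Y.V) (μ.fockAction v y) := by
  rw [_root_.map_mul, Fock.gen, fockAction, symmetricLift_ι, creators_single]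
  rfl

/-- The extension to `M_H(0) ⊗ A` of a map from `A` to the vacuum vectors of `V`. -/
def extend : P.Lattice →ₗ[ℂ] Y.V :=
  TensorProduct.lift (LinearMap.lcomp ℂ Y.V μ.map ∘ₗ μ.fockAction.toLinearMap)

theorem extend_tmul (v : Fock P.H) (a : P.A) : μ.extend (v ⊗ₜ a) = μ.fockAction v (μ.map a) := rfl

theorem extend_one_tmul (a : P.A) : μ.extend (1 ⊗ₜ a) = μ.map a := by
  rw [extend_tmul, _root_.map_one]
  rfl

theorem extend_neg (h : P.H) (k : ℕ) (x : P.Lattice) :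
    μ.extend (heisOp h (-1 - k) x) = nProd (-1 - k) (μ.isom h : Y.V) (μ.extend x) := by
  have : μ.extend ∘ₗ heisOp h (-1 - k) = nProd (-1 - k) (μ.isom h : Y.V) ∘ₗ μ.extend :=
    TensorProduct.ext' fun v a => by
      rw [LinearMap.comp_apply, LinearMap.comp_apply, heisOp_neg, extend_tmul, extend_tmul,
        fockAction_gen_mul]
  exact LinearMap.congr_fun this x

theorem extend_heisOp (h : P.H) (n : ℤ) (x : P.Lattice) :
    μ.extend (heisOp h n x) = nProd n (μ.isom h : Y.V) (μ.extend x) := by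
  rcases lt_or_ge n 0 with hn | hn
  · obtain ⟨k, rfl⟩ : ∃ k : ℕ, n = -1 - k := ⟨(-1 - n).toNat, by omega⟩
    exact μ.extend_neg h k x
  · have : μ.extend ∘ₗ heisOp h n = nProd n (μ.isom h : Y.V) ∘ₗ μ.extend := by
      refine lattice_ext_heisOp (fun β b hb => ?_) fun h' k x ih => ?_
      · have hw := isWeightVector_of_mem (μ.map_mem β b hb)
        rw [LinearMap.comp_apply, LinearMap.comp_apply, extend_one_tmul]
        rcases hn.eq_or_lt with rfl | hn
        · rw [heisOp_zero h hb, map_smul, extend_one_tmul, hw.2, μ.form_isom]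
        · rw [heisOp_pos_one h hn, map_zero, hw.1 _ _ (by omega)]
      · rw [LinearMap.comp_apply, LinearMap.comp_apply] at ih ⊢
        rw [heisOp_comm, map_add, extend_neg, ih, map_smul, extend_neg,
          Y.heis_comm (μ.isom h) (μ.isom h') n (-1 - k), μ.form_isom,
          ite_smul, zero_smul]
    exact LinearMap.congr_fun this x

/-- The series `z^(-(α, β)) Y(a, z) b` in `V` and its counterpart in `M_H(0) ⊗ A` satisfy the same
first-order differential equation and have the same constant term. -/
theorem extend_vertexMode_one {α β : P.H} {N : ℤ} (hN : P.form α β = N) {a b : P.A}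
    (ha : a ∈ P.grade α) (hb : b ∈ P.grade β) (k : ℤ) :
    μ.extend (Fock.creationInt P.form α k 1 ⊗ₜ (a * b)) =
      nProd (-(k + N) - 1) (μ.map a) (μ.map b) := by
  have hN' : Y.form (μ.isom α) (μ.isom β) = N := (μ.form_isom α β).trans hN
  have hv := μ.map_mem α a ha
  have hw := isWeightVector_of_mem (μ.map_mem β b hb)
  induction k using IsExpSeq.induction with
  | neg k hk =>
    rw [(Fock.isExpSeq_creationInt P.isSymm α).of_neg k hk, LinearMap.zero_apply,
      TensorProduct.zero_tmul, map_zero, nProd_eq_zero_of_lt hv hw hN' (by omega)]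
  | zero =>
    rw [(Fock.isExpSeq_creationInt P.isSymm α).zero, Module.End.one_apply, extend_one_tmul,
      μ.map_mul α β a ha b hb, leadingProd_eq hN', zero_add]
  | step k hk ih =>
    refine IsExpSeq.smul_cancel hk ?_
    have h1 := vacuumSpace_recursion hv hw (k + N)
    rw [hN', Int.cast_add, add_sub_cancel_right] at h1
    rw [h1, finsum_eq_sum_of_support_subset (s := Finset.range k.toNat), ← map_smul,
      TensorProduct.smul_tmul', ← LinearMap.smul_apply,
      (Fock.isExpSeq_creationInt P.isSymm α).recursion k k.toNat (by omega), LinearMap.sum_apply,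
      TensorProduct.sum_tmul, map_sum]
    · refine Finset.sum_congr rfl fun i _ => ?_
      rw [Module.End.mul_apply, ← heisOp_of_ne α (by omega), extend_heisOp, ih _ (by omega),
        show -(k - 1 - (i : ℤ) + N) - 1 = -(k + N) + i by ring]
    · intro i hi
      by_contra hi'
      simp only [Finset.coe_range, Set.mem_Iio, not_lt] at hi'
      refine hi ?_
      dsimp only
      rw [nProd_eq_zero_of_lt hv hw hN' (by omega), map_zero]

theorem extend_vertexMode {α : P.H} {a : P.A} (ha : a ∈ P.grade α) (n : ℤ) (x : P.Lattice) :
    μ.extend (vertexMode α a n x) = nProd n (μ.map a) (μ.extend x) := by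
  have key : ∀ β, ∀ b ∈ P.grade β, ∀ (v : Fock P.H) (n : ℤ),
      μ.extend (vertexMode α a n (v ⊗ₜ b)) = nProd n (μ.map a) (μ.extend (v ⊗ₜ b)) := by
    intro β b hb v
    induction v using Fock.induction with
    | one =>
      intro n
      rw [extend_one_tmul]
      by_cases h : ∃ N : ℤ, P.form α β = N
      · obtain ⟨N, hN⟩ := h
        rw [vertexMode_one hN hb, μ.extend_vertexMode_one hN ha hb,
          show -(-n - 1 - N + N) - 1 = n by ring]
      · rw [vertexMode_eq_zero (not_exists.1 h) hb, map_zero,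
          nProd_eq_zero_of_nonintegral (μ.map_mem α a ha)
            (isWeightVector_of_mem (μ.map_mem β b hb)) (by rwa [μ.form_isom])]
    | gen_mul h k v ih =>
      intro n
      have h1 := heisOp_vertexMode h ha (-1 - k) n (v ⊗ₜ b)
      have h2 := heis_vacuumSpace_comm (μ.map_mem α a ha) (μ.isom h) (-1 - k) n
        (μ.extend (v ⊗ₜ b))
      rw [← ih, ← extend_heisOp, h1, map_add, map_smul, ih, μ.form_isom,
        show n + (-1 - (k : ℤ)) = -1 - k + n by ring, add_comm, ← extend_heisOp] at h2
      rw [← heisOp_neg]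
      exact add_left_cancel h2
    | add v w hv hw =>
      intro n
      simp only [TensorProduct.add_tmul, map_add, hv, hw]
    | smul c v hv =>
      intro n
      simp only [← TensorProduct.smul_tmul', map_smul, hv]
  have : μ.extend ∘ₗ vertexMode α a n = nProd n (μ.map a) ∘ₗ μ.extend :=
    lattice_ext fun β b hb v => key β b hb v n
  exact LinearMap.congr_fun this x

theorem extend_vac : μ.extend (1 ⊗ₜ 1) = vac := by
  rw [extend_one_tmul, μ.map_one]

theorem extend_embed (h : P.H) : μ.extend (embed P h) = μ.isom h := by
  rw [embed_apply, ← heisOp_neg_one, extend_heisOp, extend_vac, nProd_neg_one_vac]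

/-- It suffices to let `x` run through a space stable under the generating fields, and there
`extend_heisOp` and `extend_vertexMode` apply. -/
theorem extend_nProd (n : ℤ) (x y : P.Lattice) :
    μ.extend (nProd n x y) = nProd n (μ.extend x) (μ.extend y) := by
  let W : Submodule ℂ P.Lattice :=
    { carrier := {x | ∀ n y, μ.extend (nProd n x y) = nProd n (μ.extend x) (μ.extend y)}
      zero_mem' := fun n y => by simp
      add_mem' := fun hx hx' n y => by simp [hx n y, hx' n y]
      smul_mem' := fun c x hx n y => by simp [hx n y] }
  suffices h : W = ⊤ by
    have : x ∈ W := by rw [h]; trivial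
    exact this n y
  refine eq_top_of_stable (fun n y => ?_) fun a ha n x hx => ?_
  · rw [extend_vac, ← lattice_vac, nProd_vac_left, nProd_vac_left]
    split_ifs
    · rfl
    · exact map_zero _
  · cases ha with
    | heis h =>
      change heisOp h n x ∈ W
      rw [← nProd_heis]
      refine map_nProd_closed μ.extend n (fun n y => ?_) hx
      rw [nProd_heis, extend_heisOp]
      exact congrArg (fun z => nProd n z _) (μ.extend_embed h).symm
    | vertex α a ha =>
      change vertexMode α a n x ∈ W
      rw [← nProd_vertex ha]
      refine map_nProd_closed μ.extend n (fun n y => ?_) hx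
      rw [nProd_vertex ha, μ.extend_vertexMode ha, extend_one_tmul]

/-- The morphism of VH pairs that extends a map from `A` to the vacuum vectors. -/
def hom : latticePair P ⟶ Y where
  toLinearMap := μ.extend
  map_vac := μ.extend_vac
  map_nProd := μ.extend_nProd
  map_H := by
    refine Submodule.ext fun y => ⟨?_, fun hy => ?_⟩
    · rintro ⟨_, ⟨h, rfl⟩, rfl⟩
      exact (μ.extend_embed h).symm ▸ (μ.isom h).2
    · obtain ⟨h, hh⟩ := μ.isom.surjective ⟨y, hy⟩
      exact ⟨embed P h, ⟨h, rfl⟩, (μ.extend_embed h).trans (congrArg Subtype.val hh)⟩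

end VacuumMap

/-- A morphism to `Ω(V, H)` as a linear map to `V`. -/
def vacuumMapOfHom {P : AHPair.{u}} {Y : VHPair.{u}} (f : P ⟶ vacuumFunctor.obj Y) :
    VacuumMap P Y where
  isom := AHPair.isom f
  form_isom := AHPair.Hom.map_form f
  map := Y.vacuumModel.incl ∘ₗ (AHPair.alg f).toLinearMap
  map_mem α a ha := Y.vacuumModel.incl_mem (AHPair.Hom.map_grade f α a ha)
  map_one := (congrArg Y.vacuumModel.incl (map_one (AHPair.alg f))).trans Y.vacuumModel.incl_one
  map_mul α β a ha b hb := by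
    have h1 := AHPair.Hom.map_grade f α a ha
    have h2 := AHPair.Hom.map_grade f β b hb
    exact (congrArg Y.vacuumModel.incl (map_mul (AHPair.alg f) a b)).trans
      (Y.vacuumModel.incl_mul h1 h2)

namespace AHPair

/-- The unit of the adjunction, `a ↦ 𝟏 ⊗ a`. -/
def unitHom (P : AHPair.{u}) : P ⟶ vacuumFunctor.obj (latticePair P) :=
  (latticeVacuumModel P).compare (latticePair P).vacuumModel

variable {P Q : AHPair.{u}} {Y : VHPair.{u}}

theorem incl_unitHom (a : P.A) :
    (latticePair P).vacuumModel.incl (alg (unitHom P) a) = (1 : Fock P.H) ⊗ₜ[ℂ] a :=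
  VacuumModel.incl_alg_compare _ _ a

/-- The linear map underlying a morphism out of the lattice VH pair. -/
def latticeLin (F : latticePair P ⟶ Y) : P.Lattice →ₗ[ℂ] Y.V := lin F

theorem incl_transpose (F : latticePair P ⟶ Y) (a : P.A) :
    Y.vacuumModel.incl (alg (unitHom P ≫ vacuumFunctor.map F) a) =
      latticeLin F ((1 : Fock P.H) ⊗ₜ[ℂ] a) := by
  rw [alg_comp, ← incl_unitHom]
  exact incl_vacuumMap F _

theorem isom_transpose (F : latticePair P ⟶ Y) (h : P.H) :
    (Y.vacuumModel.isoH.symm (isom (unitHom P ≫ vacuumFunctor.map F) h) : Y.V) =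
      latticeLin F (embed P h) := rfl

theorem latticeLin_heisOp (F : latticePair P ⟶ Y) (h : P.H) (n : ℤ) (x : P.Lattice) :
    latticeLin F (heisOp h n x) = nProd n (latticeLin F (embed P h)) (latticeLin F x) := by
  rw [← nProd_heis]
  exact lin_nProd F n _ _

/-- A morphism out of the lattice VH pair is determined by its values on `H` and on `𝟏 ⊗ A`. -/
theorem latticePair_hom_ext {F G : latticePair P ⟶ Y}
    (h1 : ∀ a : P.A, latticeLin F ((1 : Fock P.H) ⊗ₜ[ℂ] a) = latticeLin G ((1 : Fock P.H) ⊗ₜ[ℂ] a))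
    (h2 : ∀ h, latticeLin F (embed P h) = latticeLin G (embed P h)) : F = G := by
  have : latticeLin F = latticeLin G :=
    lattice_ext_heisOp (fun β b _ => h1 b) fun h k x ih => by
      rw [latticeLin_heisOp, latticeLin_heisOp, ih, h2]
  exact VHPair.hom_ext fun v => LinearMap.congr_fun this v

/-- The universal property of the lattice VH pair: every morphism to `Ω(V, H)` factors uniquely
through the unit. -/
theorem bijective_transpose (P : AHPair.{u}) (Y : VHPair.{u}) :
    Function.Bijective fun F : latticePair P ⟶ Y => unitHom P ≫ vacuumFunctor.map F := by
  refine ⟨fun F G h => latticePair_hom_ext (fun a => ?_) fun x => ?_, fun f => ?_⟩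
  · rw [← incl_transpose, ← incl_transpose]
    exact congrArg (fun f => Y.vacuumModel.incl (alg f a)) h
  · rw [← isom_transpose, ← isom_transpose]
    exact congrArg (fun f => (Y.vacuumModel.isoH.symm (isom f x) : Y.V)) h
  · refine ⟨(vacuumMapOfHom f).hom, Y.vacuumModel.hom_ext (fun a => ?_) fun x => ?_⟩
    · refine (incl_transpose _ a).trans ?_
      exact (vacuumMapOfHom f).extend_one_tmul a
    · refine Subtype.ext ?_
      exact (isom_transpose _ x).trans ((vacuumMapOfHom f).extend_embed x)

/-- The adjunction bijection. -/
def transposeEquiv (P : AHPair.{u}) (Y : VHPair.{u}) :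
    (latticePair P ⟶ Y) ≃ (P ⟶ vacuumFunctor.obj Y) :=
  Equiv.ofBijective _ (bijective_transpose P Y)

theorem transposeEquiv_apply (F : latticePair P ⟶ Y) :
    transposeEquiv P Y F = unitHom P ≫ vacuumFunctor.map F := rfl

theorem transposeEquiv_id : transposeEquiv P (latticePair P) (𝟙 _) = unitHom P := by
  rw [transposeEquiv_apply, CategoryTheory.Functor.map_id, Category.comp_id]

theorem transposeEquiv_comp {Y' : VHPair.{u}} (g : Y ⟶ Y') (F : latticePair P ⟶ Y) :
    transposeEquiv P Y' (F ≫ g) = transposeEquiv P Y F ≫ vacuumFunctor.map g := by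
  rw [transposeEquiv_apply, transposeEquiv_apply, Functor.map_comp, Category.assoc]

end AHPair

/-- The functor `𝒱`. -/
def latticeFunctor : AHPair.{u} ⥤ VHPair.{u} :=
  Adjunction.leftAdjointOfEquiv (G := vacuumFunctor.{u}) AHPair.transposeEquiv
    fun _ _ _ g F => AHPair.transposeEquiv_comp g F

/-- The adjunction between `𝒱` and `Ω`. -/
def latticeAdjunction : latticeFunctor.{u} ⊣ vacuumFunctor.{u} :=
  Adjunction.adjunctionOfEquivLeft AHPair.transposeEquiv
    fun _ _ _ g F => AHPair.transposeEquiv_comp g F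

theorem unit_latticeAdjunction (P : AHPair.{u}) :
    latticeAdjunction.{u}.unit.app P = AHPair.unitHom P := by
  refine Eq.trans ?_ (AHPair.transposeEquiv_id (P := P))
  simp only [latticeAdjunction, Adjunction.adjunctionOfEquivLeft_unit_app]
  rfl

instance isIso_unit_latticeAdjunction : IsIso latticeAdjunction.{u}.unit := by
  have : ∀ P, IsIso (latticeAdjunction.{u}.unit.app P) := fun P => by
    rw [unit_latticeAdjunction]
    exact VacuumModel.isIso_compare _ _
  exact NatIso.isIso_of_isIso_app _

/-- Naturality of the unit. -/
theorem transpose_latticeFunctor_map {P Q : AHPair.{u}} (f : P ⟶ Q) :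
    AHPair.unitHom P ≫ vacuumFunctor.map (latticeFunctor.map f : AHPair.latticePair P ⟶ _) =
      f ≫ AHPair.unitHom Q := by
  rw [← AHPair.transposeEquiv_id (P := Q)]
  exact (AHPair.transposeEquiv P (AHPair.latticePair Q)).apply_symm_apply _

/-- The left adjoint acts on morphisms by `M(f') ⊗ f`. -/
theorem lin_latticeFunctor_map {P Q : AHPair.{u}} (f : P ⟶ Q) (v : Fock P.H) (a : P.A) :
    AHPair.latticeLin (Y := AHPair.latticePair Q) (latticeFunctor.map f) (v ⊗ₜ[ℂ] a) =
      Fock.map (AHPair.isom f).toLinearMap v ⊗ₜ[ℂ] AHPair.alg f a := by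
  have ht := transpose_latticeFunctor_map f
  set F : AHPair.latticePair P ⟶ AHPair.latticePair Q := latticeFunctor.map f
  have h1 : ∀ a, AHPair.latticeLin F ((1 : Fock P.H) ⊗ₜ[ℂ] a) = (1 : Fock Q.H) ⊗ₜ[ℂ] AHPair.alg f a
      := fun a => by
    rw [← AHPair.incl_transpose, ← AHPair.incl_unitHom]
    exact congrArg (fun g => (AHPair.latticePair Q).vacuumModel.incl (AHPair.alg g a)) ht
  have h2 : ∀ h, AHPair.latticeLin F (AHPair.embed P h) = AHPair.embed Q (AHPair.isom f h) :=
      fun h => by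
    rw [← AHPair.isom_transpose]
    exact congrArg (fun g => ((AHPair.latticePair Q).vacuumModel.isoH.symm (AHPair.isom g h) :
      (AHPair.latticePair Q).V)) ht
  induction v using Fock.induction with
  | one => rw [h1, map_one]
  | gen_mul h k v ih =>
    have h3 : Fock.map (AHPair.isom f).toLinearMap (Fock.gen h k) =
        Fock.gen (AHPair.isom f h) k := by
      simp [Fock.map, Fock.gen]
    rw [← AHPair.heisOp_neg, AHPair.latticeLin_heisOp, ih, h2, map_mul, h3, ← AHPair.heisOp_neg]
    exact AHPair.nProd_heis _ _ _
  | add v w hv hw =>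
    rw [TensorProduct.add_tmul, map_add, hv, hw, map_add, TensorProduct.add_tmul]
    rfl
  | smul c v hv =>
    rw [← TensorProduct.smul_tmul', map_smul, hv, map_smul, ← TensorProduct.smul_tmul']
    rfl

theorem isLatticeFunctor_latticeFunctor : IsLatticeFunctor latticeFunctor.{u} :=
  ⟨fun P => AHPair.latticeModel P, fun _ _ f v a => lin_latticeFunctor_map f v a⟩

end VertexPair

end

theorem mainTheorem3 :
    ∃ (𝒱 : VertexPair.AHPair.{u} ⥤ VertexPair.VHPair.{u})
      (Ω : VertexPair.VHPair.{u} ⥤ VertexPair.AHPair.{u}),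
      VertexPair.IsLatticeFunctor 𝒱 ∧ VertexPair.IsVacuumFunctor Ω ∧
        Nonempty (𝒱 ⊣ Ω) ∧ Nonempty (𝒱 ⋙ Ω ≅ 𝟭 VertexPair.AHPair.{u}) :=
  ⟨VertexPair.latticeFunctor, VertexPair.vacuumFunctor,
    VertexPair.isLatticeFunctor_latticeFunctor, VertexPair.isVacuumFunctor_vacuumFunctor,
    ⟨VertexPair.latticeAdjunction⟩, ⟨(asIso VertexPair.latticeAdjunction.unit).symm⟩⟩
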